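/- **Definitions.** A *multigraph* may have loops and multiple edges; the $(u,v)$ entry of its adjacency matrix is the number of edges with ends $u,v$, and the degree of a vertex is the number of edges incident to it (so a loop counts once in both). A *cubic multigraph* is a finite connected multigraph in which every degree is $3$; a *cubic graph* is a cubic multigraph without loops and multiple edges. $\sigma(Y)$ denotes the spectrum of the adjacency matrix of $Y$. Planar means drawable in $\mathbb{R}^2$ without crossings. A closed set $K\subset[-3,3]$ is *spectral* for a class of cubic multigraphs if there are arbitrarily large $Y$ in the class with $\sigma(Y)\subset K$; a *gap set* for the class is the complement in $[-3,3]$ of a spectral set. A *gap interval* is an interval that is a gap set for the class of cubic graphs, and a *maximal gap interval* is one that is not properly contained in another gap interval. Let $\bar W_b$ be the infinite graph with vertices $(k,i)$, $k\in\mathbb{Z}$, $i\in\{0,1\}$, in which $(k,i)$ is joined to $(k+1,j)$ exactly when $k$ is even or $i=j$; its $h$-th unit cell consists of the columns $2h,2h+1$. Let $\bar W_a$ be the infinite graph on the same vertices in which $(k,i)$ is joined to $(k+1,j)$ exactly when $3\mid k$ or $i=j$, and moreover $(k,0)$ is joined to $(k,1)$ exactly when $k\equiv 2\pmod 3$; its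 $h$-th unit cell consists of the columns $3h,3h+1,3h+2$. Both are cubic and periodic under the infinite cyclic group of translations by unit cells. For an integer $m$ let $\rho_m(k,i)=(m-k,1-i)$ (rotation by $\pi$ about the point of the central axis with horizontal coordinate $m/2$); it is an automorphism of $\bar W_b$ if $m\equiv 3 \pmod 4$, and of $\bar W_a$ if $m\equiv 1\pmod 3$. The quotient of a graph by a group of automorphisms is the multigraph whose vertices and edges are the orbits of vertices and of edges. Put $$W_b(n)=\bar W_b/\langle (k,i)\mapsto(k+2n,i)\rangle,\quad W_a(n)=\bar W_a/\langle (k,i)\mapsto(k+3n,i)\rangle,\quad P_b(n)=\bar W_b/\langle\rho_{-1},\rho_{4n-1}\rangle,$$ $$P_a(n)=\bar W_a/\langle\rho_{-2},\rho_{6n-2}\rangle,\qquad Q_a(n)=\bar W_a/\langle\rho_{1},\rho_{6n+1}\rangle .$$ **Theorem 3.** The intervals $(-1,1)$ and $(-2,0)$ are maximal gap intervals. The interval $(-1,1)$ is a gap set for the class of planar cubic graphs, and $(-2,0)$ is a gap set for the class of planar cubic multigraphs. More precisely: 1. For every $n\ge 1$, $P_b(n)$ is a planar cubic graph with $4n$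 vertices and no eigenvalue in $(-1,1)$. 2. For every $n\ge 1$, $P_a(n)$ and $Q_a(n)$ are planar cubic multigraphs with $6n$ vertices and no eigenvalue in $(-2,0)$. 3. For every $n\ge 2$, $W_b(n)$ is a cubic graph with $4n$ vertices and no eigenvalue in $(-1,1)$; it is not planar if $n\ge 3$. 4. For every $n\ge 1$, $W_a(n)$ is a cubic graph with $6n$ vertices and no eigenvalue in $(-2,0)$; it is not planar if $n\ge 2$. -/

import Mathlib

open scoped Graph

namespace CubicGaps

/-! ### Finite multigraphs: adjacency matrix, spectrum, regularity -/

section Basic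

variable {α β : Type*}

/-- The adjacency matrix of a multigraph: the `(u, v)` entry is the number of edges with ends
`u` and `v`. In particular every loop at `u` contributes `1` to the `(u, u)` entry. -/
noncomputable def adjMatrix (G : Graph α β) : Matrix V(G) V(G) ℝ :=
  Matrix.of fun u v => ({e : β | G.IsLink e u v}.ncard : ℝ)

/-- The spectrum of the adjacency matrix of a multigraph with finitely many vertices. -/
noncomputable def adjSpectrum (G : Graph α β) [Finite V(G)] : Set ℝ :=
  letI : Fintype V(G) := Fintype.ofFinite V(G)
  letI : DecidableEq V(G) := Classical.decEq V(G)
  spectrum ℝ (adjMatrix G)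

/-- A connected `3`-regular multigraph. The degree of a vertex is the number of edges incident
to it, a loop being counted once (as in the adjacency matrix, whose row sums are therefore the
degrees). -/
structure IsCubic (G : Graph α β) : Prop where
  connected : G.toSimpleGraph.Connected
  degree_eq : ∀ v ∈ V(G), (G.incidenceSet v).ncard = 3

/-- A multigraph is planar if it can be drawn in the plane `ℂ = ℝ²`: the vertices are placed at
distinct points, each edge is a continuous curve joining its two ends, and the open edges are
injective curves, pairwise disjoint, that do not pass through vertices. -/
def IsPlanar (G : Graph α β) : Prop :=
  ∃ (p : V(G) → ℂ) (γ : E(G) → C(unitInterval, ℂ)),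
    Function.Injective p ∧
    (∀ e : E(G), ∃ u v : V(G), G.IsLink e u v ∧ γ e 0 = p u ∧ γ e 1 = p v) ∧
    (∀ e e' : E(G), ∀ s ∈ Set.Ioo (0 : unitInterval) 1, ∀ t ∈ Set.Ioo (0 : unitInterval) 1,
      γ e s = γ e' t → e = e' ∧ s = t) ∧
    (∀ e : E(G), ∀ s ∈ Set.Ioo (0 : unitInterval) 1, ∀ v : V(G), γ e s ≠ p v)

end Basic

/-! ### Spectral sets, gap sets and gap intervals -/

/-- `K` is a spectral set for a class `P` of multigraphs: a closed subset of `[-3, 3]` such that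
arbitrarily large connected cubic multigraphs in the class have their spectrum in `K`. -/
def IsSpectralFor (P : ∀ ⦃α β : Type⦄, Graph α β → Prop) (K : Set ℝ) : Prop :=
  IsClosed K ∧ K ⊆ Set.Icc (-3) 3 ∧
    ∀ N : ℕ, ∃ (α β : Type) (G : Graph α β) (_ : Finite V(G)),
      IsCubic G ∧ P G ∧ N ≤ Nat.card V(G) ∧ adjSpectrum G ⊆ K

/-- `U` is a gap set for `P`: the complement in `[-3, 3]` of a spectral set for `P`. -/
def IsGapSetFor (P : ∀ ⦃α β : Type⦄, Graph α β → Prop) (U : Set ℝ) : Prop :=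
  ∃ K : Set ℝ, IsSpectralFor P K ∧ U = Set.Icc (-3) 3 \ K

/-- Gap sets for cubic graphs (no loops, no multiple edges). -/
def IsGapSet (U : Set ℝ) : Prop :=
  IsGapSetFor (fun _ _ G => G.Simple) U

/-- Gap sets for planar cubic graphs (no loops, no multiple edges). -/
def IsPlanarGapSet (U : Set ℝ) : Prop :=
  IsGapSetFor (fun _ _ G => G.Simple ∧ IsPlanar G) U

/-- Gap sets for planar cubic multigraphs (loops and multiple edges are allowed). -/
def IsPlanarMultigraphGapSet (U : Set ℝ) : Prop :=
  IsGapSetFor (fun _ _ G => IsPlanar G) U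

/-- A gap interval is a gap set for cubic graphs that is an interval. -/
def IsGapInterval (I : Set ℝ) : Prop :=
  I.OrdConnected ∧ IsGapSet I

/-! ### Quotients of graphs by groups of automorphisms -/

section Quotient

variable {V : Type*} (W : SimpleGraph V) (Γ : Subgroup (W ≃g W))

/-- Two unordered pairs of vertices are equivalent if an element of `Γ` maps one to the other. -/
def edgeSetoid : Setoid (Sym2 V) where
  r e e' := ∃ g ∈ Γ, e.map g = e'
  iseqv :=
    { refl := fun e => ⟨1, Γ.one_mem, by
        have : ((1 : W ≃g W) : V → V) = id := rfl
        rw [this, Sym2.map_id, id]⟩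
      symm := by
        rintro e e' ⟨g, hg, rfl⟩
        refine ⟨g⁻¹, Γ.inv_mem hg, ?_⟩
        rw [Sym2.map_map]
        have : (((g⁻¹ : W ≃g W) : V → V) ∘ (g : V → V)) = id := by
          funext x
          exact g.symm_apply_apply x
        rw [this, Sym2.map_id, id]
      trans := by
        rintro e e' e'' ⟨g, hg, rfl⟩ ⟨g', hg', rfl⟩
        refine ⟨g' * g, Γ.mul_mem hg' hg, ?_⟩
        rw [Sym2.map_map]
        rfl }

/-- The quotient multigraph `W / Γ`: its vertices are the `Γ`-orbits of vertices of `W`, its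
edges are the `Γ`-orbits of edges of `W`. An edge of `W` whose ends lie in the same orbit gives
a loop. -/
def quotientGraph :
    Graph (MulAction.orbitRel.Quotient Γ V) (Quotient (edgeSetoid W Γ)) where
  vertexSet := Set.univ
  IsLink e x y := ∃ u v : V, W.Adj u v ∧ e = Quotient.mk _ s(u, v) ∧
    x = Quotient.mk _ u ∧ y = Quotient.mk _ v
  isLink_symm := by
    rintro e -
    refine ⟨?_⟩
    rintro x y ⟨u, v, h, rfl, rfl, rfl⟩
    exact ⟨v, u, h.symm, by rw [Sym2.eq_swap], rfl, rfl⟩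
  eq_or_eq_of_isLink_of_isLink := by
    rintro e x y z w ⟨u, v, -, rfl, rfl, rfl⟩ ⟨u', v', -, he, rfl, rfl⟩
    obtain ⟨g, hg, hgu⟩ := Quotient.exact he
    have key : ∀ a b : V, g a = b →
        (Quotient.mk (MulAction.orbitRel Γ V) a) = Quotient.mk _ b := by
      intro a b hab
      refine Quotient.sound ?_
      refine (MulAction.orbitRel Γ V).symm ?_
      exact ⟨⟨g, hg⟩, hab⟩
    rw [Sym2.map_mk, Sym2.eq_iff] at hgu
    rcases hgu with ⟨h1, -⟩ | ⟨h1, -⟩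
    · exact Or.inl (key _ _ h1)
    · exact Or.inr (key _ _ h1)
  left_mem_of_isLink := fun _ _ _ _ => Set.mem_univ _

end Quotient

/-! ### The infinite graph `Wbar_b` and its quotients

The vertices are arranged in columns indexed by `ℤ` with two rows, `true` and `false`. -/

/-- `Wbar_b`: unit cell number `h` consists of the columns `2h` and `2h + 1`, all four pairs
between them being edges (an "hourglass", that is a `4`-cycle in which the vertices of each column
are opposite corners); column `2h + 1` is joined to column `2h + 2` by two edges along the rows. -/
def WbarB : SimpleGraph (ℤ × Bool) where
  Adj u v := (v.1 = u.1 + 1 ∧ (u.1 % 2 = 0 ∨ u.2 = v.2)) ∨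
    (u.1 = v.1 + 1 ∧ (v.1 % 2 = 0 ∨ u.2 = v.2))
  symm := ⟨by
    rintro u v (⟨h, h'⟩ | ⟨h, h'⟩)
    · exact Or.inr ⟨h, h'.imp id Eq.symm⟩
    · exact Or.inl ⟨h, h'.imp id Eq.symm⟩⟩
  loopless := ⟨by
    rintro u (⟨h, -⟩ | ⟨h, -⟩) <;> omega⟩

/-- Translation of `Wbar_b` by `n` unit cells. -/
def transB (n : ℤ) : WbarB ≃g WbarB where
  toFun u := (u.1 + 2 * n, u.2)
  invFun u := (u.1 - 2 * n, u.2)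
  left_inv u := by simp
  right_inv u := by simp
  map_rel_iff' := by
    rintro ⟨k, i⟩ ⟨l, j⟩
    simp only [WbarB, Equiv.coe_fn_mk]
    have h1 : (k + 2 * n) % 2 = k % 2 := by omega
    have h2 : (l + 2 * n) % 2 = l % 2 := by omega
    have h3 : (l + 2 * n = k + 2 * n + 1) ↔ l = k + 1 := by omega
    have h4 : (k + 2 * n = l + 2 * n + 1) ↔ k = l + 1 := by omega
    rw [h1, h2, h3, h4]

/-- Rotation of `Wbar_b` by `π` about the point midway between the unit cells `h - 1` and `h`
(that is, midway between the columns `2h - 1` and `2h`, on the central axis). -/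
def rotB (h : ℤ) : WbarB ≃g WbarB where
  toFun u := (4 * h - 1 - u.1, !u.2)
  invFun u := (4 * h - 1 - u.1, !u.2)
  left_inv u := by simp
  right_inv u := by simp
  map_rel_iff' := by
    rintro ⟨k, i⟩ ⟨l, j⟩
    simp only [WbarB, Equiv.coe_fn_mk, Bool.not_inj_iff]
    constructor
    · rintro (⟨h1, h2⟩ | ⟨h1, h2⟩)
      · exact Or.inr ⟨by omega, h2.imp (by omega) id⟩
      · exact Or.inl ⟨by omega, h2.imp (by omega) id⟩
    · rintro (⟨h1, h2⟩ | ⟨h1, h2⟩)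
      · exact Or.inr ⟨by omega, h2.imp (by omega) id⟩
      · exact Or.inl ⟨by omega, h2.imp (by omega) id⟩

/-- The hamburger graph `W_b(n)`: the quotient of `Wbar_b` by the translation by `n` unit cells. -/
def hamburgerB (n : ℕ) :=
  quotientGraph WbarB (Subgroup.zpowers (transB n))

/-- `P_b(n)`: the quotient of `Wbar_b` by the group generated by two rotations whose centres are
`n` unit cells apart. -/
def capB (n : ℕ) :=
  quotientGraph WbarB (Subgroup.closure {rotB 0, rotB n})

/-! ### The infinite graph `Wbar_a` and its quotients -/

/-- `Wbar_a`: unit cell number `h` consists of the columns `3h`, `3h + 1`, `3h + 2`; all four pairs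
between the columns `3h` and `3h + 1` are edges (an hourglass), column `3h + 1` is joined to
column `3h + 2`, and column `3h + 2` to column `3h + 3`, by two edges along the rows, and the two
vertices of column `3h + 2` are joined to each other (a vertical bar). -/
def WbarA : SimpleGraph (ℤ × Bool) where
  Adj u v := (v.1 = u.1 + 1 ∧ (u.1 % 3 = 0 ∨ u.2 = v.2)) ∨
    (u.1 = v.1 + 1 ∧ (v.1 % 3 = 0 ∨ u.2 = v.2)) ∨
    (u.1 = v.1 ∧ u.1 % 3 = 2 ∧ u.2 ≠ v.2)
  symm := ⟨by
    rintro u v (⟨h, h'⟩ | ⟨h, h'⟩ | ⟨h, h', h''⟩)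
    · exact Or.inr (Or.inl ⟨h, h'.imp id Eq.symm⟩)
    · exact Or.inl ⟨h, h'.imp id Eq.symm⟩
    · exact Or.inr (Or.inr ⟨h.symm, h ▸ h', h''.symm⟩)⟩
  loopless := ⟨by
    rintro u (⟨h, -⟩ | ⟨h, -⟩ | ⟨-, -, h⟩)
    · omega
    · omega
    · exact h rfl⟩

/-- Translation of `Wbar_a` by `n` unit cells. -/
def transA (n : ℤ) : WbarA ≃g WbarA where
  toFun u := (u.1 + 3 * n, u.2)
  invFun u := (u.1 - 3 * n, u.2)
  left_inv u := by simp
  right_inv u := by simp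
  map_rel_iff' := by
    rintro ⟨k, i⟩ ⟨l, j⟩
    simp only [WbarA, Equiv.coe_fn_mk]
    have h1 : (k + 3 * n) % 3 = k % 3 := by omega
    have h2 : (l + 3 * n) % 3 = l % 3 := by omega
    have h3 : (l + 3 * n = k + 3 * n + 1) ↔ l = k + 1 := by omega
    have h4 : (k + 3 * n = l + 3 * n + 1) ↔ k = l + 1 := by omega
    have h5 : (k + 3 * n = l + 3 * n) ↔ k = l := by omega
    rw [h1, h2, h3, h4, h5]

/-- The reflection-and-flip `(k, i) ↦ (m - k, not i)`, that is, the rotation by `π` about the point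
of the central axis with horizontal coordinate `m / 2`; it preserves `Wbar_a` if `m % 3 = 1`. -/
def rotA (m : ℤ) (hm : m % 3 = 1) : WbarA ≃g WbarA where
  toFun u := (m - u.1, !u.2)
  invFun u := (m - u.1, !u.2)
  left_inv u := by simp
  right_inv u := by simp
  map_rel_iff' := by
    rintro ⟨k, i⟩ ⟨l, j⟩
    simp only [WbarA, Equiv.coe_fn_mk, ne_eq, Bool.not_inj_iff]
    constructor
    · rintro (⟨h1, h2⟩ | ⟨h1, h2⟩ | ⟨h1, h2, h3⟩)
      · exact Or.inr (Or.inl ⟨by omega, h2.imp (by omega) id⟩)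
      · exact Or.inl ⟨by omega, h2.imp (by omega) id⟩
      · exact Or.inr (Or.inr ⟨by omega, by omega, h3⟩)
    · rintro (⟨h1, h2⟩ | ⟨h1, h2⟩ | ⟨h1, h2, h3⟩)
      · exact Or.inr (Or.inl ⟨by omega, h2.imp (by omega) id⟩)
      · exact Or.inl ⟨by omega, h2.imp (by omega) id⟩
      · exact Or.inr (Or.inr ⟨by omega, by omega, h3⟩)

/-- Rotation of `Wbar_a` by `π` about the midpoint of the vertical bar of unit cell `h - 1`
(column `3h - 1`). -/
def rotBar (h : ℤ) : WbarA ≃g WbarA := rotA (6 * h - 2) (by omega)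

/-- Rotation of `Wbar_a` by `π` about the centre of the hourglass of unit cell `h`
(midway between the columns `3h` and `3h + 1`). -/
def rotHourglass (h : ℤ) : WbarA ≃g WbarA := rotA (6 * h + 1) (by omega)

/-- The hamburger graph `W_a(n)`: the quotient of `Wbar_a` by the translation by `n` unit cells. -/
def hamburgerA (n : ℕ) :=
  quotientGraph WbarA (Subgroup.zpowers (transA n))

/-- `P_a(n)`: the quotient of `Wbar_a` by the group generated by the rotations about the midpoints
of two vertical bars that are `n` unit cells apart. -/
def capBarA (n : ℕ) :=
  quotientGraph WbarA (Subgroup.closure {rotBar 0, rotBar n})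

/-- `Q_a(n)`: the quotient of `Wbar_a` by the group generated by the rotations about the centres
of two hourglasses that are `n` unit cells apart. -/
def capHourglassA (n : ℕ) :=
  quotientGraph WbarA (Subgroup.closure {rotHourglass 0, rotHourglass n})

/-- `G` is a connected cubic multigraph with exactly `m` vertices and without eigenvalues in
`I`. -/
def IsGappedCubic {α β : Type*} (G : Graph α β) (m : ℕ) (I : Set ℝ) : Prop :=
  ∃ _ : Finite V(G), IsCubic G ∧ Nat.card V(G) = m ∧ Disjoint (adjSpectrum G) I

end CubicGaps

open CubicGaps

/-! The gaps. Each finite graph is the quotient of an infinite two-row strip by a group that fixes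
no vertex except trivially and in which an element moving a vertex to a neighbour exchanges the two
(`IsAlmostFree`). The edges at a vertex of the quotient then correspond to the three neighbours of
any lift (`IsAlmostFree.mkE_injective`), so the quotient is cubic and an eigenvector pulls back to
an eigenfunction on the strip with finitely many values (`exists_lift_of_mem_adjSpectrum`). Split it
into the sum and the difference of the two rows. The difference does not see the hourglasses, so it
lives on finite pieces with eigenvalues ±1 for `WbarB` and -2, 0, 1 for `WbarA`. The sum satisfies a
recurrence along the columns, and a maximum principle forces it to vanish for μ in the gap
(`EigenB.eq_zero`, `EigenA.eq_zero`).

Maximality. If a cubic graph has no eigenvalue in (c - r, c + r), then (A - c)² - r² is positive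
semidefinite. Test it along a long geodesic against the real and imaginary parts of exp(i j θ),
where 2 cos θ = c₀ lies in [-√2, 0]. There cos θ ≤ 0 and cos 2θ ≤ 0, so common neighbours beyond
those forced by the geodesic only decrease the quadratic form, and each vertex contributes at most 1
+ (c - c₀)² - r², up to boundary terms. If this is negative, long geodesics are impossible; but
large cubic graphs contain them. A gap interval that properly extends (c₀ - 1, c₀ + 1) would supply
such c and r, with r slightly above 1 (`IsGapInterval.maximal`).

Non-planarity. The hamburger graphs have a K₃,₃ minor, and K₃,₃ cannot be drawn. For disjoint arcs g
and h, a logarithm of g(s) - h(t) exists on the whole square, so its increments around the boundary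
cancel. Applied to all pairs of independent edges, this gives integer equations that are
inconsistent modulo 2 (`parity_obstruction`).

Planarity. The columns of a fundamental domain are placed on concentric ℓ¹ circles, two antipodal
vertices on each, with a quarter turn at every hourglass. Distinct arcs are separated mostly by
their ℓ¹ radius (`Arc.curve_inj`). The edges folded by the two rotations are drawn on the innermost
and outermost circles, or as loops just beyond them. -/

namespace CubicGaps

/-! ### A topological `K₃,₃` does not embed in the plane -/

section TopologicalK33

/-- A nowhere vanishing continuous function on a simply connected space has a continuous
logarithm. -/
lemma exists_continuous_log {X : Type*} [TopologicalSpace X] [SimplyConnectedSpace X]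
    [LocallyPathConnectedSpace X] (f : C(X, ℂ)) (hf : ∀ x, f x ≠ 0) :
    ∃ L : C(X, ℂ), ∀ x, Complex.exp (L x) = f x := by
  obtain ⟨x₀⟩ : Nonempty X := inferInstance
  obtain ⟨F, ⟨-, hF⟩, -⟩ := Complex.isCoveringMapOn_exp.existsUnique_continuousMap_lifts f
    (Complex.exp_log (hf x₀)) hf
  exact ⟨F, fun x => congrFun hF x⟩

/-- `exp (L t - M t)` is the constant `c`, and a continuous lift of a constant through the covering
`exp` is constant. So increments depend neither on the branch nor on a constant factor; the factor
`-1` is what allows g - h to be compared with h - g. -/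
lemma log_increment_unique {L M : ℝ → ℂ} (hL : Continuous L) (hM : Continuous M) (c : ℂ)
    (h : ∀ t, Complex.exp (L t) = c * Complex.exp (M t)) : L 1 - L 0 = M 1 - M 0 := by
  have hc : c ≠ 0 := by
    rintro rfl
    exact Complex.exp_ne_zero (L 0) (by simpa using h 0)
  have key : ∀ t t', L t - M t = L t' - M t' := by
    refine Complex.isCoveringMap_exp.const_of_comp (g := fun t => L t - M t)
      (hL.sub hM) ?_
    intro t t'
    have : ∀ s, Complex.exp (L s - M s) = c := fun s => by
      rw [Complex.exp_sub, h, mul_div_cancel_right₀ _ (Complex.exp_ne_zero _)]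
    simp [this]
  linear_combination key 1 0

/-- The increment of the logarithm along a nowhere vanishing path. -/
lemma exists_log_path {g : ℝ → ℂ} (hg : Continuous g) {z : ℂ} (h : ∀ t, g t ≠ z) :
    ∃ L : ℝ → ℂ, Continuous L ∧ ∀ t, Complex.exp (L t) = g t - z := by
  obtain ⟨L, hL⟩ := exists_continuous_log (X := ℝ) ⟨fun t => g t - z, by fun_prop⟩
    (fun t => sub_ne_zero.2 (h t))
  exact ⟨L, L.continuous, hL⟩

/-- For two disjoint paths `g` and `h`, the total increment of the logarithm of `g s - h t` along
the boundary of the unit square vanishes. -/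
lemma log_increment_square {g h : ℝ → ℂ} (hg : Continuous g) (hh : Continuous h)
    (hd : ∀ s t, g s ≠ h t) {L₀ L₁ M₀ M₁ : ℝ → ℂ}
    (cL₀ : Continuous L₀) (hL₀ : ∀ t, Complex.exp (L₀ t) = g t - h 0)
    (cL₁ : Continuous L₁) (hL₁ : ∀ t, Complex.exp (L₁ t) = g t - h 1)
    (cM₀ : Continuous M₀) (hM₀ : ∀ t, Complex.exp (M₀ t) = h t - g 0)
    (cM₁ : Continuous M₁) (hM₁ : ∀ t, Complex.exp (M₁ t) = h t - g 1) :
    (L₀ 1 - L₀ 0) - (M₀ 1 - M₀ 0) = (L₁ 1 - L₁ 0) - (M₁ 1 - M₁ 0) := by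
  obtain ⟨F, hF⟩ := exists_continuous_log (X := ℝ × ℝ) ⟨fun p => g p.1 - h p.2, by fun_prop⟩
    (fun p => sub_ne_zero.2 (hd p.1 p.2))
  have hF' : ∀ s t, Complex.exp (F (s, t)) = g s - h t := fun s t => hF (s, t)
  -- The four sides of the square each give an increment of `F`, and these telescope at the corners.
  -- The factor is `-1` on two sides because `M₀` and `M₁` are logarithms of h - g.
  have e₁ := log_increment_unique (L := fun s => F (s, 0)) (by fun_prop) cL₀ 1
    (fun t => by rw [hF', hL₀, one_mul])
  have e₂ := log_increment_unique (L := fun s => F (s, 1)) (by fun_prop) cL₁ 1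
    (fun t => by rw [hF', hL₁, one_mul])
  have e₃ := log_increment_unique (L := fun s => F (0, s)) (by fun_prop) cM₀ (-1)
    (fun t => by rw [hF', hM₀]; ring)
  have e₄ := log_increment_unique (L := fun s => F (1, s)) (by fun_prop) cM₁ (-1)
    (fun t => by rw [hF', hM₁]; ring)
  linear_combination -e₁ + e₂ + e₃ - e₄

/-- Logarithms of the differences of three distinct points, antisymmetric up to `π`. -/
lemma exists_log_differences (a : Fin 3 → ℂ) (ha : ∀ i k, i ≠ k → a i ≠ a k) :
    ∃ α : Fin 3 → Fin 3 → ℂ, (∀ i k, i ≠ k → Complex.exp (α i k) = a i - a k) ∧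
      ∀ i k, i < k → α k i = α i k + Real.pi * Complex.I := by
  refine ⟨fun i k => if i < k then Complex.log (a i - a k)
    else Complex.log (a k - a i) + Real.pi * Complex.I, ?_, ?_⟩
  · intro i k hik
    dsimp only
    split_ifs
    · rw [Complex.exp_log (sub_ne_zero.2 (ha _ _ hik))]
    · rw [Complex.exp_add, Complex.exp_log (sub_ne_zero.2 (ha _ _ hik.symm)), Complex.exp_pi_mul_I]
      ring
  · intro i k hik
    simp [hik, hik.asymm]

/-- The parity obstruction to a planar `K₃,₃`. -/
lemma parity_obstruction (x y : Fin 3 → Fin 3 → Fin 3 → ℤ)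
    (h₁ : ∀ i k, i < k → ∀ j l, j < l → x k i j - x i k l - y l i j + y j k l = -1)
    (h₂ : ∀ i k, i < k → ∀ j l, l < j → x k i j - x i k l - y l i j + y j k l = 0) : False := by
  -- In the sum of the eighteen equations each unknown occurs exactly twice, up to sign, so the left
  -- side is even. The right side is -9, one for each choice of i < k and j < l.
  have a01 : (0 : Fin 3) < 1 := by decide
  have a02 : (0 : Fin 3) < 2 := by decide
  have a12 : (1 : Fin 3) < 2 := by decide
  have p1 := h₁ 0 1 a01 0 1 a01
  have p2 := h₁ 0 1 a01 0 2 a02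
  have p3 := h₁ 0 1 a01 1 2 a12
  have p4 := h₁ 0 2 a02 0 1 a01
  have p5 := h₁ 0 2 a02 0 2 a02
  have p6 := h₁ 0 2 a02 1 2 a12
  have p7 := h₁ 1 2 a12 0 1 a01
  have p8 := h₁ 1 2 a12 0 2 a02
  have p9 := h₁ 1 2 a12 1 2 a12
  have q1 := h₂ 0 1 a01 1 0 a01
  have q2 := h₂ 0 1 a01 2 0 a02
  have q3 := h₂ 0 1 a01 2 1 a12
  have q4 := h₂ 0 2 a02 1 0 a01
  have q5 := h₂ 0 2 a02 2 0 a02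
  have q6 := h₂ 0 2 a02 2 1 a12
  have q7 := h₂ 1 2 a12 1 0 a01
  have q8 := h₂ 1 2 a12 2 0 a02
  have q9 := h₂ 1 2 a12 2 1 a12
  omega

/-- If every `a i` is joined to every `b j` by a path in the plane, then some two paths without a
common end intersect. -/
theorem not_disjoint_joinedIn (a b : Fin 3 → ℂ) (S : Fin 3 → Fin 3 → Set ℂ)
    (hJ : ∀ i j, JoinedIn (S i j) (a i) (b j))
    (hD : ∀ i j k l, i ≠ k → j ≠ l → Disjoint (S i j) (S k l)) : False := by
  have hpath : ∀ i j, ∃ g : ℝ → ℂ, Continuous g ∧ g 0 = a i ∧ g 1 = b j ∧ ∀ t, g t ∈ S i j := by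
    intro i j
    obtain ⟨γ, hγ⟩ := hJ i j
    refine ⟨γ.extend, γ.continuous_extend, by simp, by simp, fun t => ?_⟩
    have : γ.extend t ∈ Set.range γ.extend := ⟨t, rfl⟩
    rw [Path.extend_range] at this
    obtain ⟨s, hs⟩ := this
    exact hs ▸ hγ s
  choose g cg g0 g1 gS using hpath
  -- A spare index turns the disjointness hypothesis into avoidance of points: for k ≠ i, the path
  -- `g i j` misses `a k` because `a k` lies in `S k l` with l ≠ j.
  have other : ∀ i : Fin 3, ∃ k, k ≠ i := by decide
  have ne_of : ∀ i j k l, i ≠ k → j ≠ l → ∀ u v, u ∈ S i j → v ∈ S k l → u ≠ v := by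
    rintro i j k l hik hjl u v hu hv rfl
    exact Set.disjoint_left.1 (hD i j k l hik hjl) hu hv
  have aS : ∀ i j, a i ∈ S i j := fun i j => (hJ i j).source_mem
  have bS : ∀ i j, b j ∈ S i j := fun i j => (hJ i j).target_mem
  have gga : ∀ k i j, k ≠ i → ∀ t, g i j t ≠ a k := fun k i j hki t => by
    obtain ⟨l, hl⟩ := other j
    exact ne_of i j k l hki.symm hl.symm _ _ (gS i j t) (aS k l)
  have ggb : ∀ l i j, l ≠ j → ∀ t, g i j t ≠ b l := fun l i j hlj t => by
    obtain ⟨k, hk⟩ := other i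
    exact ne_of i j k l hk.symm hlj.symm _ _ (gS i j t) (bS k l)
  have ha : ∀ i k, i ≠ k → a i ≠ a k := fun i k hik => g0 i 0 ▸ gga k i 0 hik.symm 0
  have hb : ∀ j l, j ≠ l → b j ≠ b l := fun j l hjl => g1 0 j ▸ ggb l 0 j hjl.symm 1
  have hab : ∀ j k, b j ≠ a k := fun j k => by
    obtain ⟨i, hi⟩ := other k
    exact g1 i j ▸ gga k i j hi.symm 1
  obtain ⟨α, hα, hα'⟩ := exists_log_differences a ha
  obtain ⟨β, hβ, hβ'⟩ := exists_log_differences b hb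
  have hX : ∀ k i j, ∃ L : ℝ → ℂ, k ≠ i → Continuous L ∧
      ∀ t, Complex.exp (L t) = g i j t - a k := by
    intro k i j
    by_cases hki : k = i
    · exact ⟨0, fun h => absurd hki h⟩
    · obtain ⟨L, h⟩ := exists_log_path (cg i j) (gga k i j hki)
      exact ⟨L, fun _ => h⟩
  choose X hX using hX
  have hY : ∀ l i j, ∃ L : ℝ → ℂ, l ≠ j → Continuous L ∧
      ∀ t, Complex.exp (L t) = g i j t - b l := by
    intro l i j
    by_cases hlj : l = j
    · exact ⟨0, fun h => absurd hlj h⟩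
    · obtain ⟨L, h⟩ := exists_log_path (cg i j) (ggb l i j hlj)
      exact ⟨L, fun _ => h⟩
  choose Y hY using hY
  have hx : ∀ k i j, ∃ n : ℤ, k ≠ i → X k i j 1 - X k i j 0 =
      Complex.log (b j - a k) - α i k + n * (2 * Real.pi * Complex.I) := by
    intro k i j
    by_cases hki : k = i
    · exact ⟨0, fun h => absurd hki h⟩
    · have : Complex.exp (X k i j 1 - X k i j 0) =
          Complex.exp (Complex.log (b j - a k) - α i k) := by
        rw [Complex.exp_sub, Complex.exp_sub, (hX k i j hki).2, (hX k i j hki).2, g0, g1,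
          hα _ _ (Ne.symm hki), Complex.exp_log (sub_ne_zero.2 (hab j k))]
      obtain ⟨n, hn⟩ := Complex.exp_eq_exp_iff_exists_int.1 this
      exact ⟨n, fun _ => hn⟩
  choose x hx using hx
  -- The logarithm of a i - b l is taken to be `log (b l - a i) + π I`, so that all logarithms of
  -- mixed differences cancel in `rel`. Only the antisymmetry defects of `α` and `β` remain.
  have hy : ∀ l i j, ∃ n : ℤ, l ≠ j → Y l i j 1 - Y l i j 0 =
      β j l - (Complex.log (b l - a i) + Real.pi * Complex.I) +
        n * (2 * Real.pi * Complex.I) := by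
    intro l i j
    by_cases hlj : l = j
    · exact ⟨0, fun h => absurd hlj h⟩
    · have : Complex.exp (Y l i j 1 - Y l i j 0) =
          Complex.exp (β j l - (Complex.log (b l - a i) + Real.pi * Complex.I)) := by
        rw [Complex.exp_sub, Complex.exp_sub, (hY l i j hlj).2, (hY l i j hlj).2, g0, g1,
          hβ _ _ (Ne.symm hlj), Complex.exp_add, Complex.exp_log (sub_ne_zero.2 (hab l i)),
          Complex.exp_pi_mul_I]
        congr 1
        ring
      obtain ⟨n, hn⟩ := Complex.exp_eq_exp_iff_exists_int.1 this
      exact ⟨n, fun _ => hn⟩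
  choose y hy using hy
  have rel : ∀ i j k l, i ≠ k → j ≠ l →
      (X k i j 1 - X k i j 0) - (X i k l 1 - X i k l 0) =
        (Y l i j 1 - Y l i j 0) - (Y j k l 1 - Y j k l 0) := by
    intro i j k l hik hjl
    refine log_increment_square (cg i j) (cg k l)
      (fun s t => ne_of i j k l hik hjl _ _ (gS i j s) (gS k l t))
      (hX k i j hik.symm).1 ?_ (hY l i j hjl.symm).1 ?_ (hX i k l hik).1 ?_ (hY j k l hjl).1 ?_
    · rw [g0]; exact (hX k i j hik.symm).2
    · rw [g1]; exact (hY l i j hjl.symm).2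
    · rw [g0]; exact (hX i k l hik).2
    · rw [g1]; exact (hY j k l hjl).2
  have hpi : (2 * Real.pi * Complex.I : ℂ) ≠ 0 := Complex.two_pi_I_ne_zero
  refine parity_obstruction x y ?_ ?_
  -- For j < l the defects of `α` and `β` are both -πI and add up to one full period; for l < j,
  -- below, they cancel.
  · intro i k hik j l hjl
    have h := rel i j k l hik.ne hjl.ne
    rw [hx _ _ _ hik.ne', hx _ _ _ hik.ne, hy _ _ _ hjl.ne', hy _ _ _ hjl.ne,
      hα' _ _ hik, hβ' _ _ hjl] at h
    have : ((x k i j - x i k l - y l i j + y j k l : ℤ) : ℂ) * (2 * Real.pi * Complex.I) =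
        ((-1 : ℤ) : ℂ) * (2 * Real.pi * Complex.I) := by
      push_cast
      linear_combination h
    exact_mod_cast mul_right_cancel₀ hpi this
  · intro i k hik j l hjl
    have h := rel i j k l hik.ne hjl.ne'
    rw [hx _ _ _ hik.ne', hx _ _ _ hik.ne, hy _ _ _ hjl.ne', hy _ _ _ hjl.ne,
      hα' _ _ hik, hβ' _ _ hjl] at h
    have : ((x k i j - x i k l - y l i j + y j k l : ℤ) : ℂ) * (2 * Real.pi * Complex.I) =
        ((0 : ℤ) : ℂ) * (2 * Real.pi * Complex.I) := by
      push_cast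
      linear_combination h
    exact_mod_cast mul_right_cancel₀ hpi this

end TopologicalK33

/-! ### Planar graphs do not contain a subdivision of `K₃,₃` -/

section GraphK33

variable {α β : Type*}

/-- Adjacency within a set of vertices. -/
def AdjIn (G : Graph α β) (U : Set α) (u v : α) : Prop :=
  u ∈ U ∧ v ∈ U ∧ G.Adj u v

/-- A planar graph does not contain vertices `a i`, `b j` and walks joining each `a i` to each
`b j` such that walks without common ends are disjoint. -/
theorem IsPlanar.not_k33 {G : Graph α β} (hG : IsPlanar G) (a b : Fin 3 → α)
    (U : Fin 3 → Fin 3 → Set α) (ha : ∀ i, a i ∈ V(G))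
    (hmem : ∀ i j, a i ∈ U i j)
    (hU : ∀ i j, Relation.ReflTransGen (AdjIn G (U i j)) (a i) (b j))
    (hD : ∀ i j k l, i ≠ k → j ≠ l → Disjoint (U i j) (U k l)) : False := by
  obtain ⟨p, γ, hp, hends, hcross, havoid⟩ := hG
  classical
  let q : α → ℂ := fun u => if h : u ∈ V(G) then p ⟨u, h⟩ else 0
  have hq : ∀ u : V(G), q u = p u := fun u => by simp [q]
  -- The drawing of the subgraph induced on `U`. An edge counts only if all its ends lie in `U`;
  -- this makes disjoint vertex sets give disjoint plane sets, since a common point would be a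
  -- common vertex or lie inside a common edge.
  let D : Set α → Set ℂ := fun U => {z | (∃ u : V(G), u.1 ∈ U ∧ z = p u) ∨
    ∃ e : E(G), (∀ x, G.Inc e x → x ∈ U) ∧ ∃ t, z = γ e t}
  have hjoin : ∀ U : Set α, ∀ u ∈ U, u ∈ V(G) → ∀ v, Relation.ReflTransGen (AdjIn G U) u v →
      JoinedIn (D U) (q u) (q v) := by
    intro U u huU huG v huv
    induction huv with
    | refl => exact JoinedIn.refl (Or.inl ⟨⟨u, huG⟩, huU, hq ⟨u, huG⟩⟩)
    | tail _ hbc ih =>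
      refine ih.trans ?_
      obtain ⟨hb, hc, e, he⟩ := hbc
      obtain ⟨u', v', hl, h0, h1⟩ := hends ⟨e, he.edge_mem⟩
      have hinc : ∀ x, G.Inc e x → x ∈ U := fun x hx => by
        rcases hx.eq_or_eq_of_isLink he with rfl | rfl <;> assumption
      have hj : JoinedIn (D U) (q u') (q v') := by
        rw [hq, hq]
        exact ⟨⟨γ ⟨e, he.edge_mem⟩, h0, h1⟩, fun t => Or.inr ⟨⟨e, he.edge_mem⟩, hinc, t, rfl⟩⟩
      rcases hl.eq_and_eq_or_eq_and_eq he with ⟨h, h'⟩ | ⟨h, h'⟩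
      · rwa [h, h'] at hj
      · rw [h, h'] at hj
        exact hj.symm
  have interior : ∀ t : unitInterval, t = 0 ∨ t = 1 ∨ t ∈ Set.Ioo (0 : unitInterval) 1 := by
    intro t
    rcases eq_or_ne t 0 with h | h
    · exact Or.inl h
    · rcases eq_or_ne t 1 with h' | h'
      · exact Or.inr (Or.inl h')
      · exact Or.inr (Or.inr ⟨unitInterval.pos_iff_ne_zero.2 h, unitInterval.lt_one_iff_ne_one.2 h'⟩)
  have hpt : ∀ (U : Set α) (z : ℂ), z ∈ D U → (∃ u : V(G), u.1 ∈ U ∧ z = p u) ∨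
      ∃ e : E(G), (∀ x, G.Inc e x → x ∈ U) ∧ ∃ t ∈ Set.Ioo (0 : unitInterval) 1, z = γ e t := by
    rintro U z (h | ⟨e, he, t, rfl⟩)
    · exact Or.inl h
    · obtain ⟨u', v', hl, h0, h1⟩ := hends e
      rcases interior t with rfl | rfl | ht
      · exact Or.inl ⟨u', he _ hl.inc_left, h0⟩
      · exact Or.inl ⟨v', he _ hl.inc_right, h1⟩
      · exact Or.inr ⟨e, he, t, ht, rfl⟩
  have hdisj : ∀ U U' : Set α, Disjoint U U' → Disjoint (D U) (D U') := by
    intro U U' h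
    rw [Set.disjoint_left] at h ⊢
    intro z hz hz'
    rcases hpt U z hz with ⟨u, hu, rfl⟩ | ⟨e, he, t, ht, rfl⟩
    · rcases hpt U' _ hz' with ⟨u', hu', h'⟩ | ⟨e, -, t, ht, h'⟩
      · exact h hu (hp h' ▸ hu')
      · exact havoid e t ht u h'.symm
    · rcases hpt U' _ hz' with ⟨u', hu', h'⟩ | ⟨e', he', t', ht', h'⟩
      · exact havoid e t ht u' h'
      · obtain ⟨rfl, -⟩ := hcross e e' t ht t' ht' h'
        obtain ⟨u', v', hl, -, -⟩ := hends e
        exact h (he _ hl.inc_left) (he' _ hl.inc_left)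
  exact not_disjoint_joinedIn (fun i => q (a i)) (fun j => q (b j)) (fun i j => D (U i j))
    (fun i j => hjoin _ _ (hmem i j) (ha i) _ (hU i j))
    (fun i j k l hik hjl => hdisj _ _ (hD i j k l hik hjl))

end GraphK33

/-! ### Eigenvalues of large cubic graphs near points of `[-√2, 0]` -/

section Geodesic

open Finset Matrix

lemma mem_spectrum_iff_exists_mulVec {V : Type*} [Fintype V] [DecidableEq V] (A : Matrix V V ℝ)
    (μ : ℝ) : μ ∈ spectrum ℝ A ↔ ∃ x : V → ℝ, x ≠ 0 ∧ A *ᵥ x = μ • x := by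
  rw [← Matrix.spectrum_toLin', ← Module.End.hasEigenvalue_iff_mem_spectrum]
  constructor
  · intro h
    obtain ⟨x, hx⟩ := h.exists_hasEigenvector
    exact ⟨x, hx.2, by simpa using hx.apply_eq_smul⟩
  · rintro ⟨x, hx0, hx⟩
    exact Module.End.hasEigenvalue_of_hasEigenvector
      ⟨Module.End.mem_eigenspace_iff.2 (by simpa using hx), hx0⟩

/-- If a symmetric matrix `A` has no eigenvalue in `(c - r, c + r)`, then `(A - c)² - r²` is
positive semidefinite. -/
lemma posSemidef_of_gap {V : Type*} [Fintype V] [DecidableEq V] {A : Matrix V V ℝ}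
    (hA : A.IsSymm) {c r : ℝ} (hr : 0 < r)
    (hgap : ∀ μ ∈ spectrum ℝ A, μ ∉ Set.Ioo (c - r) (c + r)) :
    ((A - c • (1 : Matrix V V ℝ)) * (A - c • (1 : Matrix V V ℝ)) -
      (r ^ 2) • (1 : Matrix V V ℝ)).PosSemidef := by
  set B := A - c • (1 : Matrix V V ℝ) with hB
  have hBH : Bᴴ = B := by
    rw [conjTranspose_eq_transpose_of_trivial, hB, transpose_sub, hA.eq, transpose_smul,
      transpose_one]
  have hBB : (B * B).PosSemidef := by
    have := posSemidef_conjTranspose_mul_self B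
    rwa [hBH] at this
  have hM : (B * B - (r ^ 2) • (1 : Matrix V V ℝ)).IsHermitian := by
    refine hBB.1.sub ?_
    simp [IsHermitian, conjTranspose_eq_transpose_of_trivial]
  rw [hM.posSemidef_iff_eigenvalues_nonneg]
  intro i
  by_contra hneg
  simp only [Pi.zero_apply, not_le] at hneg
  set ν := hM.eigenvalues i
  set x : V → ℝ := (hM.eigenvectorBasis i).ofLp with hx
  have hx0 : x ≠ 0 := by
    intro h
    have := hM.eigenvectorBasis.toBasis.ne_zero i
    apply this
    ext v
    simpa using congrFun h v
  have hMx : (B * B - (r ^ 2) • (1 : Matrix V V ℝ)) *ᵥ x = ν • x := hM.mulVec_eigenvectorBasis i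
  have hBBx : (B * B) *ᵥ x = (r ^ 2 + ν) • x := by
    rw [sub_mulVec, smul_mulVec, one_mulVec, sub_eq_iff_eq_add] at hMx
    rw [hMx, add_smul, add_comm]
  have hxx : 0 < x ⬝ᵥ x := by
    rcases (dotProduct_self_star_nonneg x).lt_or_eq with h | h
    · simpa using h
    · exact absurd (dotProduct_self_star_eq_zero.1 h.symm) hx0
  have hnn : 0 ≤ r ^ 2 + ν := by
    have h := (posSemidef_iff_dotProduct_mulVec.1 hBB).2 x
    rw [hBBx, dotProduct_smul, smul_eq_mul, star_trivial] at h
    exact nonneg_of_mul_nonneg_left h hxx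
  -- Since (B - s)(B + s) x = 0, either `x` is an eigenvector of `B` for -s, or (B + s) x is one for
  -- s. As s < r, both c - s and c + s are forbidden eigenvalues of `A`.
  set s := √(r ^ 2 + ν) with hs
  have hss : s * s = r ^ 2 + ν := Real.mul_self_sqrt hnn
  have hs0 : 0 ≤ s := Real.sqrt_nonneg _
  have hsr : s < r := by nlinarith
  have hAB : ∀ y : V → ℝ, A *ᵥ y = B *ᵥ y + c • y := by
    intro y
    rw [hB, sub_mulVec, smul_mulVec, one_mulVec, sub_add_cancel]
  set y := B *ᵥ x + s • x with hy
  have hBy : B *ᵥ y = s • y := by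
    rw [hy, mulVec_add, mulVec_mulVec, hBBx, mulVec_smul, ← hss, smul_add, smul_smul, add_comm]
  by_cases hy0 : y = 0
  · have : B *ᵥ x = -s • x := by
      rw [neg_smul]
      exact eq_neg_of_add_eq_zero_left hy0
    refine hgap (c - s) ((mem_spectrum_iff_exists_mulVec A _).2 ⟨x, hx0, ?_⟩)
      ⟨by linarith, by linarith⟩
    rw [hAB, this, ← add_smul]
    congr 1
    ring
  · refine hgap (c + s) ((mem_spectrum_iff_exists_mulVec A _).2 ⟨y, hy0, ?_⟩)
      ⟨by linarith, by linarith⟩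
    rw [hAB, hBy, ← add_smul, add_comm]

/-- As cos(iθ - jθ) = cos iθ cos jθ + sin iθ sin jθ, the sum is the quadratic form evaluated at the
real and imaginary parts of a plane wave along `w`. Passing to a submatrix allows repeated vertices.
-/
lemma sum_cos_mul_nonneg {V : Type*} [Fintype V] {M : Matrix V V ℝ} (hM : M.PosSemidef)
    (w : ℕ → V) (n : ℕ) (θ : ℝ) :
    0 ≤ ∑ i ∈ range n, ∑ j ∈ range n, Real.cos (i * θ - j * θ) * M (w i) (w j) := by
  have key : ∀ f : ℕ → ℝ, 0 ≤ ∑ i ∈ range n, ∑ j ∈ range n, f i * f j * M (w i) (w j) := by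
    intro f
    have h := (posSemidef_iff_dotProduct_mulVec.1 (hM.submatrix (fun i : Fin n => w i))).2
      (fun i => f i)
    simp only [dotProduct, mulVec, submatrix_apply, mul_sum, star_trivial] at h
    simp only [sum_range]
    refine h.trans_eq (sum_congr rfl fun i _ => sum_congr rfl fun j _ => ?_)
    ring
  have := add_nonneg (key fun i => Real.cos (i * θ)) (key fun i => Real.sin (i * θ))
  refine this.trans_eq ?_
  simp only [← sum_add_distrib]
  refine sum_congr rfl fun i _ => sum_congr rfl fun j _ => ?_
  rw [Real.cos_sub]
  ring

/-- Enlarging the range by one index adds a diagonal entry together with a row and a column whose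
sums are t₁ + t₂ each; the 2 × 2 corner supplies the boundary term. -/
lemma sum_band_matrix (t₀ t₁ t₂ : ℝ) (T : ℕ → ℕ → ℝ) (h0 : ∀ i, T i i = t₀)
    (h1 : ∀ i, T i (i + 1) = t₁ ∧ T (i + 1) i = t₁)
    (h2 : ∀ i, T i (i + 2) = t₂ ∧ T (i + 2) i = t₂)
    (h3 : ∀ i j, i + 2 < j → T i j = 0 ∧ T j i = 0) (m : ℕ) :
    ∑ i ∈ range (m + 2), ∑ j ∈ range (m + 2), T i j =
      m * (t₀ + 2 * t₁ + 2 * t₂) + 2 * t₀ + 2 * t₁ := by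
  induction m with
  | zero =>
    have := h1 0
    simp only [zero_add] at this
    simp only [sum_range_succ, sum_range_zero, h0, this.1, this.2, zero_add, Nat.cast_zero]
    ring
  | succ m ih =>
    rw [sum_range_succ]
    simp_rw [sum_range_succ _ (m + 2)]
    rw [sum_add_distrib, ih, h0]
    have r1 : ∑ i ∈ range (m + 2), T i (m + 2) = t₁ + t₂ := by
      rw [sum_range_succ, sum_range_succ, (h2 m).1, (h1 (m + 1)).1,
        sum_eq_zero fun i hi => (h3 i (m + 2) (by simp at hi; omega)).1]
      ring
    have r2 : ∑ i ∈ range (m + 2), T (m + 2) i = t₁ + t₂ := by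
      rw [sum_range_succ, sum_range_succ, (h2 m).2, (h1 (m + 1)).2,
        sum_eq_zero fun i hi => (h3 i (m + 2) (by simp at hi; omega)).2]
      ring
    rw [r1, r2]
    push_cast
    ring

/-! ### Geodesics in cubic graphs -/

variable {V : Type*} {H : SimpleGraph V}

/-- A sequence of vertices `w 0, w 1, …, w n` that are consecutively adjacent, with `w 0` and
`w n` at distance `n`, is a geodesic. -/
lemma le_dist_of_geodesic (hc : H.Connected) {w : ℕ → V} {n : ℕ}
    (hw : ∀ i < n, H.Adj (w i) (w (i + 1))) (hd : H.dist (w 0) (w n) = n) {i j : ℕ}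
    (hij : i ≤ j) (hj : j ≤ n) : j - i ≤ H.dist (w i) (w j) := by
  have up : ∀ k l, k + l ≤ n → H.dist (w k) (w (k + l)) ≤ l := by
    intro k l
    induction l with
    | zero => simp
    | succ l ih =>
      intro h
      have h1 := ih (by omega)
      have h2 := SimpleGraph.dist_eq_one_iff_adj.2 (hw (k + l) (by omega))
      have h3 := hc.dist_triangle (u := w k) (v := w (k + l)) (w := w (k + l + 1))
      rw [← add_assoc]
      omega
  have h1 := up 0 i (by omega)
  have h2 := up j (n - j) (by omega)
  rw [zero_add] at h1
  rw [Nat.add_sub_cancel' hj] at h2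
  have h3 := hc.dist_triangle (u := w 0) (v := w i) (w := w n)
  have h4 := hc.dist_triangle (u := w i) (v := w j) (w := w n)
  omega

/-- A connected cubic graph containing a long geodesic has an eigenvalue in `(c - r, c + r)`
whenever some `2 γ` in `[-√2, 0]` satisfies `1 + (c - 2 γ)² < r²`. -/
lemma exists_eigenvalue_of_geodesic [Fintype V] [DecidableEq V] [DecidableRel H.Adj]
    (hc : H.Connected) (h3 : H.IsRegularOfDegree 3) {γ c r : ℝ} (hγ : γ ≤ 0)
    (hγ' : 2 * γ ^ 2 ≤ 1) (hr : 0 < r) {m : ℕ}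
    (hm : m * (1 + (c - 2 * γ) ^ 2 - r ^ 2) + 2 * (3 + c ^ 2 - r ^ 2) + 2 * (-2 * c * γ) < 0)
    {w : ℕ → V} (hw : ∀ i < m + 1, H.Adj (w i) (w (i + 1)))
    (hd : H.dist (w 0) (w (m + 1)) = m + 1) :
    ∃ μ ∈ spectrum ℝ (H.adjMatrix ℝ), μ ∈ Set.Ioo (c - r) (c + r) := by
  by_contra! hgap
  set A := H.adjMatrix ℝ with hA
  have hM := posSemidef_of_gap (H.isSymm_adjMatrix) hr hgap
  set M := (A - c • (1 : Matrix V V ℝ)) * (A - c • (1 : Matrix V V ℝ)) -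
      (r ^ 2) • (1 : Matrix V V ℝ) with hMdef
  have hMexp : ∀ u v, M u v = (A * A) u v - 2 * c * A u v +
      (c ^ 2 - r ^ 2) * (1 : Matrix V V ℝ) u v := by
    intro u v
    have : M = A * A - (2 * c) • A + (c ^ 2 - r ^ 2) • (1 : Matrix V V ℝ) := by
      rw [hMdef, sub_mul, mul_sub, mul_sub]
      simp only [smul_mul_assoc, mul_smul_comm, mul_one, one_mul]
      module
    rw [this]
    simp
  have hAA : ∀ u v, (A * A) u v = #({x ∈ H.neighborFinset u | H.Adj x v}) := by
    intro u v
    rw [hA, SimpleGraph.adjMatrix_mul_apply]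
    simp [SimpleGraph.adjMatrix_apply]
  have hcos1 : ∃ θ, Real.cos θ = γ := ⟨Real.arccos γ, Real.cos_arccos (by nlinarith) (by nlinarith)⟩
  obtain ⟨θ, hθ⟩ := hcos1
  have hS := sum_cos_mul_nonneg hM w (m + 2) θ
  -- `T` bounds the weighted entries of `M` from above. The number of common neighbours is 3 on the
  -- diagonal, at least 0 at distance one and at least 1 at distance two. As the weights γ and 2γ² -
  -- 1 of the last two are nonpositive, extra common neighbours only lower the entry. Beyond
  -- distance two `M` vanishes.
  let T : ℕ → ℕ → ℝ := fun i j => if i = j then 3 + c ^ 2 - r ^ 2 else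
    if j = i + 1 ∨ i = j + 1 then -2 * c * γ else
    if j = i + 2 ∨ i = j + 2 then 2 * γ ^ 2 - 1 else 0
  have T0 : ∀ i, T i i = 3 + c ^ 2 - r ^ 2 := fun i => if_pos rfl
  have T1 : ∀ i, T i (i + 1) = -2 * c * γ ∧ T (i + 1) i = -2 * c * γ := fun i =>
    ⟨(if_neg (by omega)).trans (if_pos (Or.inl rfl)),
      (if_neg (by omega)).trans (if_pos (Or.inr rfl))⟩
  have T2 : ∀ i, T i (i + 2) = 2 * γ ^ 2 - 1 ∧ T (i + 2) i = 2 * γ ^ 2 - 1 := fun i =>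
    ⟨(if_neg (by omega)).trans ((if_neg (by omega)).trans (if_pos (Or.inl rfl))),
      (if_neg (by omega)).trans ((if_neg (by omega)).trans (if_pos (Or.inr rfl)))⟩
  have hsymm : ∀ u v, M u v = M v u := fun u v => by
    rw [← hM.1.apply u v, star_trivial]
  have bound : ∀ i j, i ≤ j → j < m + 2 →
      Real.cos (i * θ - j * θ) * M (w i) (w j) ≤ T i j := by
    intro i j hij hj
    have hdist := le_dist_of_geodesic hc hw hd hij (by omega)
    obtain ⟨k, rfl⟩ := Nat.exists_eq_add_of_le hij
    rw [Nat.add_sub_cancel_left] at hdist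
    have hcos : Real.cos (i * θ - ((i + k : ℕ) : ℝ) * θ) = Real.cos (k * θ) := by
      rw [← Real.cos_neg]
      congr 1
      push_cast
      ring
    rw [hcos, hMexp]
    rcases k with _ | _ | _ | k
    · rw [add_zero, T0]
      have h1 : (A * A) (w i) (w i) = 3 := by
        rw [hAA, Finset.filter_true_of_mem fun x hx => ((H.mem_neighborFinset _ _).1 hx).symm,
          H.card_neighborFinset_eq_degree, h3 (w i)]
        norm_num
      rw [h1, hA, SimpleGraph.adjMatrix_apply, if_neg (H.loopless.irrefl _), one_apply_eq]
      simp only [Nat.cast_zero, zero_mul, Real.cos_zero]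
      linarith
    · rw [(T1 i).1]
      have hadj := hw i (by omega)
      have h0 : 0 ≤ (A * A) (w i) (w (i + (0 + 1))) := by rw [hAA]; positivity
      have h1 : A (w i) (w (i + (0 + 1))) = 1 := by simp [hA, SimpleGraph.adjMatrix_apply, hadj]
      rw [h1, one_apply_ne hadj.ne]
      simp only [zero_add, Nat.cast_one, one_mul, hθ] at h0 ⊢
      nlinarith
    · rw [(T2 i).1]
      have hna : ¬ H.Adj (w i) (w (i + (0 + 1 + 1))) := fun h => by
        rw [SimpleGraph.dist_eq_one_iff_adj.2 h] at hdist
        omega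
      have hne : w i ≠ w (i + (0 + 1 + 1)) := fun h => by
        rw [← h, SimpleGraph.dist_self] at hdist
        omega
      have h1 : 1 ≤ (A * A) (w i) (w (i + (0 + 1 + 1))) := by
        rw [hAA]
        have : 0 < #({x ∈ H.neighborFinset (w i) | H.Adj x (w (i + (0 + 1 + 1)))}) :=
          Finset.card_pos.2 ⟨w (i + 1), by
            simp [hw i (by omega)]
            exact hw (i + 1) (by omega)⟩
        exact_mod_cast this
      rw [one_apply_ne hne, hA, SimpleGraph.adjMatrix_apply, if_neg hna, ← hA]
      have : Real.cos (((0 + 1 + 1 : ℕ) : ℝ) * θ) = 2 * γ ^ 2 - 1 := by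
        rw [← hθ, ← Real.cos_two_mul]
        norm_num
      rw [this]
      nlinarith
    · have : T i (i + (k + 1 + 1 + 1)) = 0 := by
        simp only [T]
        rw [if_neg (by omega), if_neg (by omega), if_neg (by omega)]
      rw [this]
      have hna : ¬ H.Adj (w i) (w (i + (k + 1 + 1 + 1))) := fun h => by
        rw [SimpleGraph.dist_eq_one_iff_adj.2 h] at hdist
        omega
      have hne : w i ≠ w (i + (k + 1 + 1 + 1)) := fun h => by
        rw [← h, SimpleGraph.dist_self] at hdist
        omega
      have h1 : (A * A) (w i) (w (i + (k + 1 + 1 + 1))) = 0 := by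
        rw [hAA, Nat.cast_eq_zero, Finset.card_eq_zero, Finset.filter_eq_empty_iff]
        intro x hx hx'
        have e1 := SimpleGraph.dist_eq_one_iff_adj.2 ((H.mem_neighborFinset _ _).1 hx)
        have e2 := SimpleGraph.dist_eq_one_iff_adj.2 hx'
        have := hc.dist_triangle (u := w i) (v := x) (w := w (i + (k + 1 + 1 + 1)))
        omega
      rw [h1, one_apply_ne hne, hA, SimpleGraph.adjMatrix_apply, if_neg hna]
      simp
  have hTsymm : ∀ i j, T i j = T j i := by
    intro i j
    simp only [T, eq_comm (a := i) (b := j), or_comm (a := j = i + 1), or_comm (a := j = i + 2)]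
  have bound' : ∀ i < m + 2, ∀ j < m + 2,
      Real.cos (i * θ - j * θ) * M (w i) (w j) ≤ T i j := by
    intro i hi j hj
    rcases le_total i j with h | h
    · exact bound i j h hj
    · rw [hTsymm, hsymm, ← Real.cos_neg, neg_sub]
      exact bound j i h hi
  have hT := sum_band_matrix (3 + c ^ 2 - r ^ 2) (-2 * c * γ) (2 * γ ^ 2 - 1) T T0 T1 T2
    (fun i j hij => by
      simp only [T]
      constructor <;> rw [if_neg (by omega), if_neg (by omega), if_neg (by omega)]) m
  have hle : ∑ i ∈ range (m + 2), ∑ j ∈ range (m + 2),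
      Real.cos (i * θ - j * θ) * M (w i) (w j) ≤
      ∑ i ∈ range (m + 2), ∑ j ∈ range (m + 2), T i j :=
    sum_le_sum fun i hi => sum_le_sum fun j hj =>
      bound' i (mem_range.1 hi) j (mem_range.1 hj)
  rw [hT] at hle
  -- The five diagonals of the band add up, per vertex, to a completed square.
  have : (m : ℝ) * (3 + c ^ 2 - r ^ 2 + 2 * (-2 * c * γ) + 2 * (2 * γ ^ 2 - 1)) =
      m * (1 + (c - 2 * γ) ^ 2 - r ^ 2) := by ring
  linarith

/-- A connected cubic graph with more than `4 ^ D` vertices contains a geodesic of length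
`D + 1`. -/
lemma exists_geodesic [Fintype V] [DecidableRel H.Adj] (hc : H.Connected)
    (h3 : H.IsRegularOfDegree 3) (D : ℕ) (hcard : 4 ^ D < Fintype.card V) :
    ∃ w : ℕ → V, (∀ i < D + 1, H.Adj (w i) (w (i + 1))) ∧ H.dist (w 0) (w (D + 1)) = D + 1 := by
  classical
  obtain ⟨u⟩ := hc.nonempty
  -- A ball of radius k + 1 is covered by the closed neighbourhoods, of at most 1 + 3 vertices each,
  -- of the points of the ball of radius k.
  have ball : ∀ k, #({v : V | H.dist u v ≤ k} : Finset V) ≤ 4 ^ k := by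
    intro k
    induction k with
    | zero =>
      rw [pow_zero, Finset.card_le_one]
      intro a ha b hb
      simp only [mem_filter, mem_univ, true_and, Nat.le_zero, hc.dist_eq_zero_iff] at ha hb
      rw [← ha, hb]
    | succ k ih =>
      have hsub : ({v : V | H.dist u v ≤ k + 1} : Finset V) ⊆
          ({v : V | H.dist u v ≤ k} : Finset V).biUnion
            (fun v => insert v (H.neighborFinset v)) := by
        intro v hv
        simp only [mem_filter, mem_univ, true_and, mem_biUnion, mem_insert,
          SimpleGraph.mem_neighborFinset] at hv ⊢
        rcases Nat.lt_or_ge k (H.dist u v) with h | h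
        · obtain ⟨p, hp⟩ := hc.exists_walk_length_eq_dist u v
          refine ⟨p.getVert k, ?_, Or.inr ?_⟩
          · exact (SimpleGraph.dist_le (p.take k)).trans (by
              rw [SimpleGraph.Walk.take_length]; exact min_le_left _ _)
          · have := p.adj_getVert_succ (i := k) (by omega)
            rwa [show k + 1 = p.length by omega, p.getVert_length] at this
        · exact ⟨v, h, Or.inl rfl⟩
      refine (card_le_card hsub).trans ((card_biUnion_le_card_mul _ _ 4 fun v _ => ?_).trans ?_)
      · refine (card_insert_le _ _).trans ?_
        rw [H.card_neighborFinset_eq_degree, h3 v]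
      · rw [pow_succ]
        exact Nat.mul_le_mul_right 4 ih
  obtain ⟨v, hv⟩ : ∃ v, D < H.dist u v := by
    by_contra! h
    have := ball D
    rw [filter_true_of_mem fun v _ => h v, card_univ] at this
    omega
  obtain ⟨p, hp⟩ := hc.exists_walk_length_eq_dist u v
  have hw : ∀ i < p.length, H.Adj (p.getVert i) (p.getVert (i + 1)) := fun i hi =>
    p.adj_getVert_succ hi
  refine ⟨p.getVert, fun i hi => hw i (by omega), le_antisymm ?_ ?_⟩
  · rw [p.getVert_zero]
    exact (SimpleGraph.dist_le (p.take (D + 1))).trans (by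
      rw [SimpleGraph.Walk.take_length]; exact min_le_left _ _)
  · exact le_dist_of_geodesic hc hw (by rw [p.getVert_zero, p.getVert_length, hp])
      (Nat.zero_le _) (by rw [hp]; exact hv)

/-- Every sufficiently large connected cubic graph has an eigenvalue in `(c - r, c + r)`
whenever some `c₀` in `[-√2, 0]` satisfies `1 + (c - c₀)² < r²`. -/
theorem exists_eigenvalue_of_large {c₀ c r : ℝ} (h0 : c₀ ≤ 0) (h0' : c₀ ^ 2 ≤ 2) (hr : 0 < r)
    (hcr : 1 + (c - c₀) ^ 2 < r ^ 2) : ∃ N : ℕ, ∀ (V : Type) [Fintype V] [DecidableEq V]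
      (H : SimpleGraph V) [DecidableRel H.Adj], H.Connected → H.IsRegularOfDegree 3 →
      N ≤ Fintype.card V → ∃ μ ∈ spectrum ℝ (H.adjMatrix ℝ), μ ∈ Set.Ioo (c - r) (c + r) := by
  -- The denominator is the guaranteed loss per geodesic vertex, so for this `m` the total loss
  -- outweighs the boundary terms.
  obtain ⟨m, hm⟩ := exists_nat_gt
    ((2 * (3 + c ^ 2 - r ^ 2) + 2 * (-2 * c * (c₀ / 2))) / (r ^ 2 - 1 - (c - c₀) ^ 2))
  rw [div_lt_iff₀ (by linarith)] at hm
  refine ⟨4 ^ m + 1, fun V _ _ H _ hc h3 hcard => ?_⟩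
  obtain ⟨w, hw, hd⟩ := exists_geodesic hc h3 m hcard
  refine exists_eigenvalue_of_geodesic hc h3 (γ := c₀ / 2) (by linarith) (by nlinarith) hr ?_ hw hd
  rw [mul_div_cancel₀ c₀ two_ne_zero]
  linarith

end Geodesic

/-! ### Maximality of gap intervals of length two -/

section Maximality

variable {α β : Type*} {G : Graph α β}

lemma adjMatrix_apply_of_simple (hG : G.Simple) (u v : V(G)) [Decidable (G.toSimpleGraph.Adj u v)] :
    adjMatrix G u v = if G.toSimpleGraph.Adj u v then 1 else 0 := by
  simp only [adjMatrix, Matrix.of_apply, Graph.toSimpleGraph_adj_iff]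
  split_ifs with h
  · obtain ⟨e, he⟩ := (Graph.toSimpleGraph_adj_iff u v).1 h
    have : {e' : β | G.IsLink e' u v} = {e} := by
      ext e'
      exact ⟨fun h' => h'.eq he, by rintro rfl; exact he⟩
    rw [this]
    simp
  · have : {e' : β | G.IsLink e' u v} = ∅ := by
      ext e'
      simp only [Set.mem_ofPred_eq, Set.mem_empty_iff_false, iff_false]
      exact fun h' => h ((Graph.toSimpleGraph_adj_iff u v).2 ⟨e', h'⟩)
    rw [this]
    simp

lemma degree_toSimpleGraph (hG : G.Simple) (v : V(G)) [Fintype (G.toSimpleGraph.neighborSet v)] :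
    G.toSimpleGraph.degree v = (G.incidenceSet v).ncard := by
  rw [← SimpleGraph.card_neighborSet_eq_degree, ← Nat.card_eq_fintype_card,
    Nat.card_coe_set_eq]
  have h : ∀ u ∈ G.toSimpleGraph.neighborSet v, ∃ e, G.IsLink e v u := fun u hu =>
    (Graph.toSimpleGraph_adj_iff v u).1 hu
  choose f hf using h
  refine Set.ncard_congr f (fun u hu => ⟨u, hf u hu⟩) ?_ ?_
  · intro u u' hu hu' he
    have h1 := hf u hu
    rw [he] at h1
    exact Subtype.ext (h1.right_unique (hf u' hu'))
  · rintro e ⟨u, hu⟩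
    have hadj : G.toSimpleGraph.Adj v ⟨u, hu.right_mem⟩ :=
      (Graph.toSimpleGraph_adj_iff _ _).2 ⟨e, hu⟩
    exact ⟨⟨u, hu.right_mem⟩, hadj, (hf _ hadj).eq hu⟩

/-- Spectral sets of cubic graphs meet every interval `(c - r, c + r)` for which some `c₀` in
`[-√2, 0]` satisfies `1 + (c - c₀)² < r²`. -/
lemma IsSpectralFor.inter_nonempty {K : Set ℝ} (hK : IsSpectralFor (fun _ _ G => G.Simple) K)
    {c₀ c r : ℝ} (h0 : c₀ ≤ 0) (h0' : c₀ ^ 2 ≤ 2) (hr : 0 < r)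
    (hcr : 1 + (c - c₀) ^ 2 < r ^ 2) : ∃ μ ∈ K, μ ∈ Set.Ioo (c - r) (c + r) := by
  obtain ⟨N, hN⟩ := exists_eigenvalue_of_large h0 h0' hr hcr
  obtain ⟨α, β, G, hfin, hG, hsimple, hcard, hspec⟩ := hK.2.2 N
  let _ : Fintype V(G) := Fintype.ofFinite V(G)
  let _ : DecidableEq V(G) := Classical.decEq V(G)
  let _ : DecidableRel G.toSimpleGraph.Adj := Classical.decRel _
  obtain ⟨μ, hμ, hμI⟩ := hN V(G) G.toSimpleGraph hG.connected
    (fun v => by rw [degree_toSimpleGraph hsimple, hG.degree_eq v v.2])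
    (by rwa [← Nat.card_eq_fintype_card])
  refine ⟨μ, hspec ?_, hμI⟩
  have : adjMatrix G = G.toSimpleGraph.adjMatrix ℝ := by
    ext u v
    rw [adjMatrix_apply_of_simple hsimple, SimpleGraph.adjMatrix_apply]
  rw [adjSpectrum, this]
  exact hμ

/-- Gap intervals of length two with centre in `[-√2, 0]` are maximal. -/
theorem IsGapInterval.maximal {c₀ : ℝ} (h0 : c₀ ≤ 0) (h0' : c₀ ^ 2 ≤ 2)
    (hI : IsGapInterval (Set.Ioo (c₀ - 1) (c₀ + 1))) :
    Maximal IsGapInterval (Set.Ioo (c₀ - 1) (c₀ + 1)) := by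
  refine ⟨hI, ?_⟩
  rintro J ⟨hJ, K, hK, rfl⟩ hIJ x hx
  have hmem : c₀ ∈ Set.Icc (-3) 3 \ K := hIJ ⟨by linarith, by linarith⟩
  have near : ∀ y ∈ Set.Icc (-3) 3 \ K, ∃ ε > 0, ∀ z, |z - y| < ε → z ∉ K := by
    intro y hy
    obtain ⟨ε, hε, h⟩ := Metric.isOpen_iff.1 hK.1.isOpen_compl y hy.2
    exact ⟨ε, hε, fun z hz => h (by rwa [Metric.mem_ball, Real.dist_eq])⟩
  have hgap : ∀ z ∈ Set.Ioo (c₀ - 1) (c₀ + 1), z ∉ K := fun z hz => (hIJ hz).2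
  constructor
  · by_contra! hxle
    obtain ⟨ε, hε, h⟩ := near (c₀ - 1) (hJ.out hx hmem ⟨hxle, by linarith⟩)
    -- Here (c - r, c + r) = (c₀ - 1 - ε, c₀ + 1), which `K` misses entirely, while 1 + (c - c₀)² =
    -- 1 + ε²/4 is smaller than r² = 1 + ε + ε²/4.
    obtain ⟨μ, hμK, hμ⟩ := hK.inter_nonempty (c := c₀ - ε / 2) (r := 1 + ε / 2) h0 h0'
      (by linarith) (by nlinarith)
    rcases lt_or_ge (c₀ - 1) μ with h' | h'
    · exact hgap μ ⟨h', by linarith [hμ.2]⟩ hμK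
    · exact h μ (by rw [abs_lt]; constructor <;> linarith [hμ.1]) hμK
  · by_contra! hxle
    obtain ⟨ε, hε, h⟩ := near (c₀ + 1) (hJ.out hmem hx ⟨by linarith, hxle⟩)
    obtain ⟨μ, hμK, hμ⟩ := hK.inter_nonempty (c := c₀ + ε / 2) (r := 1 + ε / 2) h0 h0'
      (by linarith) (by nlinarith)
    rcases lt_or_ge μ (c₀ + 1) with h' | h'
    · exact hgap μ ⟨by linarith [hμ.1], h'⟩ hμK
    · exact h μ (by rw [abs_lt]; constructor <;> linarith [hμ.2]) hμK

end Maximality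

/-! ### Quotients by almost free group actions -/

section QuotientTheory

variable {V : Type*} {W : SimpleGraph V} {Γ : Subgroup (W ≃g W)}

variable (Γ) in
/-- The orbit of a vertex. -/
def mkV (u : V) : MulAction.orbitRel.Quotient Γ V := Quotient.mk _ u

variable (Γ) in
/-- The orbit of an edge. -/
def mkE (u v : V) : Quotient (edgeSetoid W Γ) := Quotient.mk _ s(u, v)

lemma mkV_eq_mkV {u v : V} : mkV Γ u = mkV Γ v ↔ ∃ g ∈ Γ, g u = v := by
  constructor
  · intro h
    obtain ⟨g, hg⟩ := (MulAction.orbitRel Γ V).symm (Quotient.exact h)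
    exact ⟨g.1, g.2, hg⟩
  · rintro ⟨g, hg, h⟩
    refine Quotient.sound ((MulAction.orbitRel Γ V).symm ?_)
    exact ⟨⟨g, hg⟩, h⟩

lemma mkE_eq_mkE {u v u' v' : V} : mkE Γ u v = mkE Γ u' v' ↔
    ∃ g ∈ Γ, (g u = u' ∧ g v = v') ∨ (g u = v' ∧ g v = u') := by
  constructor
  · intro h
    obtain ⟨g, hg, h⟩ := Quotient.exact h
    rw [Sym2.map_mk, Sym2.eq_iff] at h
    exact ⟨g, hg, h⟩
  · rintro ⟨g, hg, h⟩
    exact Quotient.sound ⟨g, hg, by rw [Sym2.map_mk, Sym2.eq_iff]; exact h⟩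

lemma mkE_comm (u v : V) : mkE Γ u v = mkE Γ v u := by
  rw [mkE, Sym2.eq_swap, mkE]

lemma mkE_map {g : W ≃g W} (hg : g ∈ Γ) (u v : V) : mkE Γ (g u) (g v) = mkE Γ u v :=
  (mkE_eq_mkE.2 ⟨g, hg, Or.inl ⟨rfl, rfl⟩⟩).symm

lemma mkV_surjective (x : MulAction.orbitRel.Quotient Γ V) : ∃ u, mkV Γ u = x :=
  Quotient.exists_rep x

lemma isLink_mkE {u v : V} (h : W.Adj u v) :
    (quotientGraph W Γ).IsLink (mkE Γ u v) (mkV Γ u) (mkV Γ v) :=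
  ⟨u, v, h, rfl, rfl, rfl⟩

lemma isLink_mkV_iff {e : Quotient (edgeSetoid W Γ)} {u : V}
    {y : MulAction.orbitRel.Quotient Γ V} : (quotientGraph W Γ).IsLink e (mkV Γ u) y ↔
      ∃ v, W.Adj u v ∧ e = mkE Γ u v ∧ y = mkV Γ v := by
  constructor
  · rintro ⟨u', v', h, rfl, hu, rfl⟩
    obtain ⟨g, hg, hgu⟩ := mkV_eq_mkV.1 hu.symm
    refine ⟨g v', hgu ▸ g.map_rel_iff.2 h, ?_, mkV_eq_mkV.2 ⟨g, hg, rfl⟩⟩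
    rw [← hgu]
    exact (mkE_map hg u' v').symm
  · rintro ⟨v, h, rfl, rfl⟩
    exact isLink_mkE h

variable (Γ) in
/-- No nontrivial element of `Γ` fixes a vertex, and an element moving a vertex to an adjacent
one exchanges the two. -/
structure IsAlmostFree : Prop where
  free : ∀ g ∈ Γ, ∀ u, g u = u → ∀ v, g v = v
  swap : ∀ g ∈ Γ, ∀ u, W.Adj u (g u) → g (g u) = u

/-- An element identifying two edges at `u` either fixes `u`, hence is trivial, or moves `u` to its
neighbour `v'`. In the second case it swaps `u` and `v'`, so the edge is merely reversed and becomes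
a loop counted once. -/
lemma IsAlmostFree.mkE_injective (hΓ : IsAlmostFree Γ) {u v v' : V} (hv' : W.Adj u v')
    (h : mkE Γ u v = mkE Γ u v') : v = v' := by
  obtain ⟨g, hg, ⟨h1, h2⟩ | ⟨h1, h2⟩⟩ := mkE_eq_mkE.1 h
  · rw [← h2, hΓ.free g hg u h1]
  · apply g.injective
    rw [h2, ← h1, hΓ.swap g hg u (h1 ▸ hv')]

lemma ncard_incidenceSet (hΓ : IsAlmostFree Γ) (N : V → Finset V)
    (hN : ∀ u v, v ∈ N u ↔ W.Adj u v) (u : V) :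
    ((quotientGraph W Γ).incidenceSet (mkV Γ u)).ncard = (N u).card := by
  rw [← Set.ncard_coe_finset]
  symm
  refine Set.ncard_congr (fun v _ => mkE Γ u v) ?_ ?_ ?_
  · intro v hv
    exact (isLink_mkE ((hN u v).1 hv)).inc_left
  · intro v v' _ hv' h
    exact hΓ.mkE_injective ((hN u v').1 hv') h
  · rintro e ⟨y, hy⟩
    obtain ⟨v, hv, rfl, rfl⟩ := isLink_mkV_iff.1 hy
    exact ⟨v, (hN u v).2 hv, rfl⟩

/-- This expresses an entry of the adjacency matrix of the quotient through the neighbours of one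
lift, which is what makes eigenvectors pull back. -/
lemma ncard_isLink (hΓ : IsAlmostFree Γ) (N : V → Finset V) (hN : ∀ u v, v ∈ N u ↔ W.Adj u v)
    (u : V) (y : MulAction.orbitRel.Quotient Γ V) [DecidablePred fun v => mkV Γ v = y] :
    {e | (quotientGraph W Γ).IsLink e (mkV Γ u) y}.ncard =
      ((N u).filter fun v => mkV Γ v = y).card := by
  rw [← Set.ncard_coe_finset]
  symm
  refine Set.ncard_congr (fun v _ => mkE Γ u v) ?_ ?_ ?_
  · intro v hv
    obtain ⟨hvN, rfl⟩ := Finset.mem_filter.1 hv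
    exact isLink_mkE ((hN u v).1 hvN)
  · intro v v' _ hv' h
    exact hΓ.mkE_injective ((hN u v').1 (Finset.mem_filter.1 hv').1) h
  · intro e hy
    obtain ⟨v, hv, rfl, rfl⟩ := isLink_mkV_iff.1 hy
    exact ⟨v, Finset.mem_filter.2 ⟨(hN u v).2 hv, rfl⟩, rfl⟩

lemma adj_mkV {u v : V} (h : W.Adj u v) : (quotientGraph W Γ).Adj (mkV Γ u) (mkV Γ v) :=
  ⟨_, isLink_mkE h⟩

lemma connected_quotientGraph (hW : W.Connected) :
    (quotientGraph W Γ).toSimpleGraph.Connected := by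
  have key : ∀ u v, W.Reachable u v → (quotientGraph W Γ).toSimpleGraph.Reachable
      ⟨mkV Γ u, Set.mem_univ _⟩ ⟨mkV Γ v, Set.mem_univ _⟩ := by
    rintro u v ⟨p⟩
    induction p with
    | nil => exact SimpleGraph.Reachable.refl _
    | @cons u v w h _ ih =>
      refine SimpleGraph.Reachable.trans ?_ ih
      -- A step that becomes a loop in the quotient is dropped, as the underlying simple graph has
      -- no loops.
      by_cases huv : mkV Γ u = mkV Γ v
      · simp only [huv]
        exact SimpleGraph.Reachable.refl _
      · exact SimpleGraph.Adj.reachable ⟨fun h' => huv (congrArg Subtype.val h'), adj_mkV h⟩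
  obtain ⟨u₀⟩ := hW.nonempty
  have : Nonempty V(quotientGraph W Γ) := ⟨⟨mkV Γ u₀, Set.mem_univ _⟩⟩
  refine SimpleGraph.Connected.mk ?_
  rintro ⟨x, hx⟩ ⟨y, hy⟩
  obtain ⟨u, rfl⟩ := mkV_surjective x
  obtain ⟨v, rfl⟩ := mkV_surjective y
  exact key u v (hW.preconnected u v)

lemma isCubic_quotientGraph (hΓ : IsAlmostFree Γ) (hW : W.Connected) (N : V → Finset V)
    (hN : ∀ u v, v ∈ N u ↔ W.Adj u v) (hN3 : ∀ u, (N u).card = 3) :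
    IsCubic (quotientGraph W Γ) := by
  refine ⟨connected_quotientGraph hW, fun x _ => ?_⟩
  obtain ⟨u, rfl⟩ := mkV_surjective x
  rw [ncard_incidenceSet hΓ N hN, hN3]

lemma simple_quotientGraph (h₁ : ∀ u v, W.Adj u v → mkV Γ u ≠ mkV Γ v)
    (h₂ : ∀ u v v', W.Adj u v → W.Adj u v' → mkV Γ v = mkV Γ v' → v = v') :
    (quotientGraph W Γ).Simple where
  not_isLoopAt e x h := by
    obtain ⟨u, rfl⟩ := mkV_surjective x
    obtain ⟨v, hv, -, h'⟩ := isLink_mkV_iff.1 h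
    exact h₁ u v hv h'
  eq_of_isLink e f x y he hf := by
    obtain ⟨u, rfl⟩ := mkV_surjective x
    obtain ⟨v, hv, rfl, rfl⟩ := isLink_mkV_iff.1 he
    obtain ⟨v', hv', rfl, h⟩ := isLink_mkV_iff.1 hf
    rw [h₂ u v v' hv hv' h]

/-- A finite set of vertices meeting every orbit exactly once. -/
structure IsFundamental (Γ : Subgroup (W ≃g W)) (F : Finset V) : Prop where
  inj : ∀ u ∈ F, ∀ v ∈ F, mkV Γ u = mkV Γ v → u = v
  surj : ∀ u, ∃ v ∈ F, mkV Γ v = mkV Γ u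

lemma IsFundamental.finite_and_card {F : Finset V} (hF : IsFundamental Γ F) :
    Finite V(quotientGraph W Γ) ∧ Nat.card V(quotientGraph W Γ) = F.card := by
  let f : F → V(quotientGraph W Γ) := fun u => ⟨mkV Γ u.1, Set.mem_univ _⟩
  have hf : Function.Bijective f := by
    constructor
    · rintro ⟨u, hu⟩ ⟨v, hv⟩ h
      exact Subtype.ext (hF.inj u hu v hv (congrArg Subtype.val h))
    · rintro ⟨x, hx⟩
      obtain ⟨u, rfl⟩ := mkV_surjective x
      obtain ⟨v, hv, h⟩ := hF.surj u
      exact ⟨⟨v, hv⟩, Subtype.ext h⟩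
  exact ⟨Finite.of_surjective f hf.2, by
    rw [← Nat.card_congr (Equiv.ofBijective f hf), Nat.card_eq_fintype_card, Fintype.card_coe]⟩

/-- An eigenvector of a finite quotient lifts to a function on the vertices that takes finitely
many values. -/
lemma exists_lift_of_mem_adjSpectrum (hΓ : IsAlmostFree Γ) (N : V → Finset V)
    (hN : ∀ u v, v ∈ N u ↔ W.Adj u v) [Finite V(quotientGraph W Γ)] {μ : ℝ}
    (hμ : μ ∈ adjSpectrum (quotientGraph W Γ)) :
    ∃ f : V → ℝ, (Set.range f).Finite ∧ (∃ u, f u ≠ 0) ∧ ∀ u, ∑ v ∈ N u, f v = μ * f u := by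
  classical
  let _ : Fintype V(quotientGraph W Γ) := Fintype.ofFinite _
  rw [adjSpectrum] at hμ
  obtain ⟨x, hx0, hx⟩ := (@mem_spectrum_iff_exists_mulVec _ _ (Classical.decEq _) _ _).1 hμ
  let π : V → V(quotientGraph W Γ) := fun u => ⟨mkV Γ u, Set.mem_univ _⟩
  refine ⟨fun u => x (π u), (Set.finite_range x).subset ?_, ?_, fun u => ?_⟩
  · rintro _ ⟨u, rfl⟩
    exact ⟨π u, rfl⟩
  · by_contra! h
    apply hx0
    ext ⟨y, hy⟩
    obtain ⟨u, rfl⟩ := mkV_surjective y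
    exact h u
  · have h := congrFun hx (π u)
    rw [Pi.smul_apply, smul_eq_mul] at h
    rw [← h]
    simp only [Matrix.mulVec, dotProduct]
    -- Group the neighbours of `u` by orbit; the size of each group is the matrix entry.
    rw [← Finset.sum_fiberwise (N u) π fun v => x (π v)]
    refine Finset.sum_congr rfl fun y _ => ?_
    rw [Finset.sum_congr rfl (g := fun _ => x y)
      (fun v hv => by rw [(Finset.mem_filter.1 hv).2]), Finset.sum_const, nsmul_eq_mul]
    congr 1
    rw [adjMatrix, Matrix.of_apply]
    change _ = (({e | (quotientGraph W Γ).IsLink e (mkV Γ u) y.1}.ncard : ℕ) : ℝ)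
    rw [ncard_isLink hΓ N hN u y.1]
    congr 3
    ext v
    exact Subtype.ext_iff

end QuotientTheory

/-! ### Graphs on a two-row strip and their groups of automorphisms -/

section Strip

/-- The features common to `Wbar_a` and `Wbar_b`: the rows are paths, some edge joins the two rows,
and adjacent vertices lie in the same column or in consecutive ones. -/
structure IsStrip (W : SimpleGraph (ℤ × Bool)) : Prop where
  row : ∀ k i, W.Adj (k, i) (k + 1, i)
  cross : W.Adj (0, true) (1, false)
  col : ∀ u v, W.Adj u v → v.1 = u.1 + 1 ∨ u.1 = v.1 + 1 ∨ u.1 = v.1 ∧ u.2 ≠ v.2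

variable {W : SimpleGraph (ℤ × Bool)} {Γ : Subgroup (W ≃g W)}

lemma IsStrip.connected (hW : IsStrip W) : W.Connected := by
  have row : ∀ (i : Bool) (k : ℤ), W.Reachable (0, i) (k, i) := by
    intro i k
    induction k using Int.induction_on with
    | zero => exact SimpleGraph.Reachable.refl _
    | succ k ih => exact ih.trans (hW.row k i).reachable
    | pred k ih =>
      refine ih.trans (SimpleGraph.Adj.reachable ?_)
      have := hW.row (-(k : ℤ) - 1) i
      rw [sub_add_cancel] at this
      exact this.symm
  have key : ∀ u, W.Reachable (0, true) u := by
    rintro ⟨k, _ | _⟩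
    · exact (hW.cross.reachable.trans (row false 1).symm).trans (row false k)
    · exact row true k
  exact SimpleGraph.Connected.mk fun u v => (key u).symm.trans (key v)

/-- `Γ` is the group of translations by the multiples of `P` columns. -/
structure IsShift (Γ : Subgroup (W ≃g W)) (P : ℤ) : Prop where
  elim : ∀ g ∈ Γ, ∃ j : ℤ, ∀ u, g u = (u.1 + P * j, u.2)
  shift : ∀ j : ℤ, ∃ g ∈ Γ, ∀ u, g u = (u.1 + P * j, u.2)

/-- `Γ` is the group of translations by the multiples of `P` columns and of the rotations
`(k, i) ↦ (m + P j - k, !i)`. -/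
structure IsDihedral (Γ : Subgroup (W ≃g W)) (P m : ℤ) : Prop where
  elim : ∀ g ∈ Γ, ∃ j : ℤ, (∀ u, g u = (u.1 + P * j, u.2)) ∨ ∀ u, g u = (m + P * j - u.1, !u.2)
  shift : ∀ j : ℤ, ∃ g ∈ Γ, ∀ u, g u = (u.1 + P * j, u.2)
  rot : ∀ j : ℤ, ∃ g ∈ Γ, ∀ u, g u = (m + P * j - u.1, !u.2)

lemma inv_apply_eq {g : W ≃g W} {u v : ℤ × Bool} (h : g v = u) : g⁻¹ u = v := by
  rw [← h]
  exact g.symm_apply_apply v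

lemma zpow_shift_apply {τ : W ≃g W} {P : ℤ} (hτ : ∀ u, τ u = (u.1 + P, u.2)) (j : ℤ)
    (u : ℤ × Bool) : (τ ^ j : W ≃g W) u = (u.1 + P * j, u.2) := by
  have hinv : ∀ u, τ⁻¹ u = (u.1 - P, u.2) := fun u =>
    inv_apply_eq (by rw [hτ, sub_add_cancel])
  induction j using Int.induction_on generalizing u with
  | zero => simp
  | succ k ih =>
    rw [zpow_add_one, RelIso.mul_apply, hτ, ih]
    exact Prod.ext (by dsimp only; ring1) rfl
  | pred k ih =>
    rw [zpow_sub_one, RelIso.mul_apply, hinv, ih]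
    exact Prod.ext (by dsimp only; ring1) rfl

lemma isShift_zpowers {τ : W ≃g W} {P : ℤ} (hτ : ∀ u, τ u = (u.1 + P, u.2)) :
    IsShift (Subgroup.zpowers τ) P where
  elim := by
    intro g hg
    obtain ⟨j, rfl⟩ := Subgroup.mem_zpowers_iff.1 hg
    exact ⟨j, zpow_shift_apply hτ j⟩
  shift j := ⟨τ ^ j, Subgroup.zpow_mem_zpowers τ j, zpow_shift_apply hτ j⟩

/-- The product `σ' * σ` is the translation by `P`, and its powers times `σ` are the rotations.
Conversely, these two families together are closed under products and inverses. -/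
lemma isDihedral_closure {σ σ' : W ≃g W} {P m : ℤ} (hσ : ∀ u, σ u = (m - u.1, !u.2))
    (hσ' : ∀ u, σ' u = (m + P - u.1, !u.2)) : IsDihedral (Subgroup.closure {σ, σ'}) P m := by
  have hσm : σ ∈ Subgroup.closure {σ, σ'} := Subgroup.subset_closure (by simp)
  have hσm' : σ' ∈ Subgroup.closure {σ, σ'} := Subgroup.subset_closure (by simp)
  have hτ : ∀ u, (σ' * σ) u = (u.1 + P, u.2) := fun u => by
    rw [RelIso.mul_apply, hσ, hσ']
    exact Prod.ext (by dsimp only; ring1) (by simp)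
  have hshift : ∀ j : ℤ, ∃ g ∈ Subgroup.closure {σ, σ'}, ∀ u, g u = (u.1 + P * j, u.2) :=
    fun j => ⟨(σ' * σ) ^ j, Subgroup.zpow_mem _ (Subgroup.mul_mem _ hσm' hσm) j,
      zpow_shift_apply hτ j⟩
  refine ⟨?_, hshift, ?_⟩
  · intro g hg
    induction hg using Subgroup.closure_induction with
    | mem x hx =>
      rcases hx with rfl | rfl
      · exact ⟨0, Or.inr fun u => by rw [hσ]; simp⟩
      · exact ⟨1, Or.inr fun u => by rw [hσ']; simp⟩
    | one => exact ⟨0, Or.inl fun u => by simp⟩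
    | mul x y _ _ hx hy =>
      obtain ⟨j, hx | hx⟩ := hx <;> obtain ⟨l, hy | hy⟩ := hy
      · exact ⟨l + j, Or.inl fun u => by
          rw [RelIso.mul_apply, hy, hx]; exact Prod.ext (by dsimp only; ring1) rfl⟩
      · exact ⟨l + j, Or.inr fun u => by
          rw [RelIso.mul_apply, hy, hx]; exact Prod.ext (by dsimp only; ring1) rfl⟩
      · exact ⟨j - l, Or.inr fun u => by
          rw [RelIso.mul_apply, hy, hx]; exact Prod.ext (by dsimp only; ring1) rfl⟩
      · exact ⟨j - l, Or.inl fun u => by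
          rw [RelIso.mul_apply, hy, hx]; exact Prod.ext (by dsimp only; ring1) (by simp)⟩
    | inv x _ hx =>
      obtain ⟨j, hx | hx⟩ := hx
      · exact ⟨-j, Or.inl fun u =>
          inv_apply_eq (by rw [hx]; exact Prod.ext (by dsimp only; ring1) (by simp))⟩
      · exact ⟨j, Or.inr fun u =>
          inv_apply_eq (by rw [hx]; exact Prod.ext (by dsimp only; ring1) (by simp))⟩
  · intro j
    obtain ⟨g, hg, h⟩ := hshift j
    exact ⟨g * σ, Subgroup.mul_mem _ hg hσm, fun u => by
      rw [RelIso.mul_apply, hσ, h]; exact Prod.ext (by dsimp only; ring1) rfl⟩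

lemma eq_zero_of_mul_eq {P j x : ℤ} (h : P * j = x) (h1 : -P < x) (h2 : x < P) : j = 0 := by
  rcases lt_trichotomy j 0 with hj | hj | hj
  · nlinarith
  · exact hj
  · nlinarith

/-! ### Orbits and almost freeness -/

lemma IsShift.mkV_eq_iff {P : ℤ} (hΓ : IsShift Γ P) {u v : ℤ × Bool} :
    mkV Γ u = mkV Γ v ↔ ∃ j, v = (u.1 + P * j, u.2) := by
  rw [mkV_eq_mkV]
  constructor
  · rintro ⟨g, hg, rfl⟩
    obtain ⟨j, hj⟩ := hΓ.elim g hg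
    exact ⟨j, hj u⟩
  · rintro ⟨j, rfl⟩
    obtain ⟨g, hg, h⟩ := hΓ.shift j
    exact ⟨g, hg, h u⟩

lemma IsDihedral.mkV_eq_iff {P m : ℤ} (hΓ : IsDihedral Γ P m) {u v : ℤ × Bool} :
    mkV Γ u = mkV Γ v ↔ ∃ j, v = (u.1 + P * j, u.2) ∨ v = (m + P * j - u.1, !u.2) := by
  rw [mkV_eq_mkV]
  constructor
  · rintro ⟨g, hg, rfl⟩
    obtain ⟨j, hj | hj⟩ := hΓ.elim g hg
    · exact ⟨j, Or.inl (hj u)⟩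
    · exact ⟨j, Or.inr (hj u)⟩
  · rintro ⟨j, rfl | rfl⟩
    · obtain ⟨g, hg, h⟩ := hΓ.shift j
      exact ⟨g, hg, h u⟩
    · obtain ⟨g, hg, h⟩ := hΓ.rot j
      exact ⟨g, hg, h u⟩

lemma shift_free {P j : ℤ} {g : W ≃g W} (hg : ∀ u, g u = (u.1 + P * j, u.2))
    {u : ℤ × Bool} (h : g u = u) (v : ℤ × Bool) : g v = v := by
  rw [hg] at h
  have : P * j = 0 := by
    have := congrArg Prod.fst h
    simp only at this
    omega
  rw [hg, this, add_zero]

lemma shift_not_adj (hW : IsStrip W) {P j : ℤ} (hP : 2 ≤ P) {g : W ≃g W}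
    (hg : ∀ u, g u = (u.1 + P * j, u.2)) (u : ℤ × Bool) : ¬ W.Adj u (g u) := by
  intro h
  rw [hg] at h
  have hj : P * j = 1 ∨ P * j = -1 := by
    rcases hW.col _ _ h with h' | h' | h'
    · exact Or.inl (by simpa using h')
    · exact Or.inr (by simp only at h'; omega)
    · exact absurd rfl h'.2
  have : j = 0 := by
    rcases hj with hj | hj
    · exact eq_zero_of_mul_eq hj (by omega) (by omega)
    · exact eq_zero_of_mul_eq hj (by omega) (by omega)
  simp [this] at hj

lemma IsShift.isAlmostFree (hW : IsStrip W) {P : ℤ} (hP : 2 ≤ P) (hΓ : IsShift Γ P) :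
    IsAlmostFree Γ where
  free g hg u hu v := by
    obtain ⟨j, hj⟩ := hΓ.elim g hg
    exact shift_free hj hu v
  swap g hg u hu := by
    obtain ⟨j, hj⟩ := hΓ.elim g hg
    exact absurd hu (shift_not_adj hW hP hj u)

/-- A rotation exchanges the rows, so it fixes no vertex, and it is an involution, so it swaps any
vertex with its image. -/
lemma IsDihedral.isAlmostFree (hW : IsStrip W) {P m : ℤ} (hP : 2 ≤ P) (hΓ : IsDihedral Γ P m) :
    IsAlmostFree Γ where
  free g hg u hu v := by
    obtain ⟨j, hj | hj⟩ := hΓ.elim g hg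
    · exact shift_free hj hu v
    · rw [hj] at hu
      exact absurd (congrArg Prod.snd hu) (by simp)
  swap g hg u hu := by
    obtain ⟨j, hj | hj⟩ := hΓ.elim g hg
    · exact absurd hu (shift_not_adj hW hP hj u)
    · rw [hj, hj]
      simp

/-! ### Fundamental domains -/

/-- The columns `L, …, L + H - 1`. -/
noncomputable def block (L H : ℤ) : Finset (ℤ × Bool) := Finset.Ico L (L + H) ×ˢ Finset.univ

lemma mem_block {L H : ℤ} {u : ℤ × Bool} : u ∈ block L H ↔ L ≤ u.1 ∧ u.1 < L + H := by
  simp [block]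

lemma card_block (L : ℤ) (H : ℕ) : (block L H).card = 2 * H := by
  simp [block, mul_comm]

lemma exists_shift_mem_Ico {P : ℤ} (hP : 0 < P) (L k : ℤ) : ∃ j, L ≤ k + P * j ∧ k + P * j < L + P := by
  refine ⟨-((k - L) / P), ?_⟩
  have h1 := Int.emod_nonneg (k - L) hP.ne'
  have h2 := Int.emod_lt_of_pos (k - L) hP
  have h3 := Int.emod_add_mul_ediv (k - L) P
  constructor <;> linarith

lemma IsShift.isFundamental {P : ℤ} (hP : 0 < P) (hΓ : IsShift Γ P) (L : ℤ) :
    IsFundamental Γ (block L P) where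
  inj u hu v hv h := by
    rw [mem_block] at hu hv
    obtain ⟨j, hj⟩ := hΓ.mkV_eq_iff.1 h
    have h1 : P * j = v.1 - u.1 := by rw [hj]; ring
    rw [hj, eq_zero_of_mul_eq h1 (by omega) (by omega)]
    simp
  surj u := by
    obtain ⟨j, hj⟩ := exists_shift_mem_Ico hP L u.1
    exact ⟨(u.1 + P * j, u.2), mem_block.2 hj, (hΓ.mkV_eq_iff.2 ⟨j, rfl⟩).symm⟩

/-- Every vertex can be moved to the columns `L, …, L + H` by rotations centred at `L` or `L - 1/2`
and translations. -/
lemma IsDihedral.exists_mem_Icc {H m : ℤ} (hH : 0 < H) (hΓ : IsDihedral Γ (2 * H) m) {L : ℤ}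
    (hL : 2 * L - 1 ≤ m) (hL' : m ≤ 2 * L) (u : ℤ × Bool) :
    ∃ g ∈ Γ, L ≤ (g u).1 ∧ (g u).1 ≤ m - L + H := by
  obtain ⟨j, hj, hj'⟩ := exists_shift_mem_Ico (P := 2 * H) (by omega) L u.1
  -- A translation brings the column into one period of length 2H; if it lands in the far half, the
  -- rotation about the far centre folds it back.
  rcases le_or_gt (u.1 + 2 * H * j) (m - L + H) with h | h
  · obtain ⟨g, hg, h'⟩ := hΓ.shift j
    exact ⟨g, hg, by rw [h']; exact ⟨hj, h⟩⟩
  · obtain ⟨g, hg, h'⟩ := hΓ.rot (1 - j)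
    refine ⟨g, hg, ?_⟩
    rw [h']
    simp only
    have : 2 * H * (1 - j) = 2 * H - 2 * H * j := by ring
    constructor <;> omega

/-- If the centres of the rotations lie between two columns, a block of columns is a fundamental
domain. -/
lemma IsDihedral.isFundamental_block {H L : ℤ} (hH : 0 < H)
    (hΓ : IsDihedral Γ (2 * H) (2 * L - 1)) : IsFundamental Γ (block L H) where
  inj u hu v hv h := by
    rw [mem_block] at hu hv
    obtain ⟨j, hj | hj⟩ := hΓ.mkV_eq_iff.1 h
    · have h1 : 2 * H * j = v.1 - u.1 := by rw [hj]; ring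
      rw [hj, eq_zero_of_mul_eq h1 (by omega) (by omega)]
      simp
    -- The right side lies between 1 and 2H - 1, so it is not a multiple of 2H.
    · have h1 : 2 * H * j = v.1 + u.1 - 2 * L + 1 := by rw [hj]; ring
      have := eq_zero_of_mul_eq h1 (by omega) (by omega)
      rw [this] at h1
      omega
  surj u := by
    obtain ⟨g, hg, h1, h2⟩ := hΓ.exists_mem_Icc hH (L := L) (by omega) (by omega) u
    exact ⟨g u, mem_block.2 ⟨h1, by omega⟩, (mkV_eq_mkV.2 ⟨g, hg, rfl⟩).symm⟩

/-- The columns `L + 1, …, L + H - 1` and one vertex of each of the columns `L` and `L + H`. -/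
noncomputable def cappedBlock (L H : ℤ) : Finset (ℤ × Bool) :=
  insert (L, false) (insert (L + H, false) (block (L + 1) (H - 1)))

lemma mem_cappedBlock {L H : ℤ} {u : ℤ × Bool} : u ∈ cappedBlock L H ↔
    u = (L, false) ∨ u = (L + H, false) ∨ (L < u.1 ∧ u.1 < L + H) := by
  rw [cappedBlock, Finset.mem_insert, Finset.mem_insert, mem_block]
  have : (L + 1 ≤ u.1 ∧ u.1 < L + 1 + (H - 1)) ↔ (L < u.1 ∧ u.1 < L + H) := by omega
  rw [this]

lemma card_cappedBlock (L : ℤ) {H : ℕ} (hH : 0 < H) : (cappedBlock L H).card = 2 * H := by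
  rw [cappedBlock, Finset.card_insert_of_notMem, Finset.card_insert_of_notMem]
  · obtain ⟨H, rfl⟩ := Nat.exists_eq_succ_of_ne_zero hH.ne'
    have : ((H.succ : ℤ) - 1) = (H : ℤ) := by push_cast; ring
    rw [this, card_block]
    omega
  · rw [mem_block]; simp only; omega
  · rw [Finset.mem_insert, mem_block, Prod.mk.injEq]; simp only; omega

/-- If the centres of the rotations lie on columns, a block of columns with halved ends is a
fundamental domain. -/
lemma IsDihedral.isFundamental_cappedBlock {H L : ℤ} (hH : 0 < H)
    (hΓ : IsDihedral Γ (2 * H) (2 * L)) : IsFundamental Γ (cappedBlock L H) where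
  inj u hu v hv h := by
    have hu' : L ≤ u.1 ∧ u.1 ≤ L + H ∧ (u.1 = L ∨ u.1 = L + H → u.2 = false) := by
      rcases mem_cappedBlock.1 hu with rfl | rfl | h
      · simp [hH.le]
      · simp [hH.le]
      · exact ⟨by omega, by omega, by omega⟩
    have hv' : L ≤ v.1 ∧ v.1 ≤ L + H ∧ (v.1 = L ∨ v.1 = L + H → v.2 = false) := by
      rcases mem_cappedBlock.1 hv with rfl | rfl | h
      · simp [hH.le]
      · simp [hH.le]
      · exact ⟨by omega, by omega, by omega⟩
    obtain ⟨j, hj | hj⟩ := hΓ.mkV_eq_iff.1 h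
    · have h1 : 2 * H * j = v.1 - u.1 := by rw [hj]; ring
      rw [hj, eq_zero_of_mul_eq h1 (by omega) (by omega)]
      simp
    · exfalso
      have h2 : v.2 = !u.2 := by rw [hj]
      have h1 : 2 * H * j = v.1 + u.1 - 2 * L := by rw [hj]; ring
      -- The sum of the offsets lies in [0, 2H] and is a multiple of 2H, so both vertices are in
      -- column L or both in column L + H. Only one row is kept there, whereas a rotation changes
      -- the row.
      have hends : (u.1 = L ∨ u.1 = L + H) ∧ (v.1 = L ∨ v.1 = L + H) := by
        by_cases h3 : v.1 + u.1 - 2 * L = 2 * H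
        · omega
        · have := eq_zero_of_mul_eq h1 (by omega) (by omega)
          rw [this] at h1
          omega
      rw [hu'.2.2 hends.1, hv'.2.2 hends.2] at h2
      exact absurd h2 (by simp)
  surj u := by
    obtain ⟨g, hg, h1, h2⟩ := hΓ.exists_mem_Icc hH (L := L) (by omega) (by omega) u
    have hgu : mkV Γ u = mkV Γ (g u) := mkV_eq_mkV.2 ⟨g, hg, rfl⟩
    rcases h : g u with ⟨k, i⟩
    rw [h] at h1 h2 hgu
    simp only at h1 h2
    rcases eq_or_ne k L with rfl | hk
    · refine ⟨(k, false), mem_cappedBlock.2 (Or.inl rfl), ?_⟩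
      rw [hgu]
      cases i
      · rfl
      · exact hΓ.mkV_eq_iff.2 ⟨0, Or.inr (by ext <;> simp; ring)⟩
    · rcases eq_or_ne k (L + H) with rfl | hk'
      · refine ⟨(L + H, false), mem_cappedBlock.2 (Or.inr (Or.inl rfl)), ?_⟩
        rw [hgu]
        cases i
        · rfl
        · exact hΓ.mkV_eq_iff.2 ⟨1, Or.inr (by ext <;> simp; ring)⟩
      · exact ⟨(k, i), mem_cappedBlock.2 (Or.inr (Or.inr ⟨by omega, by omega⟩)), hgu.symm⟩

end Strip

/-! ### Bounded eigenfunctions on the strips -/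

section Eigenfunctions

lemma exists_abs_max {ι : Type*} [Nonempty ι] {f : ι → ℝ} (hf : (Set.range f).Finite) :
    ∃ i, ∀ j, |f j| ≤ |f i| := by
  obtain ⟨_, ⟨i, rfl⟩, hi⟩ := Set.exists_max_image (Set.range f) abs hf (Set.range_nonempty f)
  exact ⟨i, fun j => hi _ ⟨j, rfl⟩⟩

/-- Evaluate the eigenvalue equation where |f| is largest; finiteness of the range makes the maximum
attained. -/
lemma eigenvalue_mem_Icc {V : Type*} {f : V → ℝ} (hf : (Set.range f).Finite)
    (h0 : ∃ u, f u ≠ 0) (N : V → Finset V) (hN : ∀ u, (N u).card = 3) {μ : ℝ}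
    (h : ∀ u, ∑ v ∈ N u, f v = μ * f u) : μ ∈ Set.Icc (-3) 3 := by
  obtain ⟨u₀, hu₀⟩ := h0
  have : Nonempty V := ⟨u₀⟩
  obtain ⟨u, hu⟩ := exists_abs_max hf
  have hpos : 0 < |f u| := (abs_pos.2 hu₀).trans_le (hu u₀)
  have h1 : |μ| * |f u| ≤ 3 * |f u| := by
    rw [← abs_mul, ← h]
    refine (Finset.abs_sum_le_sum_abs _ _).trans ?_
    refine (Finset.sum_le_card_nsmul _ _ _ fun v _ => hu v).trans ?_
    rw [hN]
    simp
  exact abs_le.1 (le_of_mul_le_mul_right h1 hpos)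

lemma finite_range_row_add {f : ℤ × Bool → ℝ} (hf : (Set.range f).Finite) :
    (Set.range fun k : ℤ => f (k, true) + f (k, false)).Finite := by
  refine (Set.Finite.image2 (fun a b => a + b) hf hf).subset ?_
  rintro _ ⟨k, rfl⟩
  exact ⟨_, ⟨_, rfl⟩, _, ⟨_, rfl⟩, rfl⟩

lemma eq_zero_of_add_sub {f : ℤ × Bool → ℝ} (hs : ∀ k, f (k, true) + f (k, false) = 0)
    (hd : ∀ k, f (k, true) - f (k, false) = 0) (u : ℤ × Bool) : f u = 0 := by
  obtain ⟨k, _ | _⟩ := u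
  · linarith [hs k, hd k]
  · linarith [hs k, hd k]

/-- `μ` is an eigenvalue of the adjacency operator of `Wbar_b` at `f`. -/
structure EigenB (f : ℤ × Bool → ℝ) (μ : ℝ) : Prop where
  even : ∀ k i, k % 2 = 0 → f (k + 1, true) + f (k + 1, false) + f (k - 1, i) = μ * f (k, i)
  odd : ∀ k i, k % 2 = 1 → f (k - 1, true) + f (k - 1, false) + f (k + 1, i) = μ * f (k, i)

/-- For the row sum s, take k with |s k| maximal and use the equation at the other column of its
hourglass: s k occurs there with coefficient 2, so 2|s k| ≤ (|μ| + 1)|s k|, which forces s k = 0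
when |μ| < 1. In the row difference d the hourglass terms cancel; only the two columns joined along
the rows interact, and d = μ² d. -/
lemma EigenB.eq_zero {f : ℤ × Bool → ℝ} {μ : ℝ} (hf : (Set.range f).Finite) (h : EigenB f μ)
    (hμ : μ ∈ Set.Ioo (-1) 1) (u : ℤ × Bool) : f u = 0 := by
  obtain ⟨hμ1, hμ2⟩ := hμ
  have hsq : μ * μ < 1 := by nlinarith
  refine eq_zero_of_add_sub ?_ ?_ u
  · set s : ℤ → ℝ := fun k => f (k, true) + f (k, false) with hs
    have e0 : ∀ k, k % 2 = 0 → 2 * s (k + 1) + s (k - 1) = μ * s k := fun k hk => by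
      linear_combination h.even k true hk + h.even k false hk
    have e1 : ∀ k, k % 2 = 1 → 2 * s (k - 1) + s (k + 1) = μ * s k := fun k hk => by
      linear_combination h.odd k true hk + h.odd k false hk
    obtain ⟨k, hk⟩ := exists_abs_max (finite_range_row_add hf)
    have hk : ∀ j, |s j| ≤ |s k| := hk
    have key : ∀ a b, 2 * s k + a = μ * b → |a| ≤ |s k| → |b| ≤ |s k| → s k = 0 := by
      intro a b hab ha hb
      have h1 : 2 * |s k| ≤ |μ| * |b| + |a| := by
        rw [← abs_mul, ← hab, ← abs_of_pos (two_pos : (0 : ℝ) < 2), ← abs_mul,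
          abs_of_pos (two_pos : (0 : ℝ) < 2)]
        calc |2 * s k| = |2 * s k + a - a| := by ring_nf
          _ ≤ _ := abs_sub _ _
      have h2 : |μ| < 1 := abs_lt.2 ⟨by linarith, hμ2⟩
      have h3 : |μ| * |b| ≤ |μ| * |s k| := mul_le_mul_of_nonneg_left hb (abs_nonneg _)
      have h4 := abs_nonneg (s k)
      exact abs_eq_zero.1 (le_antisymm (by nlinarith) h4)
    have hsk : s k = 0 := by
      rcases Int.emod_two_eq_zero_or_one k with h0 | h0
      · refine key _ _ ?_ (hk (k + 1 + 1)) (hk (k + 1))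
        have := e1 (k + 1) (by omega)
        rwa [add_sub_cancel_right] at this
      · refine key _ _ ?_ (hk (k - 1 - 1)) (hk (k - 1))
        have := e0 (k - 1) (by omega)
        rwa [sub_add_cancel] at this
    intro j
    have := hk j
    rw [hsk, abs_zero] at this
    exact abs_eq_zero.1 (le_antisymm this (abs_nonneg _))
  · set d : ℤ → ℝ := fun k => f (k, true) - f (k, false) with hd
    have e0 : ∀ k, k % 2 = 0 → d (k - 1) = μ * d k := fun k hk => by
      linear_combination h.even k true hk - h.even k false hk
    have e1 : ∀ k, k % 2 = 1 → d (k + 1) = μ * d k := fun k hk => by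
      linear_combination h.odd k true hk - h.odd k false hk
    have key : ∀ a b, a = μ * b → b = μ * a → a = 0 := fun a b h1 h2 => by
      have : (1 - μ * μ) * a = 0 := by rw [h2] at h1; linarith
      exact (mul_eq_zero.1 this).resolve_left (by linarith)
    intro k
    rcases Int.emod_two_eq_zero_or_one k with h0 | h0
    · refine key _ (d (k - 1)) ?_ (e0 k h0)
      have := e1 (k - 1) (by omega)
      rwa [sub_add_cancel] at this
    · refine key _ (d (k + 1)) ?_ (e1 k h0)
      have := e0 (k + 1) (by omega)
      rwa [add_sub_cancel_right] at this

/-- `μ` is an eigenvalue of the adjacency operator of `Wbar_a` at `f`. -/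
structure EigenA (f : ℤ × Bool → ℝ) (μ : ℝ) : Prop where
  left : ∀ k i, k % 3 = 0 → f (k + 1, true) + f (k + 1, false) + f (k - 1, i) = μ * f (k, i)
  right : ∀ k i, k % 3 = 1 → f (k - 1, true) + f (k - 1, false) + f (k + 1, i) = μ * f (k, i)
  bar : ∀ k i, k % 3 = 2 → f (k, !i) + f (k - 1, i) + f (k + 1, i) = μ * f (k, i)

/-- Both parts are reduced to the bar columns. For the row sum s, eliminating the hourglass columns
leaves a three-term recurrence whose central coefficient exceeds 4, the sum of the two outer ones,
so the maximum principle applies. The row difference d decouples at each bar into (μ - 1)(μ + 2) d =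
0. `spread` then carries the vanishing back to the hourglass columns. -/
lemma EigenA.eq_zero {f : ℤ × Bool → ℝ} {μ : ℝ} (hf : (Set.range f).Finite) (h : EigenA f μ)
    (hμ : μ ∈ Set.Ioo (-2) 0) (u : ℤ × Bool) : f u = 0 := by
  obtain ⟨hμ1, hμ2⟩ := hμ
  have hsq : μ ^ 2 - 4 ≠ 0 := by nlinarith
  have spread : ∀ s : ℤ → ℝ, (∀ k, k % 3 = 2 → s k = 0) →
      (∀ k, k % 3 = 2 → s (k + 1) = 0 ∧ s (k + 2) = 0) → ∀ k, s k = 0 := by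
    intro s h2 h01 k
    have : k % 3 = 0 ∨ k % 3 = 1 ∨ k % 3 = 2 := by omega
    rcases this with h0 | h0 | h0
    · have := (h01 (k - 1) (by omega)).1
      rwa [sub_add_cancel] at this
    · have := (h01 (k - 2) (by omega)).2
      rwa [sub_add_cancel] at this
    · exact h2 k h0
  refine eq_zero_of_add_sub ?_ ?_ u
  · set s : ℤ → ℝ := fun k => f (k, true) + f (k, false) with hs
    have e0 : ∀ k, k % 3 = 2 → 2 * s (k + 2) + s k = μ * s (k + 1) := fun k hk => by
      have h1 := h.left (k + 1) true (by omega)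
      have h2 := h.left (k + 1) false (by omega)
      rw [add_sub_cancel_right, show k + 1 + 1 = k + 2 by ring] at h1 h2
      linear_combination h1 + h2
    have e1 : ∀ k, k % 3 = 2 → 2 * s (k + 1) + s (k + 3) = μ * s (k + 2) := fun k hk => by
      have h1 := h.right (k + 2) true (by omega)
      have h2 := h.right (k + 2) false (by omega)
      rw [show k + 2 - 1 = k + 1 by ring, show k + 2 + 1 = k + 3 by ring] at h1 h2
      linear_combination h1 + h2
    have e2 : ∀ k, k % 3 = 2 → s k + s (k - 1) + s (k + 1) = μ * s k := fun k hk => by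
      have h1 := h.bar k true hk
      have h2 := h.bar k false hk
      simp only [Bool.not_true, Bool.not_false] at h1 h2
      linear_combination h1 + h2
    -- Cramer's rule for the two hourglass columns between consecutive bars, with determinant μ² -
    -- 4.
    have x : ∀ k, k % 3 = 2 → (μ ^ 2 - 4) * s (k + 1) = μ * s k + 2 * s (k + 3) := fun k hk => by
      linear_combination -μ * e0 k hk - 2 * e1 k hk
    have y : ∀ k, k % 3 = 2 → (μ ^ 2 - 4) * s (k + 2) = μ * s (k + 3) + 2 * s k := fun k hk => by
      linear_combination -μ * e1 k hk - 2 * e0 k hk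
    have z : ∀ k, k % 3 = 2 →
        (μ ^ 3 - μ ^ 2 - 6 * μ + 4) * s k = 2 * s (k + 3) + 2 * s (k - 3) := fun k hk => by
      have h1 := y (k - 3) (by omega)
      rw [sub_add_cancel, show k - 3 + 2 = k - 1 by ring] at h1
      linear_combination x k hk + h1 - (μ ^ 2 - 4) * e2 k hk
    have hz : ∀ k, k % 3 = 2 → s k = 0 := by
      have hfin : (Set.range fun h : ℤ => s (3 * h + 2)).Finite :=
        (finite_range_row_add hf).subset (by
          rintro _ ⟨j, rfl⟩
          exact ⟨3 * j + 2, rfl⟩)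
      obtain ⟨h, hh⟩ := exists_abs_max hfin
      have hmax : ∀ k, k % 3 = 2 → |s k| ≤ |s (3 * h + 2)| := fun k hk => by
        have := hh (k / 3)
        rwa [show 3 * (k / 3) + 2 = k by omega] at this
      set m := 3 * h + 2
      have hm : m % 3 = 2 := by omega
      -- Apart from the constant 4, the polynomial is μ(μ - 3)(μ + 2), which is positive on (-2, 0).
      have hc : 4 < μ ^ 3 - μ ^ 2 - 6 * μ + 4 := by
        have : 0 < (-μ) * ((3 - μ) * (μ + 2)) :=
          mul_pos (by linarith) (mul_pos (by linarith) (by linarith))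
        nlinarith
      have h1 : (μ ^ 3 - μ ^ 2 - 6 * μ + 4) * |s m| ≤ 4 * |s m| := by
        rw [← abs_of_pos (lt_trans four_pos hc), ← abs_mul, z m hm]
        refine (abs_add_le _ _).trans ?_
        rw [abs_mul, abs_mul, abs_two]
        linarith [hmax (m + 3) (by omega), hmax (m - 3) (by omega)]
      have h2 : |s m| = 0 := by
        refine le_antisymm ?_ (abs_nonneg _)
        by_contra! hpos
        nlinarith
      intro k hk
      have := hmax k hk
      rw [h2] at this
      exact abs_eq_zero.1 (le_antisymm this (abs_nonneg _))
    refine spread s hz fun k hk => ?_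
    have hz0 := hz k hk
    have hz3 := hz (k + 3) (by omega)
    have hx := x k hk
    have hy := y k hk
    rw [hz0, hz3, mul_zero, mul_zero, add_zero] at hx hy
    exact ⟨(mul_eq_zero.1 hx).resolve_left hsq, (mul_eq_zero.1 hy).resolve_left hsq⟩
  · set d : ℤ → ℝ := fun k => f (k, true) - f (k, false) with hd
    have e0 : ∀ k, k % 3 = 2 → d k = μ * d (k + 1) := fun k hk => by
      have h1 := h.left (k + 1) true (by omega)
      have h2 := h.left (k + 1) false (by omega)
      rw [add_sub_cancel_right] at h1 h2
      linear_combination h1 - h2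
    have e1 : ∀ k, k % 3 = 2 → d (k + 3) = μ * d (k + 2) := fun k hk => by
      have h1 := h.right (k + 2) true (by omega)
      have h2 := h.right (k + 2) false (by omega)
      rw [show k + 2 + 1 = k + 3 by ring] at h1 h2
      linear_combination h1 - h2
    have e2 : ∀ k, k % 3 = 2 → -d k + d (k - 1) + d (k + 1) = μ * d k := fun k hk => by
      have h1 := h.bar k true hk
      have h2 := h.bar k false hk
      simp only [Bool.not_true, Bool.not_false] at h1 h2
      linear_combination h1 - h2
    have hz : ∀ k, k % 3 = 2 → d k = 0 := by
      intro k hk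
      have h1 := e1 (k - 3) (by omega)
      rw [sub_add_cancel, show k - 3 + 2 = k - 1 by ring] at h1
      have : (μ - 1) * (μ + 2) * d k = 0 := by
        linear_combination -μ * e2 k hk - h1 - e0 k hk
      rcases mul_eq_zero.1 this with h | h
      · rcases mul_eq_zero.1 h with h | h <;> linarith
      · exact h
    refine spread d hz fun k hk => ?_
    have hx := e0 k hk
    have hy := e1 k hk
    rw [hz k hk] at hx
    rw [hz (k + 3) (by omega)] at hy
    exact ⟨(mul_eq_zero.1 hx.symm).resolve_left hμ2.ne,
      (mul_eq_zero.1 hy.symm).resolve_left hμ2.ne⟩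

end Eigenfunctions

/-! ### The strips `Wbar_b` and `Wbar_a` -/

section Strips

lemma isStrip_WbarB : IsStrip WbarB where
  row k i := Or.inl ⟨rfl, Or.inr rfl⟩
  cross := Or.inl ⟨rfl, Or.inl rfl⟩
  col := by
    rintro u v (⟨h, -⟩ | ⟨h, -⟩)
    · exact Or.inl h
    · exact Or.inr (Or.inl h)

lemma isStrip_WbarA : IsStrip WbarA where
  row k i := Or.inl ⟨rfl, Or.inr rfl⟩
  cross := Or.inl ⟨rfl, Or.inl rfl⟩
  col := by
    rintro u v (⟨h, -⟩ | ⟨h, -⟩ | ⟨h, -, h'⟩)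
    · exact Or.inl h
    · exact Or.inr (Or.inl h)
    · exact Or.inr (Or.inr ⟨h, h'⟩)

/-- The neighbours of a vertex of `Wbar_b`. -/
def nbrB (u : ℤ × Bool) : Finset (ℤ × Bool) :=
  if u.1 % 2 = 0 then {(u.1 + 1, true), (u.1 + 1, false), (u.1 - 1, u.2)}
  else {(u.1 - 1, true), (u.1 - 1, false), (u.1 + 1, u.2)}

/-- The neighbours of a vertex of `Wbar_a`. -/
def nbrA (u : ℤ × Bool) : Finset (ℤ × Bool) :=
  if u.1 % 3 = 0 then {(u.1 + 1, true), (u.1 + 1, false), (u.1 - 1, u.2)}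
  else if u.1 % 3 = 1 then {(u.1 - 1, true), (u.1 - 1, false), (u.1 + 1, u.2)}
  else {(u.1, !u.2), (u.1 - 1, u.2), (u.1 + 1, u.2)}

lemma mem_nbrB (u v : ℤ × Bool) : v ∈ nbrB u ↔ WbarB.Adj u v := by
  obtain ⟨k, i⟩ := u
  obtain ⟨l, j⟩ := v
  rw [nbrB]
  split_ifs with h <;> simp only at h <;>
    simp only [Finset.mem_insert, Finset.mem_singleton, Prod.mk.injEq, WbarB] <;>
    cases i <;> cases j <;> simp <;> omega

lemma mem_nbrA (u v : ℤ × Bool) : v ∈ nbrA u ↔ WbarA.Adj u v := by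
  obtain ⟨k, i⟩ := u
  obtain ⟨l, j⟩ := v
  rw [nbrA]
  split_ifs with h h' <;> simp only at h <;>
    simp only [Finset.mem_insert, Finset.mem_singleton, Prod.mk.injEq, WbarA] <;>
    cases i <;> cases j <;> simp <;> omega

lemma card_nbrB (u : ℤ × Bool) : (nbrB u).card = 3 := by
  rw [nbrB]
  split_ifs <;> rw [Finset.card_eq_three] <;>
    refine ⟨_, _, _, ?_, ?_, ?_, rfl⟩ <;> simp only [ne_eq, Prod.mk.injEq, not_and] <;>
    intro <;> first | omega | simp

lemma card_nbrA (u : ℤ × Bool) : (nbrA u).card = 3 := by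
  rw [nbrA]
  split_ifs <;> rw [Finset.card_eq_three] <;>
    refine ⟨_, _, _, ?_, ?_, ?_, rfl⟩ <;> simp only [ne_eq, Prod.mk.injEq, not_and] <;>
    intro <;> first | omega | simp

lemma sum_triple {V : Type*} [DecidableEq V] {a b c : V} (h : ({a, b, c} : Finset V).card = 3)
    (f : V → ℝ) : ∑ v ∈ ({a, b, c} : Finset V), f v = f a + f b + f c := by
  have hab : a ≠ b := by
    rintro rfl
    rw [Finset.insert_eq_of_mem (by simp)] at h
    exact absurd h (by have := Finset.card_le_two (a := a) (b := c); omega)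
  have hac : a ≠ c := by
    rintro rfl
    rw [Finset.insert_eq_of_mem (by simp)] at h
    exact absurd h (by have := Finset.card_le_two (a := b) (b := a); omega)
  have hbc : b ≠ c := by
    rintro rfl
    rw [Finset.insert_eq_of_mem (a := b) (by simp)] at h
    exact absurd h (by have := Finset.card_le_two (a := a) (b := b); omega)
  rw [Finset.sum_insert (by simp [hab, hac]), Finset.sum_insert (by simp [hbc]),
    Finset.sum_singleton, add_assoc]

lemma eigenB_of_sum {f : ℤ × Bool → ℝ} {μ : ℝ} (h : ∀ u, ∑ v ∈ nbrB u, f v = μ * f u) :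
    EigenB f μ where
  even k i hk := by
    have h1 := h (k, i)
    have h2 := card_nbrB (k, i)
    rw [nbrB, if_pos hk] at h1 h2
    rw [← h1, sum_triple h2]
  odd k i hk := by
    have h1 := h (k, i)
    have h2 := card_nbrB (k, i)
    rw [nbrB, if_neg (by simp only; omega)] at h1 h2
    rw [← h1, sum_triple h2]

lemma eigenA_of_sum {f : ℤ × Bool → ℝ} {μ : ℝ} (h : ∀ u, ∑ v ∈ nbrA u, f v = μ * f u) :
    EigenA f μ where
  left k i hk := by
    have h1 := h (k, i)
    have h2 := card_nbrA (k, i)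
    rw [nbrA, if_pos hk] at h1 h2
    rw [← h1, sum_triple h2]
  right k i hk := by
    have h1 := h (k, i)
    have h2 := card_nbrA (k, i)
    rw [nbrA, if_neg (by simp only; omega), if_pos (by simp only; omega)] at h1 h2
    rw [← h1, sum_triple h2]
  bar k i hk := by
    have h1 := h (k, i)
    have h2 := card_nbrA (k, i)
    rw [nbrA, if_neg (by simp only; omega), if_neg (by simp only; omega)] at h1 h2
    rw [← h1, sum_triple h2]

/-- The spectrum of a finite almost free quotient of `Wbar_b`. -/
lemma adjSpectrum_quotient_WbarB {Γ : Subgroup (WbarB ≃g WbarB)} (hΓ : IsAlmostFree Γ)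
    [Finite V(quotientGraph WbarB Γ)] :
    adjSpectrum (quotientGraph WbarB Γ) ⊆ Set.Icc (-3) 3 \ Set.Ioo (-1) 1 := by
  intro μ hμ
  obtain ⟨f, hf, h0, h⟩ := exists_lift_of_mem_adjSpectrum hΓ nbrB mem_nbrB hμ
  refine ⟨eigenvalue_mem_Icc hf h0 nbrB card_nbrB h, fun hμI => ?_⟩
  obtain ⟨u, hu⟩ := h0
  exact hu ((eigenB_of_sum h).eq_zero hf hμI u)

/-- The spectrum of a finite almost free quotient of `Wbar_a`. -/
lemma adjSpectrum_quotient_WbarA {Γ : Subgroup (WbarA ≃g WbarA)} (hΓ : IsAlmostFree Γ)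
    [Finite V(quotientGraph WbarA Γ)] :
    adjSpectrum (quotientGraph WbarA Γ) ⊆ Set.Icc (-3) 3 \ Set.Ioo (-2) 0 := by
  intro μ hμ
  obtain ⟨f, hf, h0, h⟩ := exists_lift_of_mem_adjSpectrum hΓ nbrA mem_nbrA hμ
  refine ⟨eigenvalue_mem_Icc hf h0 nbrA card_nbrA h, fun hμI => ?_⟩
  obtain ⟨u, hu⟩ := h0
  exact hu ((eigenA_of_sum h).eq_zero hf hμI u)

/-- A cubic multigraph with `m` vertices and spectrum in `[-3, 3] \ I`. -/
def HasGap {α β : Type*} (G : Graph α β) (m : ℕ) (I : Set ℝ) : Prop :=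
  ∃ _ : Finite V(G), IsCubic G ∧ Nat.card V(G) = m ∧ adjSpectrum G ⊆ Set.Icc (-3) 3 \ I

lemma HasGap.isGappedCubic {α β : Type*} {G : Graph α β} {m : ℕ} {I : Set ℝ} (h : HasGap G m I) :
    IsGappedCubic G m I := by
  obtain ⟨hfin, h1, h2, h3⟩ := h
  exact ⟨hfin, h1, h2, Set.disjoint_left.2 fun x hx => (h3 hx).2⟩

lemma hasGap_quotient_WbarB {Γ : Subgroup (WbarB ≃g WbarB)} (hΓ : IsAlmostFree Γ)
    {F : Finset (ℤ × Bool)} (hF : IsFundamental Γ F) {m : ℕ} (hm : F.card = m) :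
    HasGap (quotientGraph WbarB Γ) m (Set.Ioo (-1) 1) := by
  obtain ⟨hfin, hcard⟩ := hF.finite_and_card
  exact ⟨hfin, isCubic_quotientGraph hΓ isStrip_WbarB.connected nbrB mem_nbrB card_nbrB,
    hcard.trans hm, adjSpectrum_quotient_WbarB hΓ⟩

lemma hasGap_quotient_WbarA {Γ : Subgroup (WbarA ≃g WbarA)} (hΓ : IsAlmostFree Γ)
    {F : Finset (ℤ × Bool)} (hF : IsFundamental Γ F) {m : ℕ} (hm : F.card = m) :
    HasGap (quotientGraph WbarA Γ) m (Set.Ioo (-2) 0) := by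
  obtain ⟨hfin, hcard⟩ := hF.finite_and_card
  exact ⟨hfin, isCubic_quotientGraph hΓ isStrip_WbarA.connected nbrA mem_nbrA card_nbrA,
    hcard.trans hm, adjSpectrum_quotient_WbarA hΓ⟩

end Strips

/-! ### The five families of quotients -/

section Families

lemma isShift_hamburgerB (n : ℕ) : IsShift (Subgroup.zpowers (transB n)) (2 * n : ℕ) :=
  isShift_zpowers fun u => by push_cast; rfl

lemma isShift_hamburgerA (n : ℕ) : IsShift (Subgroup.zpowers (transA n)) (3 * n : ℕ) :=
  isShift_zpowers fun u => by push_cast; rfl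

/-- The parameters are written as `2 * H` and `2 * L - 1` with H = 2n and L = 0, the form required
by `IsDihedral.isFundamental_block`. A centre lying on a column, as for `capBarA`, gives `2 * L` and
a capped block instead. -/
lemma isDihedral_capB (n : ℕ) :
    IsDihedral (Subgroup.closure {rotB 0, rotB n}) (2 * (2 * n : ℕ)) (2 * 0 - 1) :=
  isDihedral_closure (fun u => Prod.ext (by simp [rotB]) rfl)
    (fun u => Prod.ext (by simp [rotB]; ring) rfl)

lemma isDihedral_capBarA (n : ℕ) :
    IsDihedral (Subgroup.closure {rotBar 0, rotBar n}) (2 * (3 * n : ℕ)) (2 * (-1)) :=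
  isDihedral_closure (fun u => Prod.ext (by simp [rotBar, rotA]) rfl)
    (fun u => Prod.ext (by simp [rotBar, rotA]; ring) rfl)

lemma isDihedral_capHourglassA (n : ℕ) :
    IsDihedral (Subgroup.closure {rotHourglass 0, rotHourglass n}) (2 * (3 * n : ℕ))
      (2 * 1 - 1) :=
  isDihedral_closure (fun u => Prod.ext (by simp [rotHourglass, rotA]) rfl)
    (fun u => Prod.ext (by simp [rotHourglass, rotA]; ring) rfl)

variable {n : ℕ}

lemma hasGap_hamburgerB (hn : 1 ≤ n) : HasGap (hamburgerB n) (4 * n) (Set.Ioo (-1) 1) :=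
  hasGap_quotient_WbarB ((isShift_hamburgerB n).isAlmostFree isStrip_WbarB (by omega))
    ((isShift_hamburgerB n).isFundamental (by omega) 0) (by rw [card_block]; ring)

lemma hasGap_hamburgerA (hn : 1 ≤ n) : HasGap (hamburgerA n) (6 * n) (Set.Ioo (-2) 0) :=
  hasGap_quotient_WbarA ((isShift_hamburgerA n).isAlmostFree isStrip_WbarA (by omega))
    ((isShift_hamburgerA n).isFundamental (by omega) 0) (by rw [card_block]; ring)

lemma hasGap_capB (hn : 1 ≤ n) : HasGap (capB n) (4 * n) (Set.Ioo (-1) 1) :=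
  hasGap_quotient_WbarB ((isDihedral_capB n).isAlmostFree isStrip_WbarB (by omega))
    ((isDihedral_capB n).isFundamental_block (by omega)) (by rw [card_block]; ring)

lemma hasGap_capBarA (hn : 1 ≤ n) : HasGap (capBarA n) (6 * n) (Set.Ioo (-2) 0) :=
  hasGap_quotient_WbarA ((isDihedral_capBarA n).isAlmostFree isStrip_WbarA (by omega))
    ((isDihedral_capBarA n).isFundamental_cappedBlock (by omega))
    (by rw [card_cappedBlock _ (by omega)]; ring)

lemma hasGap_capHourglassA (hn : 1 ≤ n) : HasGap (capHourglassA n) (6 * n) (Set.Ioo (-2) 0) :=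
  hasGap_quotient_WbarA ((isDihedral_capHourglassA n).isAlmostFree isStrip_WbarA (by omega))
    ((isDihedral_capHourglassA n).isFundamental_block (by omega)) (by rw [card_block]; ring)

/-- Two neighbours of one vertex are at most two columns apart, less than the period. -/
lemma simple_quotient_of_isShift {W : SimpleGraph (ℤ × Bool)} (hW : IsStrip W)
    {Γ : Subgroup (W ≃g W)} {P : ℤ} (hP : 3 ≤ P) (hΓ : IsShift Γ P) :
    (quotientGraph W Γ).Simple := by
  refine simple_quotientGraph ?_ ?_
  · intro u v huv h
    obtain ⟨g, hg, h'⟩ := mkV_eq_mkV.1 h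
    obtain ⟨j, hj⟩ := hΓ.elim g hg
    exact shift_not_adj hW (by omega) hj u (h' ▸ huv)
  · intro u v v' hv hv' h
    obtain ⟨j, hj⟩ := hΓ.mkV_eq_iff.1 h
    have h1 := hW.col u v hv
    have h2 := hW.col u v' hv'
    have h3 : P * j = v'.1 - v.1 := by rw [hj]; ring
    rw [hj, eq_zero_of_mul_eq h3 (by omega) (by omega)]
    simp

lemma simple_hamburgerB (hn : 2 ≤ n) : (hamburgerB n).Simple :=
  simple_quotient_of_isShift isStrip_WbarB (by omega) (isShift_hamburgerB n)

lemma simple_hamburgerA (hn : 1 ≤ n) : (hamburgerA n).Simple :=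
  simple_quotient_of_isShift isStrip_WbarA (by omega) (isShift_hamburgerA n)

/-- Parity excludes loops and multiple edges. A rotation maps a column to the next one only if the
left column is odd, where the edges keep the row but the rotation does not. Two neighbours exchanged
by a rotation would have an odd sum of columns, whereas their columns have equal parity. -/
lemma simple_capB (hn : 1 ≤ n) : (capB n).Simple := by
  have hΓ := isDihedral_capB n
  refine simple_quotientGraph ?_ ?_
  · intro u v huv h
    obtain ⟨g, hg, h'⟩ := mkV_eq_mkV.1 h
    obtain ⟨j, hj | hj⟩ := hΓ.elim g hg
    · exact shift_not_adj isStrip_WbarB (by omega) hj u (h' ▸ huv)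
    · rw [hj] at h'
      subst h'
      have e : (2 * ((2 * n : ℕ) : ℤ)) * j = 4 * (n * j) := by push_cast; ring
      simp only [WbarB, e] at huv
      rcases huv with ⟨h1, h2 | h2⟩ | ⟨h1, h2 | h2⟩
      · omega
      · exact absurd h2 (by simp)
      · omega
      · exact absurd h2 (by simp)
  · intro u v v' hv hv' h
    have h1 := isStrip_WbarB.col u v hv
    have h2 := isStrip_WbarB.col u v' hv'
    obtain ⟨j, hj | hj⟩ := hΓ.mkV_eq_iff.1 h
    · have h3 : (2 * ((2 * n : ℕ) : ℤ)) * j = v'.1 - v.1 := by rw [hj]; ring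
      rw [hj, eq_zero_of_mul_eq h3 (by omega) (by omega)]
      simp
    · exfalso
      have e : (2 * ((2 * n : ℕ) : ℤ)) * j = 4 * (n * j) := by push_cast; ring
      have h3 : v'.1 + v.1 = 4 * (n * j) - 1 := by rw [hj, e]; ring
      have h4 : v.1 = u.1 + 1 ∨ v.1 = u.1 - 1 := by
        rcases hv with h | h
        · exact Or.inl h.1
        · right; omega
      have h5 : v'.1 = u.1 + 1 ∨ v'.1 = u.1 - 1 := by
        rcases hv' with h | h
        · exact Or.inl h.1
        · right; omega
      omega

end Families

/-! ### The hamburger graphs have a `K₃,₃` minor -/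

section Minor

variable {α β : Type*}

lemma AdjIn.mono {G : Graph α β} {U U' : Set α} (h : U ⊆ U') {u v : α} (huv : AdjIn G U u v) :
    AdjIn G U' u v :=
  ⟨h huv.1, h huv.2.1, huv.2.2⟩

lemma reflTransGen_adjIn_mono {G : Graph α β} {U U' : Set α} (h : U ⊆ U') {u v : α}
    (huv : Relation.ReflTransGen (AdjIn G U) u v) : Relation.ReflTransGen (AdjIn G U') u v :=
  Relation.ReflTransGen.mono (fun _ _ => AdjIn.mono h) _ _ huv

lemma reflTransGen_adjIn_symm {G : Graph α β} {U : Set α} {u v : α}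
    (h : Relation.ReflTransGen (AdjIn G U) u v) : Relation.ReflTransGen (AdjIn G U) v u := by
  induction h with
  | refl => exact Relation.ReflTransGen.refl
  | tail _ hbc ih => exact Relation.ReflTransGen.head ⟨hbc.2.1, hbc.1, hbc.2.2.symm⟩ ih

/-- A planar graph has no `K₃,₃` minor. The branch sets are `S 0, S 1, S 2` on one side and
`S 3, S 4, S 5` on the other side, and they are connected. -/
theorem IsPlanar.not_k33_minor {G : Graph α β} (hG : IsPlanar G) (S : ℕ → Set α) (r : ℕ → α)
    (hr : ∀ x < 6, r x ∈ S x ∩ V(G))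
    (hS : ∀ x < 6, ∀ y ∈ S x, Relation.ReflTransGen (AdjIn G (S x)) y (r x))
    (hD : ∀ x y, x ≠ y → Disjoint (S x) (S y))
    (hE : ∀ i < 3, ∀ j < 3, ∃ u ∈ S i, ∃ v ∈ S (3 + j), G.Adj u v) : False := by
  refine hG.not_k33 (fun i : Fin 3 => r i) (fun j : Fin 3 => r (3 + j))
    (fun i j => S i ∪ S (3 + j)) (fun i => (hr i (by omega)).2)
    (fun i j => Or.inl (hr i (by omega)).1) ?_ ?_
  · intro i j
    obtain ⟨u, hu, v, hv, huv⟩ := hE i (by omega) j (by omega)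
    have h1 := reflTransGen_adjIn_symm (hS i (by omega) u hu)
    have h2 := hS (3 + j) (by omega) v hv
    exact (reflTransGen_adjIn_mono Set.subset_union_left h1).trans
      (Relation.ReflTransGen.head ⟨Or.inl hu, Or.inr hv, huv⟩
        (reflTransGen_adjIn_mono Set.subset_union_right h2))
  · intro i j k l hik hjl
    have hik' : (i : ℕ) ≠ k := fun h => hik (Fin.ext h)
    have hjl' : (j : ℕ) ≠ l := fun h => hjl (Fin.ext h)
    rw [Set.disjoint_union_left, Set.disjoint_union_right, Set.disjoint_union_right]
    exact ⟨⟨hD _ _ hik', hD _ _ (by omega)⟩, hD _ _ (by omega), hD _ _ (by omega)⟩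

end Minor

/-! ### Explicit branch sets in the hamburger graphs -/

section Hamburgers

variable {W : SimpleGraph (ℤ × Bool)} {Γ : Subgroup (W ≃g W)}

/-- The branch set with label `x`. -/
def branch (Γ : Subgroup (W ≃g W)) (P : ℤ) (c : ℤ × Bool → ℕ) (x : ℕ) :
    Set (MulAction.orbitRel.Quotient Γ (ℤ × Bool)) :=
  {y | ∃ u : ℤ × Bool, 0 ≤ u.1 ∧ u.1 < P ∧ c u = x ∧ y = mkV Γ u}

lemma mkV_mem_branch {P : ℤ} {c : ℤ × Bool → ℕ} {x : ℕ} {k : ℤ} {i : Bool} (h0 : 0 ≤ k)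
    (hP : k < P) (hc : c (k, i) = x) : mkV Γ (k, i) ∈ branch Γ P c x :=
  ⟨(k, i), h0, hP, hc, rfl⟩

lemma IsShift.disjoint_branch {P : ℤ} (hP : 0 < P) (hΓ : IsShift Γ P) (c : ℤ × Bool → ℕ)
    (x y : ℕ) (hxy : x ≠ y) : Disjoint (branch Γ P c x) (branch Γ P c y) := by
  rw [Set.disjoint_left]
  rintro _ ⟨u, hu0, huP, rfl, rfl⟩ ⟨v, hv0, hvP, rfl, h⟩
  exact hxy (congrArg c ((hΓ.isFundamental hP 0).inj u (mem_block.2 ⟨hu0, by omega⟩) v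
    (mem_block.2 ⟨hv0, by omega⟩) h))

lemma IsShift.mkV_wrap {P : ℤ} (hΓ : IsShift Γ P) (i : Bool) :
    mkV Γ (P, i) = mkV Γ (0, i) :=
  (hΓ.mkV_eq_iff.2 ⟨1, by simp⟩).symm

lemma step_branch {P : ℤ} {c : ℤ × Bool → ℕ} {x : ℕ} {u v : ℤ × Bool}
    (h : W.Adj u v) (hu : mkV Γ u ∈ branch Γ P c x) (hv : mkV Γ v ∈ branch Γ P c x) :
    Relation.ReflTransGen (AdjIn (quotientGraph W Γ) (branch Γ P c x)) (mkV Γ u) (mkV Γ v) :=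
  Relation.ReflTransGen.single ⟨hu, hv, adj_mkV h⟩

/-- The tail of a row can be followed to the vertex in column `P`, which is the one in column
`0`. -/
lemma IsShift.tail_branch {P q : ℤ} (hP : 0 < P) (hq : 0 ≤ q) (hW : IsStrip W) (hΓ : IsShift Γ P)
    {c : ℤ × Bool → ℕ} {x : ℕ} {i : Bool} (h0 : c (0, i) = x)
    (htail : ∀ k, q ≤ k → k < P → c (k, i) = x) {k : ℤ} (hk : q ≤ k) (hkP : k < P) :
    Relation.ReflTransGen (AdjIn (quotientGraph W Γ) (branch Γ P c x))
      (mkV Γ (k, i)) (mkV Γ (0, i)) := by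
  have mem : ∀ l, q ≤ l → l ≤ P → mkV Γ (l, i) ∈ branch Γ P c x := by
    intro l hl hlP
    rcases hlP.lt_or_eq with h | rfl
    · exact mkV_mem_branch (by omega) h (htail l hl h)
    · rw [hΓ.mkV_wrap]
      exact mkV_mem_branch le_rfl hP h0
  have key : ∀ m : ℕ, ∀ l, q ≤ l → l + m = P →
      Relation.ReflTransGen (AdjIn (quotientGraph W Γ) (branch Γ P c x))
        (mkV Γ (l, i)) (mkV Γ (0, i)) := by
    intro m
    induction m with
    | zero =>
      intro l _ hl
      rw [show l = P by omega, hΓ.mkV_wrap]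
    | succ m ih =>
      intro l hql hl
      exact (step_branch (hW.row l i) (mem l hql (by omega)) (mem (l + 1) (by omega) (by omega))).trans
        (ih (l + 1) (by omega) (by push_cast at hl; omega))
  exact key (P - k).toNat k hk (by omega)

/-- Branch sets of a `K₃,₃` minor of `W_b(n)`. -/
def labelB (u : ℤ × Bool) : ℕ :=
  if u.1 ≤ 1 then 0 else if u.1 = 2 then bif u.2 then 4 else 3 else
    if u.1 = 3 then bif u.2 then 2 else 1 else if u.1 = 4 then bif u.2 then 2 else 5 else
    if u.1 = 5 then bif u.2 then 2 else 0 else bif u.2 then 6 else 0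

/-- Branch sets of a `K₃,₃` minor of `W_a(n)`. -/
def labelA (u : ℤ × Bool) : ℕ :=
  if u.1 ≤ 2 then 0 else if u.1 = 3 then bif u.2 then 4 else 3 else
    if u.1 = 4 then bif u.2 then 2 else 1 else if u.1 = 5 then bif u.2 then 2 else 5 else
    bif u.2 then 6 else 0

/-- The hourglass on columns 2 and 3 supplies a K₂,₂ with sides {1, 2} and {3, 4}. Branch set 0
reaches 3 and 4 from the left and returns around the cycle along the row `false`, so that it meets
set 5, the vertex (4, false); this vertex is also adjacent to sets 1 and 2. Label 6 is discarded.
Columns 0 to 5 must be distinct, whence n ≥ 3. -/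
lemma not_isPlanar_hamburgerB {n : ℕ} (hn : 3 ≤ n) : ¬ IsPlanar (hamburgerB n) := by
  intro hG
  have hΓ := isShift_hamburgerB n
  set Γ := Subgroup.zpowers (transB n)
  set P : ℤ := ((2 * n : ℕ) : ℤ) with hPdef
  have hP : 6 ≤ P := by omega
  have m : ∀ k i x, 0 ≤ k → k < P → labelB (k, i) = x → mkV Γ (k, i) ∈ branch Γ P labelB x :=
    fun k i x h0 h1 h2 => mkV_mem_branch h0 h1 h2
  have cell : ∀ k i j, k % 2 = 0 → WbarB.Adj (k, i) (k + 1, j) := fun k i j h =>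
    Or.inl ⟨rfl, Or.inl h⟩
  have row : ∀ k i, WbarB.Adj (k, i) (k + 1, i) := isStrip_WbarB.row
  refine hG.not_k33_minor (branch Γ P labelB) (fun x => mkV Γ (match x with
    | 0 => (0, false)
    | 1 => (3, false)
    | 2 => (4, true)
    | 3 => (2, false)
    | 4 => (2, true)
    | _ => (4, false))) ?_ ?_ (hΓ.disjoint_branch (by omega) labelB) ?_
  · intro x hx
    refine ⟨?_, Set.mem_univ _⟩
    interval_cases x <;> exact m _ _ _ (by omega) (by omega) rfl
  · rintro x hx _ ⟨⟨k, i⟩, hk0, hkP, hc, rfl⟩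
    simp only at hk0 hkP
    rcases le_or_gt k 5 with hk | hk
    · interval_cases k <;> cases i <;> simp [labelB] at hc <;> subst hc
      · rfl
      · exact (step_branch (cell 0 true true rfl) (m _ _ _ (by omega) (by omega) rfl)
          (m _ _ _ (by omega) (by omega) rfl)).trans
          (step_branch (cell 0 false true rfl).symm (m _ _ _ (by omega) (by omega) rfl)
          (m _ _ _ (by omega) (by omega) rfl))
      · exact step_branch (cell 0 false false rfl).symm (m _ _ _ (by omega) (by omega) rfl)
          (m _ _ _ (by omega) (by omega) rfl)
      · exact step_branch (cell 0 false true rfl).symm (m _ _ _ (by omega) (by omega) rfl)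
          (m _ _ _ (by omega) (by omega) rfl)
      · rfl
      · rfl
      · rfl
      · exact step_branch (row 3 true) (m _ _ _ (by omega) (by omega) rfl)
          (m _ _ _ (by omega) (by omega) rfl)
      · rfl
      · rfl
      · exact hΓ.tail_branch (q := 5) (by omega) (by omega) isStrip_WbarB rfl
          (fun k hk _ => by
            simp only [labelB]
            rw [if_neg (by omega), if_neg (by omega), if_neg (by omega), if_neg (by omega)]
            simp) le_rfl hkP
      · exact step_branch (row 4 true).symm (m _ _ _ (by omega) (by omega) rfl)
          (m _ _ _ (by omega) (by omega) rfl)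
    · simp only [labelB] at hc
      rw [if_neg (by omega), if_neg (by omega), if_neg (by omega), if_neg (by omega),
        if_neg (by omega)] at hc
      cases i
      · simp only [cond_false] at hc
        subst hc
        exact hΓ.tail_branch (q := 5) (by omega) (by omega) isStrip_WbarB rfl
          (fun k hk _ => by
            simp only [labelB]
            rw [if_neg (by omega), if_neg (by omega), if_neg (by omega), if_neg (by omega)]
            simp) (by omega) hkP
      · simp only [cond_true] at hc
        omega
  · intro i hi j hj
    have e : ∀ k i l j x y, 0 ≤ k → k < P → 0 ≤ l → l < P → labelB (k, i) = x →
        labelB (l, j) = y → WbarB.Adj (k, i) (l, j) →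
        ∃ u ∈ branch Γ P labelB x, ∃ v ∈ branch Γ P labelB y, (hamburgerB n).Adj u v :=
      fun k i l j x y h1 h2 h3 h4 h5 h6 h7 =>
        ⟨_, m k i x h1 h2 h5, _, m l j y h3 h4 h6, adj_mkV h7⟩
    interval_cases i <;> interval_cases j
    · exact e 1 false 2 false _ _ (by omega) (by omega) (by omega) (by omega) rfl rfl (row 1 false)
    · exact e 1 true 2 true _ _ (by omega) (by omega) (by omega) (by omega) rfl rfl (row 1 true)
    · exact e 5 false 4 false _ _ (by omega) (by omega) (by omega) (by omega) rfl rfl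
        (row 4 false).symm
    · exact e 3 false 2 false _ _ (by omega) (by omega) (by omega) (by omega) rfl rfl
        (cell 2 _ _ rfl).symm
    · exact e 3 false 2 true _ _ (by omega) (by omega) (by omega) (by omega) rfl rfl
        (cell 2 _ _ rfl).symm
    · exact e 3 false 4 false _ _ (by omega) (by omega) (by omega) (by omega) rfl rfl (row 3 false)
    · exact e 3 true 2 false _ _ (by omega) (by omega) (by omega) (by omega) rfl rfl
        (cell 2 _ _ rfl).symm
    · exact e 3 true 2 true _ _ (by omega) (by omega) (by omega) (by omega) rfl rfl
        (cell 2 _ _ rfl).symm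
    · exact e 5 true 4 false _ _ (by omega) (by omega) (by omega) (by omega) rfl rfl
        (cell 4 _ _ rfl).symm

/-- As for `hamburgerB`, with the hourglass on columns 3 and 4; here the vertical bar in column 5
joins branch sets 2 and 5, so two unit cells suffice. -/
lemma not_isPlanar_hamburgerA {n : ℕ} (hn : 2 ≤ n) : ¬ IsPlanar (hamburgerA n) := by
  intro hG
  have hΓ := isShift_hamburgerA n
  set Γ := Subgroup.zpowers (transA n)
  set P : ℤ := ((3 * n : ℕ) : ℤ) with hPdef
  have hP : 6 ≤ P := by omega
  have m : ∀ k i x, 0 ≤ k → k < P → labelA (k, i) = x → mkV Γ (k, i) ∈ branch Γ P labelA x :=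
    fun k i x h0 h1 h2 => mkV_mem_branch h0 h1 h2
  have cell : ∀ k i j, k % 3 = 0 → WbarA.Adj (k, i) (k + 1, j) := fun k i j h =>
    Or.inl ⟨rfl, Or.inl h⟩
  have row : ∀ k i, WbarA.Adj (k, i) (k + 1, i) := isStrip_WbarA.row
  have bar : WbarA.Adj (5, true) (5, false) := Or.inr (Or.inr ⟨rfl, rfl, by simp⟩)
  refine hG.not_k33_minor (branch Γ P labelA) (fun x => mkV Γ (match x with
    | 0 => (0, false)
    | 1 => (4, false)
    | 2 => (4, true)
    | 3 => (3, false)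
    | 4 => (3, true)
    | _ => (5, false))) ?_ ?_ (hΓ.disjoint_branch (by omega) labelA) ?_
  · intro x hx
    refine ⟨?_, Set.mem_univ _⟩
    interval_cases x <;> exact m _ _ _ (by omega) (by omega) rfl
  · rintro x hx _ ⟨⟨k, i⟩, hk0, hkP, hc, rfl⟩
    simp only at hk0 hkP
    have s1 : ∀ i, Relation.ReflTransGen (AdjIn (quotientGraph WbarA Γ) (branch Γ P labelA 0))
        (mkV Γ (1, i)) (mkV Γ (0, false)) := fun i =>
      step_branch (cell 0 false i rfl).symm (m _ _ _ (by omega) (by omega) rfl)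
        (m _ _ _ (by omega) (by omega) rfl)
    rcases le_or_gt k 5 with hk | hk
    · interval_cases k <;> cases i <;> simp [labelA] at hc <;> subst hc
      · rfl
      · exact (step_branch (cell 0 true true rfl) (m _ _ _ (by omega) (by omega) rfl)
          (m _ _ _ (by omega) (by omega) rfl)).trans (s1 true)
      · exact s1 false
      · exact s1 true
      · exact (step_branch (row 1 false).symm (m _ _ _ (by omega) (by omega) rfl)
          (m _ _ _ (by omega) (by omega) rfl)).trans (s1 false)
      · exact (step_branch (row 1 true).symm (m _ _ _ (by omega) (by omega) rfl)
          (m _ _ _ (by omega) (by omega) rfl)).trans (s1 true)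
      · rfl
      · rfl
      · rfl
      · rfl
      · rfl
      · exact step_branch (row 4 true).symm (m _ _ _ (by omega) (by omega) rfl)
          (m _ _ _ (by omega) (by omega) rfl)
    · simp only [labelA] at hc
      rw [if_neg (by omega), if_neg (by omega), if_neg (by omega), if_neg (by omega)] at hc
      cases i
      · simp only [cond_false] at hc
        subst hc
        exact hΓ.tail_branch (q := 6) (by omega) (by omega) isStrip_WbarA rfl
          (fun k hk _ => by
            simp only [labelA]
            rw [if_neg (by omega), if_neg (by omega), if_neg (by omega), if_neg (by omega)]
            simp) (by omega) hkP
      · simp only [cond_true] at hc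
        omega
  · intro i hi j hj
    have e : ∀ k i l j x y, 0 ≤ k → k < P → 0 ≤ l → l < P → labelA (k, i) = x →
        labelA (l, j) = y → WbarA.Adj (k, i) (l, j) →
        ∃ u ∈ branch Γ P labelA x, ∃ v ∈ branch Γ P labelA y, (hamburgerA n).Adj u v :=
      fun k i l j x y h1 h2 h3 h4 h5 h6 h7 =>
        ⟨_, m k i x h1 h2 h5, _, m l j y h3 h4 h6, adj_mkV h7⟩
    interval_cases i <;> interval_cases j
    · exact e 2 false 3 false _ _ (by omega) (by omega) (by omega) (by omega) rfl rfl (row 2 false)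
    · exact e 2 true 3 true _ _ (by omega) (by omega) (by omega) (by omega) rfl rfl (row 2 true)
    -- For n = 2, column 6 is column 0 in the quotient, which also belongs to branch set 0.
    · refine ⟨mkV Γ (6, false), ?_, mkV Γ (5, false), m _ _ _ (by omega) (by omega) rfl,
        adj_mkV (row 5 false).symm⟩
      rcases hP.lt_or_eq with h | h
      · exact m _ _ _ (by omega) h rfl
      · rw [h, hΓ.mkV_wrap]
        exact m _ _ _ (by omega) (by omega) rfl
    · exact e 4 false 3 false _ _ (by omega) (by omega) (by omega) (by omega) rfl rfl
        (cell 3 _ _ rfl).symm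
    · exact e 4 false 3 true _ _ (by omega) (by omega) (by omega) (by omega) rfl rfl
        (cell 3 _ _ rfl).symm
    · exact e 4 false 5 false _ _ (by omega) (by omega) (by omega) (by omega) rfl rfl (row 4 false)
    · exact e 4 true 3 false _ _ (by omega) (by omega) (by omega) (by omega) rfl rfl
        (cell 3 _ _ rfl).symm
    · exact e 4 true 3 true _ _ (by omega) (by omega) (by omega) (by omega) rfl rfl
        (cell 3 _ _ rfl).symm
    · exact e 5 true 5 false _ _ (by omega) (by omega) (by omega) (by omega) rfl rfl bar

end Hamburgers

/-! ### Annular drawings -/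

section Drawing

/-- The `ℓ¹` norm on the plane. -/
noncomputable def norm₁ (z : ℂ) : ℝ := |z.re| + |z.im|

/-- The point with coordinates `x, y` in the frame rotated by `m` quarter turns. -/
noncomputable def rotated (m : ℤ) (x y : ℝ) : ℂ := Complex.I ^ m * (x + y * Complex.I)

lemma norm₁_I_mul (z : ℂ) : norm₁ (Complex.I * z) = norm₁ z := by
  simp [norm₁, add_comm]

lemma norm₁_I_zpow_mul (m : ℤ) (z : ℂ) : norm₁ (Complex.I ^ m * z) = norm₁ z := by
  induction m using Int.induction_on generalizing z with
  | zero => simp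
  | succ k ih => rw [zpow_add_one₀ Complex.I_ne_zero, mul_assoc, ih, norm₁_I_mul]
  | pred k ih =>
    rw [← ih z, ← sub_add_cancel (-(k : ℤ)) 1, zpow_add_one₀ Complex.I_ne_zero,
      add_sub_cancel_right, mul_comm _ Complex.I, mul_assoc, norm₁_I_mul]

lemma norm₁_rotated (m : ℤ) (x y : ℝ) : norm₁ (rotated m x y) = |x| + |y| := by
  rw [rotated, norm₁_I_zpow_mul]
  simp [norm₁]

lemma rotated_inj {m : ℤ} {x y x' y' : ℝ} (h : rotated m x y = rotated m x' y') :
    x = x' ∧ y = y' := by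
  have := mul_left_cancel₀ (zpow_ne_zero m Complex.I_ne_zero) h
  have h1 := congrArg Complex.re this
  have h2 := congrArg Complex.im this
  simp at h1 h2
  exact ⟨h1, h2⟩

lemma rotated_add_one (m : ℤ) (x : ℝ) : rotated (m + 1) x 0 = rotated m 0 x := by
  rw [rotated, rotated, zpow_add_one₀ Complex.I_ne_zero]
  simp
  ring

/-- The sign attached to a row. -/
def sgn : Bool → ℝ
  | false => 1
  | true => -1

lemma abs_sgn (i : Bool) : |sgn i| = 1 := by
  cases i <;> simp [sgn]

lemma sgn_mul_inj {i j : Bool} {a b : ℝ} (ha : 0 < a) (hb : 0 < b) (h : a * sgn i = b * sgn j) :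
    i = j := by
  cases i <;> cases j <;> simp [sgn] at h ⊢ <;> linarith

/-- The arcs of an annular drawing with vertices `(k, i)`: an arc from column `k` to column
`k + 1`, an arc joining the two vertices of a column, and a loop at a vertex of the innermost
(`out = false`) or outermost (`out = true`) column. -/
inductive Arc
  | step (k : ℤ) (i j : Bool)
  | level (k : ℤ)
  | petal (out : Bool) (i : Bool)

/-- The position of a vertex: column `k` lies at distance `k + 2` from the origin, its two vertices
are opposite, and it is rotated by `e k` quarter turns. -/
noncomputable def pos (e : ℤ → ℤ) (u : ℤ × Bool) : ℂ := rotated (e u.1) ((u.1 + 2) * sgn u.2) 0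

namespace Arc

/-- The initial vertex of an arc. -/
def src (lo hi : ℤ) : Arc → ℤ × Bool
  | step k i _ => (k, i)
  | level k => (k, false)
  | petal out i => (bif out then hi else lo, i)

/-- The final vertex of an arc. -/
def dst (lo hi : ℤ) : Arc → ℤ × Bool
  | step k _ j => (k + 1, j)
  | level k => (k, true)
  | petal out i => (bif out then hi else lo, i)

/-- The arcs that occur in a drawing with columns `lo, …, hi`. -/
def Valid (e : ℤ → ℤ) (lo hi : ℤ) : Arc → Prop
  | step k i j => lo ≤ k ∧ k < hi ∧ (e (k + 1) = e k ∧ i = j ∨ e (k + 1) = e k + 1)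
  | level k => lo ≤ k ∧ k ≤ hi
  | petal _ _ => True

/-- The first coordinate of an arc in the frame of its initial vertex. -/
noncomputable def xc (e : ℤ → ℤ) (lo hi : ℤ) : Arc → ℝ → ℝ
  | step k i _, t => if e (k + 1) = e k then (k + 2 + t) * sgn i else (k + 2 + t) * (1 - t) * sgn i
  | level k, t => (k + 2) * (1 - 2 * t)
  | petal out i, t => (((bif out then hi else lo : ℤ) : ℝ) + 2) *
      (1 + (bif out then 1 else -1) * (t * (1 - t))) * sgn i

/-- The second coordinate of an arc in the frame of its initial vertex. -/
noncomputable def yc (e : ℤ → ℤ) (lo hi : ℤ) : Arc → ℝ → ℝ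
  | step k _ j, t => if e (k + 1) = e k then 0 else (k + 2 + t) * t * sgn j
  | level k, t => (k + 2) * (1 - |1 - 2 * t|)
  | petal out i, t => (((bif out then hi else lo : ℤ) : ℝ) + 2) * (t * (1 - t) * (1 - 2 * t) / 2) * sgn i

/-- The curve of an arc. -/
noncomputable def curve (e : ℤ → ℤ) (lo hi : ℤ) (a : Arc) (t : ℝ) : ℂ :=
  rotated (e (a.src lo hi).1) (a.xc e lo hi t) (a.yc e lo hi t)

variable {e : ℤ → ℤ} {lo hi : ℤ}

lemma continuous_curve (a : Arc) : Continuous (a.curve e lo hi) := by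
  have hx : Continuous fun t => a.xc e lo hi t := by
    cases a with
    | step k i j => simp only [xc]; split_ifs <;> fun_prop
    | level k => simp only [xc]; fun_prop
    | petal out i => simp only [xc]; fun_prop
  have hy : Continuous fun t => a.yc e lo hi t := by
    cases a with
    | step k i j => simp only [yc]; split_ifs <;> fun_prop
    | level k => simp only [yc]; fun_prop
    | petal out i => simp only [yc]; fun_prop
  unfold curve rotated
  fun_prop

lemma curve_zero (a : Arc) : a.curve e lo hi 0 = pos e (a.src lo hi) := by
  cases a with
  | step k i j => by_cases h : e (k + 1) = e k <;> simp [curve, pos, xc, yc, src, h]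
  | level k => simp [curve, pos, xc, yc, src, sgn]
  | petal out i => cases out <;> simp [curve, pos, xc, yc, src]

lemma curve_one {a : Arc} (ha : a.Valid e lo hi) :
    a.curve e lo hi 1 = pos e (a.dst lo hi) := by
  cases a with
  | step k i j =>
    have h1 : (k : ℝ) + 2 + 1 = ((k + 1 : ℤ) : ℝ) + 2 := by push_cast; ring
    rcases ha.2.2 with ⟨h, rfl⟩ | h
    · simp only [curve, pos, xc, yc, src, dst, h, if_true, h1]
    · have h' : e (k + 1) ≠ e k := by omega
      simp only [curve, pos, xc, yc, src, dst]
      -- After a quarter turn, the second axis of the old frame is the first axis of the new one.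
      rw [if_neg h', if_neg h', h, rotated_add_one, h1]
      congr 1 <;> ring
  | level k =>
    simp only [curve, pos, xc, yc, src, dst, sgn]
    congr 1 <;> norm_num
  | petal out i => cases out <;> simp [curve, pos, xc, yc, src, dst]

/-! ### Separation of arcs by the ℓ¹ radius -/

lemma norm₁_curve (a : Arc) (t : ℝ) :
    norm₁ (a.curve e lo hi t) = |a.xc e lo hi t| + |a.yc e lo hi t| :=
  norm₁_rotated _ _ _

/-- In both cases the absolute coordinates add up to the factor k + 2 + t. The radius thus recovers
both the column and the parameter, and arcs between different pairs of columns lie in disjoint open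
annuli. The bound on `lo` keeps all radii positive. -/
lemma norm₁_step (hlo : -1 ≤ lo) {k : ℤ} (hk : lo ≤ k) (i j : Bool) {t : ℝ}
    (ht : t ∈ Set.Ioo (0 : ℝ) 1) : norm₁ ((step k i j).curve e lo hi t) = k + 2 + t := by
  obtain ⟨h0, h1⟩ := ht
  have hk' : (-1 : ℝ) ≤ k := by exact_mod_cast hlo.trans hk
  have hr : |(k : ℝ) + 2 + t| = k + 2 + t := abs_of_pos (by linarith)
  rw [norm₁_curve]
  simp only [xc, yc]
  split_ifs
  · rw [abs_mul, abs_sgn, hr, abs_zero]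
    ring
  · rw [abs_mul, abs_mul, abs_mul, abs_mul, abs_sgn, abs_sgn, hr, abs_of_pos h0,
      abs_of_pos (sub_pos.2 h1)]
    ring

lemma norm₁_level (hlo : -1 ≤ lo) {k : ℤ} (hk : lo ≤ k) {t : ℝ} (ht : t ∈ Set.Ioo (0 : ℝ) 1) :
    norm₁ ((level k).curve e lo hi t) = k + 2 := by
  obtain ⟨h0, h1⟩ := ht
  have hk' : (-1 : ℝ) ≤ k := by exact_mod_cast hlo.trans hk
  have hr : |(k : ℝ) + 2| = k + 2 := abs_of_pos (by linarith)
  have h2 : |1 - 2 * t| ≤ 1 := abs_le.2 ⟨by linarith, by linarith⟩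
  rw [norm₁_curve]
  simp only [xc, yc]
  rw [abs_mul, abs_mul, hr, abs_of_nonneg (sub_nonneg.2 h2)]
  ring

/-- With τ = t(1 - t), the first coordinate loses rτ while the second gains at most rτ/2. -/
lemma norm₁_petal_inner (hlo : -1 ≤ lo) (i : Bool) {t : ℝ} (ht : t ∈ Set.Ioo (0 : ℝ) 1) :
    norm₁ ((petal false i).curve e lo hi t) < lo + 2 := by
  obtain ⟨h0, h1⟩ := ht
  have hk' : (-1 : ℝ) ≤ lo := by exact_mod_cast hlo
  have hr : |(lo : ℝ) + 2| = lo + 2 := abs_of_pos (by linarith)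
  have hτ : 0 < t * (1 - t) := mul_pos h0 (by linarith)
  have hτ' : t * (1 - t) < 1 := by nlinarith
  have h2 : |1 - 2 * t| ≤ 1 := abs_le.2 ⟨by linarith, by linarith⟩
  rw [norm₁_curve]
  simp only [xc, yc, cond_false]
  rw [abs_mul, abs_mul, abs_mul, abs_mul, abs_sgn, hr, abs_of_pos (by linarith : 0 < 1 + -1 * (t * (1 - t))),
    abs_div, abs_mul (t * (1 - t)), abs_of_pos hτ, abs_two]
  have h3 : t * (1 - t) * |1 - 2 * t| ≤ t * (1 - t) := by nlinarith
  nlinarith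

lemma norm₁_petal_outer (hlo : -1 ≤ lo) (hhi : lo ≤ hi) (i : Bool) {t : ℝ}
    (ht : t ∈ Set.Ioo (0 : ℝ) 1) : hi + 2 < norm₁ ((petal true i).curve e lo hi t) := by
  obtain ⟨h0, h1⟩ := ht
  have hk' : (-1 : ℝ) ≤ hi := by exact_mod_cast hlo.trans hhi
  have hr : |(hi : ℝ) + 2| = hi + 2 := abs_of_pos (by linarith)
  have hτ : 0 < t * (1 - t) := mul_pos h0 (by linarith)
  rw [norm₁_curve]
  refine lt_of_lt_of_le ?_ (le_add_of_nonneg_right (abs_nonneg _))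
  simp only [xc, cond_true]
  rw [abs_mul, abs_mul, abs_sgn, hr, abs_of_pos (by linarith : 0 < 1 + 1 * (t * (1 - t)))]
  nlinarith

lemma norm₁_pos (hlo : -1 ≤ lo) {u : ℤ × Bool} (hu : lo ≤ u.1) : norm₁ (pos e u) = u.1 + 2 := by
  have hk' : (-1 : ℝ) ≤ u.1 := by exact_mod_cast hlo.trans hu
  rw [pos, norm₁_rotated, abs_mul, abs_sgn, abs_of_pos (by linarith), abs_zero]
  ring

lemma pos_inj (hlo : -1 ≤ lo) {u v : ℤ × Bool} (hu : lo ≤ u.1) (hv : lo ≤ v.1)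
    (h : pos e u = pos e v) : u = v := by
  have hk' : (-1 : ℝ) ≤ u.1 := by exact_mod_cast hlo.trans hu
  have hn := congrArg norm₁ h
  rw [norm₁_pos hlo hu, norm₁_pos hlo hv] at hn
  have huv : u.1 = v.1 := by exact_mod_cast (add_right_cancel hn)
  rw [pos, pos, huv] at h
  rw [huv] at hk'
  exact Prod.ext huv (sgn_mul_inj (by linarith) (by linarith) (rotated_inj h).1)

lemma int_add_eq {k l : ℤ} {s t : ℝ} (hs : s ∈ Set.Ioo (0 : ℝ) 1) (ht : t ∈ Set.Ioo (0 : ℝ) 1)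
    (h : (k : ℝ) + s = l + t) : k = l := by
  have h1 : (k : ℝ) < l + 1 := by linarith [hs.1, ht.2]
  have h2 : (l : ℝ) < k + 1 := by linarith [hs.2, ht.1]
  have h1' : k < l + 1 := by exact_mod_cast h1
  have h2' : l < k + 1 := by exact_mod_cast h2
  omega

lemma int_add_ne {k l : ℤ} {s : ℝ} (hs : s ∈ Set.Ioo (0 : ℝ) 1) : (k : ℝ) + s ≠ l := by
  intro h
  have h1 : (k : ℝ) < l := by linarith [hs.1]
  have h2 : (l : ℝ) < k + 1 := by linarith [hs.2]
  have h1' : k < l := by exact_mod_cast h1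
  have h2' : l < k + 1 := by exact_mod_cast h2
  omega

lemma curve_ne_pos (hlo : -1 ≤ lo) (hhi : lo ≤ hi) {a : Arc} (ha : a.Valid e lo hi) {t : ℝ}
    (ht : t ∈ Set.Ioo (0 : ℝ) 1) {u : ℤ × Bool} (hu : lo ≤ u.1) (hu' : u.1 ≤ hi) :
    a.curve e lo hi t ≠ pos e u := by
  intro h
  have hn := congrArg norm₁ h
  rw [norm₁_pos hlo hu] at hn
  cases a with
  | step k i j =>
    rw [norm₁_step hlo ha.1 i j ht] at hn
    exact int_add_ne (k := k) (l := u.1) ht (by linarith)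
  | level k =>
    rw [norm₁_level hlo ha.1 ht] at hn
    have hk : k = u.1 := by exact_mod_cast add_right_cancel hn
    have hk' : (-1 : ℝ) ≤ k := by exact_mod_cast hlo.trans ha.1
    rw [curve, pos, src, ← hk] at h
    have hy := (rotated_inj h).2
    simp only [yc] at hy
    have h2 : |1 - 2 * t| < 1 := abs_lt.2 ⟨by linarith [ht.2], by linarith [ht.1]⟩
    have : 0 < ((k : ℝ) + 2) * (1 - |1 - 2 * t|) := mul_pos (by linarith) (by linarith)
    linarith
  | petal out i =>
    cases out with
    | false =>
      have h1 := norm₁_petal_inner (e := e) (hi := hi) hlo i ht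
      have : (lo : ℝ) ≤ u.1 := by exact_mod_cast hu
      linarith
    | true =>
      have h1 := norm₁_petal_outer (e := e) hlo hhi i ht
      have : (u.1 : ℝ) ≤ hi := by exact_mod_cast hu'
      linarith

/-- Equal radii give the same column and parameter. Then the signs of the coordinates give the rows:
both signs at a quarter turn, and the sign of the first coordinate alone on a radial arc, where
validity makes the two rows agree. -/
lemma step_inj (hlo : -1 ≤ lo) {k l : ℤ} {i j i' j' : Bool} (ha : (step k i j).Valid e lo hi)
    (hb : (step l i' j').Valid e lo hi) {s t : ℝ} (hs : s ∈ Set.Ioo (0 : ℝ) 1)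
    (ht : t ∈ Set.Ioo (0 : ℝ) 1)
    (h : (step k i j).curve e lo hi s = (step l i' j').curve e lo hi t) :
    step k i j = step l i' j' ∧ s = t := by
  have hn := congrArg norm₁ h
  rw [norm₁_step hlo ha.1 i j hs, norm₁_step hlo hb.1 i' j' ht] at hn
  obtain rfl : k = l := int_add_eq hs ht (by linarith)
  obtain rfl : s = t := by linarith
  have hk' : (-1 : ℝ) ≤ k := by exact_mod_cast hlo.trans ha.1
  have hr : 0 < (k : ℝ) + 2 + s := by linarith [hs.1]
  obtain ⟨hx, hy⟩ := rotated_inj h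
  simp only [xc, yc] at hx hy
  by_cases he : e (k + 1) = e k
  · rw [if_pos he, if_pos he] at hx
    obtain rfl := sgn_mul_inj hr hr hx
    obtain rfl : i = j := by
      rcases ha.2.2 with h' | h'
      · exact h'.2
      · omega
    obtain rfl : i = j' := by
      rcases hb.2.2 with h' | h'
      · exact h'.2
      · omega
    exact ⟨rfl, rfl⟩
  · rw [if_neg he, if_neg he] at hx hy
    have h1 : 0 < ((k : ℝ) + 2 + s) * (1 - s) := mul_pos hr (by linarith [hs.2])
    have h2 : 0 < ((k : ℝ) + 2 + s) * s := mul_pos hr hs.1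
    obtain rfl := sgn_mul_inj h1 h1 hx
    obtain rfl := sgn_mul_inj h2 h2 hy
    exact ⟨rfl, rfl⟩

lemma level_inj (hlo : -1 ≤ lo) {k l : ℤ} (ha : (level k).Valid e lo hi)
    (hb : (level l).Valid e lo hi) {s t : ℝ} (hs : s ∈ Set.Ioo (0 : ℝ) 1)
    (ht : t ∈ Set.Ioo (0 : ℝ) 1) (h : (level k).curve e lo hi s = (level l).curve e lo hi t) :
    level k = level l ∧ s = t := by
  have hn := congrArg norm₁ h
  rw [norm₁_level hlo ha.1 hs, norm₁_level hlo hb.1 ht] at hn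
  obtain rfl : k = l := by exact_mod_cast add_right_cancel hn
  have hk' : (-1 : ℝ) ≤ k := by exact_mod_cast hlo.trans ha.1
  have hx := (rotated_inj h).1
  simp only [xc] at hx
  have := mul_left_cancel₀ (by linarith : ((k : ℝ) + 2) ≠ 0) hx
  exact ⟨rfl, by linarith⟩

/-- The radius distinguishes inner from outer petals, and the sign of the first coordinate gives the
row. The first coordinate determines t(1 - t), that is, t up to reflection; the factor 1 - 2t of the
second coordinate removes the ambiguity. -/
lemma petal_inj (hlo : -1 ≤ lo) (hhi : lo ≤ hi) {out out' i i' : Bool} {s t : ℝ}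
    (hs : s ∈ Set.Ioo (0 : ℝ) 1) (ht : t ∈ Set.Ioo (0 : ℝ) 1)
    (h : (petal out i).curve e lo hi s = (petal out' i').curve e lo hi t) :
    petal out i = petal out' i' ∧ s = t := by
  have hn := congrArg norm₁ h
  have hlh : (lo : ℝ) ≤ hi := by exact_mod_cast hhi
  have hlo' : (-1 : ℝ) ≤ lo := by exact_mod_cast hlo
  obtain rfl : out = out' := by
    cases out <;> cases out'
    · rfl
    · have h1 := norm₁_petal_inner (e := e) (hi := hi) hlo i hs
      have h2 := norm₁_petal_outer (e := e) hlo hhi i' ht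
      linarith
    · have h1 := norm₁_petal_inner (e := e) (hi := hi) hlo i' ht
      have h2 := norm₁_petal_outer (e := e) hlo hhi i hs
      linarith
    · rfl
  have hτs : 0 < s * (1 - s) := mul_pos hs.1 (by linarith [hs.2])
  have hτt : 0 < t * (1 - t) := mul_pos ht.1 (by linarith [ht.2])
  have hs1 : s * (1 - s) < 1 := by nlinarith [mul_pos hs.1 hs.1, hs.2]
  have ht1 : t * (1 - t) < 1 := by nlinarith [mul_pos ht.1 ht.1, ht.2]
  obtain ⟨hx, hy⟩ := rotated_inj h
  simp only [xc, yc] at hx hy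
  set r : ℝ := ((bif out then hi else lo : ℤ) : ℝ) + 2 with hr
  set σ : ℝ := bif out then 1 else -1 with hσ
  have hr0 : 0 < r := by cases out <;> simp [hr] <;> linarith
  have hσ2 : σ * σ = 1 := by cases out <;> simp [hσ]
  have hpos : ∀ τ : ℝ, 0 < τ → τ < 1 → 0 < r * (1 + σ * τ) := fun τ h0 h1 =>
    mul_pos hr0 (by cases out <;> simp [hσ] <;> linarith)
  obtain rfl := sgn_mul_inj (hpos _ hτs hs1) (hpos _ hτt ht1) hx
  have hs0 : sgn i ≠ 0 := by cases i <;> simp [sgn]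
  have hx' := mul_left_cancel₀ hr0.ne' (mul_right_cancel₀ hs0 hx)
  have hy' := mul_left_cancel₀ hr0.ne' (mul_right_cancel₀ hs0 hy)
  have hτ : s * (1 - s) = t * (1 - t) := by
    linear_combination σ * hx' - (s * (1 - s) - t * (1 - t)) * hσ2
  rw [hτ] at hy'
  have hst : t * (1 - t) * (s - t) = 0 := by linear_combination -hy'
  exact ⟨rfl, sub_eq_zero.1 ((mul_eq_zero.1 hst).resolve_left hτt.ne')⟩

/-- The radius separates the kinds: it is non-integral on a step, integral on a level arc, and
outside the interval from lo + 2 to hi + 2 on a petal. -/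
lemma curve_inj (hlo : -1 ≤ lo) (hhi : lo ≤ hi) {a b : Arc} (ha : a.Valid e lo hi)
    (hb : b.Valid e lo hi) {s t : ℝ} (hs : s ∈ Set.Ioo (0 : ℝ) 1) (ht : t ∈ Set.Ioo (0 : ℝ) 1)
    (h : a.curve e lo hi s = b.curve e lo hi t) : a = b ∧ s = t := by
  have hlh : (lo : ℝ) ≤ hi := by exact_mod_cast hhi
  have step_level : ∀ {k i j l s t}, (step k i j).Valid e lo hi → (level l).Valid e lo hi →
      s ∈ Set.Ioo (0 : ℝ) 1 → t ∈ Set.Ioo (0 : ℝ) 1 →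
      (step k i j).curve e lo hi s ≠ (level l).curve e lo hi t := by
    intro k i j l s t ha hb hs ht h
    have hn := congrArg norm₁ h
    rw [norm₁_step hlo ha.1 i j hs, norm₁_level hlo hb.1 ht] at hn
    exact int_add_ne (k := k) (l := l) hs (by linarith)
  have step_petal : ∀ {k i j out l s t}, (step k i j).Valid e lo hi →
      s ∈ Set.Ioo (0 : ℝ) 1 → t ∈ Set.Ioo (0 : ℝ) 1 →
      (step k i j).curve e lo hi s ≠ (petal out l).curve e lo hi t := by
    intro k i j out l s t ha hs ht h
    have hn := congrArg norm₁ h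
    rw [norm₁_step hlo ha.1 i j hs] at hn
    have h1 : (lo : ℝ) ≤ k := by exact_mod_cast ha.1
    have h2 : (k : ℝ) + 1 ≤ hi := by exact_mod_cast ha.2.1
    cases out
    · linarith [norm₁_petal_inner (e := e) (hi := hi) hlo l ht, hs.1]
    · linarith [norm₁_petal_outer (e := e) hlo hhi l ht, hs.2]
  have level_petal : ∀ {k out l s t}, (level k).Valid e lo hi →
      s ∈ Set.Ioo (0 : ℝ) 1 → t ∈ Set.Ioo (0 : ℝ) 1 →
      (level k).curve e lo hi s ≠ (petal out l).curve e lo hi t := by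
    intro k out l s t ha hs ht h
    have hn := congrArg norm₁ h
    rw [norm₁_level hlo ha.1 hs] at hn
    have h1 : (lo : ℝ) ≤ k := by exact_mod_cast ha.1
    have h2 : (k : ℝ) ≤ hi := by exact_mod_cast ha.2
    cases out
    · linarith [norm₁_petal_inner (e := e) (hi := hi) hlo l ht]
    · linarith [norm₁_petal_outer (e := e) hlo hhi l ht]
  cases a with
  | step k i j =>
    cases b with
    | step l i' j' => exact step_inj hlo ha hb hs ht h
    | level l => exact absurd h (step_level ha hb hs ht)
    | petal out i' => exact absurd h (step_petal ha hs ht)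
  | level k =>
    cases b with
    | step l i' j' => exact absurd h.symm (step_level hb ha ht hs)
    | level l => exact level_inj hlo ha hb hs ht h
    | petal out i' => exact absurd h (level_petal ha hs ht)
  | petal out i =>
    cases b with
    | step l i' j' => exact absurd h.symm (step_petal hb ht hs)
    | level l => exact absurd h.symm (level_petal hb ht hs)
    | petal out' i' => exact petal_inj hlo hhi hs ht h

end Arc

lemma mkV_mem {V : Type*} {W : SimpleGraph V} {Γ : Subgroup (W ≃g W)} (u : V) :
    mkV Γ u ∈ V(quotientGraph W Γ) :=
  Set.mem_univ _

/-- A quotient of a strip is planar if its edges are represented by the arcs of an annular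
drawing. -/
theorem isPlanar_of_arcs {W : SimpleGraph (ℤ × Bool)} {Γ : Subgroup (W ≃g W)} (e : ℤ → ℤ)
    {lo hi : ℤ} (hlo : -1 ≤ lo) (hhi : lo ≤ hi) (S : Set Arc) (hS : ∀ a ∈ S, a.Valid e lo hi)
    {F : Finset (ℤ × Bool)} (hF : IsFundamental Γ F) (hFcol : ∀ u ∈ F, lo ≤ u.1 ∧ u.1 ≤ hi)
    (hSF : ∀ a ∈ S, a.src lo hi ∈ F ∧ a.dst lo hi ∈ F)
    (E : Arc → (ℤ × Bool) × (ℤ × Bool))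
    (hE : ∀ a ∈ S, W.Adj (E a).1 (E a).2 ∧ mkV Γ (E a).1 = mkV Γ (a.src lo hi) ∧
      mkV Γ (E a).2 = mkV Γ (a.dst lo hi))
    (hcov : ∀ u v, W.Adj u v → mkE Γ u v ∈ (fun a => mkE Γ (E a).1 (E a).2) '' S) :
    IsPlanar (quotientGraph W Γ) := by
  have hrep : ∀ x : V(quotientGraph W Γ), ∃ u ∈ F, mkV Γ u = x := by
    rintro ⟨x, hx⟩
    obtain ⟨u, rfl⟩ := mkV_surjective x
    exact hF.surj u
  choose rep hrepF hrep using hrep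
  have hrep' : ∀ u ∈ F, rep ⟨mkV Γ u, mkV_mem _⟩ = u := fun u hu =>
    hF.inj _ (hrepF _) u hu (hrep _)
  -- Each edge selects one arc. The arc determines its edge through `E`, so different edges receive
  -- different arcs even if several arcs represent the same edge. `E` is needed because an edge of
  -- the strip may leave the fundamental set while its arc joins representatives inside it.
  have harc : ∀ x : E(quotientGraph W Γ), ∃ a ∈ S, mkE Γ (E a).1 (E a).2 = x := by
    rintro ⟨x, hx⟩
    obtain ⟨_, _, u, v, huv, rfl, -, -⟩ := (quotientGraph W Γ).edge_mem_iff_exists_isLink x |>.1 hx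
    exact hcov u v huv
  choose arc harcS harc using harc
  have hIoo : ∀ t : unitInterval, t ∈ Set.Ioo (0 : unitInterval) 1 → (t : ℝ) ∈ Set.Ioo (0 : ℝ) 1 :=
    fun t ht => ⟨ht.1, ht.2⟩
  refine ⟨fun x => pos e (rep x),
    fun x => ⟨fun t => (arc x).curve e lo hi t, (arc x).continuous_curve.comp continuous_subtype_val⟩,
    ?_, ?_, ?_, ?_⟩
  · intro x y h
    have := Arc.pos_inj hlo (hFcol _ (hrepF x)).1 (hFcol _ (hrepF y)).1 h
    exact Subtype.ext (by rw [← hrep x, ← hrep y, this])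
  · intro x
    obtain ⟨h1, h2⟩ := hSF _ (harcS x)
    obtain ⟨h3, h4, h5⟩ := hE _ (harcS x)
    refine ⟨⟨mkV Γ ((arc x).src lo hi), mkV_mem _⟩, ⟨mkV Γ ((arc x).dst lo hi), mkV_mem _⟩,
      ?_, ?_, ?_⟩
    · have := isLink_mkE (Γ := Γ) h3
      rwa [h4, h5, harc x] at this
    · dsimp only
      rw [hrep' _ h1, ← Arc.curve_zero]
      rfl
    · dsimp only
      rw [hrep' _ h2, ← Arc.curve_one (hS _ (harcS x))]
      rfl
  · intro x y s hs t ht h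
    obtain ⟨h1, h2⟩ := Arc.curve_inj hlo hhi (hS _ (harcS x)) (hS _ (harcS y)) (hIoo s hs)
      (hIoo t ht) h
    exact ⟨Subtype.ext (by rw [← harc x, ← harc y, h1]), Subtype.ext h2⟩
  · intro x t ht y h
    obtain ⟨h1, h2⟩ := hFcol _ (hrepF y)
    exact Arc.curve_ne_pos hlo hhi (hS _ (harcS x)) (hIoo t ht) h1 h2 h

end Drawing

/-! ### The planar examples -/

section PlanarExamples

variable {W : SimpleGraph (ℤ × Bool)} {Γ : Subgroup (W ≃g W)}

lemma IsDihedral.mkE_rot {P m : ℤ} (hΓ : IsDihedral Γ P m) (j : ℤ) {k k' l l' : ℤ} (i i' : Bool)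
    (hk : k' = m + P * j - k) (hl : l' = m + P * j - l) :
    mkE Γ (k', !i) (l', !i') = mkE Γ (k, i) (l, i') := by
  obtain ⟨g, hg, h⟩ := hΓ.rot j
  rw [← mkE_map hg (k, i) (l, i'), h, h, hk, hl]

lemma IsDihedral.mkV_rot {P m : ℤ} (hΓ : IsDihedral Γ P m) (j : ℤ) {k k' : ℤ} (i : Bool)
    (hk : k' = m + P * j - k) : mkV Γ (k', !i) = mkV Γ (k, i) :=
  (hΓ.mkV_eq_iff.2 ⟨j, Or.inr (by rw [hk])⟩).symm

/-- To prove a property of all edges of a quotient by a dihedral group it suffices to consider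
the edges between consecutive columns of a fundamental block, those leaving the block at one of
its two ends, and the vertical bars. -/
lemma IsDihedral.edge_induction (hW : IsStrip W) {H m L hi : ℤ} (hH : 0 < H)
    (hΓ : IsDihedral Γ (2 * H) m) (hL : 2 * L - 1 ≤ m) (hL' : m ≤ 2 * L) (hhi : hi = m - L + H)
    {Q : Quotient (edgeSetoid W Γ) → Prop}
    (hstep : ∀ k i j, L ≤ k → k < hi → W.Adj (k, i) (k + 1, j) → Q (mkE Γ (k, i) (k + 1, j)))
    (hlo : ∀ i j, W.Adj (L, i) (L - 1, j) → Q (mkE Γ (L, i) (L - 1, j)))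
    (hup : ∀ i j, W.Adj (hi, i) (hi + 1, j) → Q (mkE Γ (hi, i) (hi + 1, j)))
    (hbar : ∀ k, L ≤ k → k ≤ hi → W.Adj (k, false) (k, true) → Q (mkE Γ (k, false) (k, true)))
    (u v : ℤ × Bool) (huv : W.Adj u v) : Q (mkE Γ u v) := by
  obtain ⟨g, hg, h1, h2⟩ := hΓ.exists_mem_Icc hH hL hL' u
  have huv' : W.Adj (g u) (g v) := g.map_rel_iff.2 huv
  rw [← mkE_map hg]
  generalize g u = u at *
  generalize g v = v at *
  obtain ⟨k, i⟩ := u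
  obtain ⟨l, j⟩ := v
  simp only at h1 h2
  rcases hW.col _ _ huv' with h | h | ⟨h, hij⟩ <;> simp only at h
  · subst h
    rcases (hhi ▸ h2 : k ≤ hi).lt_or_eq with h | rfl
    · exact hstep k i j h1 h huv'
    · exact hup i j huv'
  · obtain rfl : l = k - 1 := by omega
    rcases h1.lt_or_eq with h | rfl
    · have := hstep (k - 1) j i (by omega) (by omega) (by rw [sub_add_cancel]; exact huv'.symm)
      rw [sub_add_cancel, mkE_comm] at this
      exact this
    · exact hlo i j huv'
  · subst h
    cases i <;> cases j
    · exact absurd rfl hij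
    · exact hbar k h1 (by omega) huv'
    · rw [mkE_comm]
      exact hbar k h1 (by omega) huv'.symm
    · exact absurd rfl hij

lemma WbarB_adj_succ {k : ℤ} {i j : Bool} :
    WbarB.Adj (k, i) (k + 1, j) ↔ k % 2 = 0 ∨ i = j := by
  simp only [WbarB, true_and, or_iff_left_iff_imp]
  omega

lemma WbarA_adj_succ {k : ℤ} {i j : Bool} :
    WbarA.Adj (k, i) (k + 1, j) ↔ k % 3 = 0 ∨ i = j := by
  simp only [WbarA, true_and, or_iff_left_iff_imp]
  omega

lemma WbarB_adj_bar {k : ℤ} {i j : Bool} : ¬ WbarB.Adj (k, i) (k, j) := by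
  simp only [WbarB]
  omega

lemma WbarA_adj_bar {k : ℤ} {i j : Bool} : WbarA.Adj (k, i) (k, j) ↔ k % 3 = 2 ∧ i ≠ j := by
  simp only [WbarA, true_and]
  constructor
  · rintro (h | h | h)
    · omega
    · omega
    · exact h
  · exact fun h => Or.inr (Or.inr h)

/-- The angle (k + 1) / 2 advances exactly at the hourglasses, that is, at even k. At either end the
rotation folds the two outgoing row edges onto each other, giving one edge between the two vertices
of the end column: a level arc. -/
theorem isPlanar_capB {n : ℕ} (hn : 1 ≤ n) : IsPlanar (capB n) := by
  have hΓ := isDihedral_capB n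
  set Γ := Subgroup.closure {rotB 0, rotB n}
  set hi : ℤ := 2 * n - 1 with hhi
  have adj_lo : ∀ i, WbarB.Adj (0, i) (-1, i) := fun i =>
    (WbarB_adj_succ.2 (Or.inr rfl) : WbarB.Adj (-1, i) (-1 + 1, i)).symm
  refine isPlanar_of_arcs (fun k => (k + 1) / 2) (lo := 0) (hi := hi) (by omega) (by omega)
    {a | match a with
      | .step k i j => 0 ≤ k ∧ k < hi ∧ WbarB.Adj (k, i) (k + 1, j)
      | .level k => k = 0 ∨ k = hi
      | .petal _ _ => False} ?_ (hΓ.isFundamental_block (by omega)) ?_ ?_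
    (fun a => match a with
      | .step k i j => ((k, i), (k + 1, j))
      | .level k => if k = 0 then ((0, false), (-1, false)) else ((hi, false), (hi + 1, false))
      | .petal _ i => ((0, i), (0, i))) ?_ ?_
  · rintro (⟨k, i, j⟩ | k | ⟨out, i⟩) h
    · obtain ⟨h1, h2, h3⟩ := h
      refine ⟨h1, h2, ?_⟩
      dsimp only
      rcases Int.emod_two_eq_zero_or_one k with h0 | h0
      · right; omega
      · exact Or.inl ⟨by omega, (WbarB_adj_succ.1 h3).resolve_left (by omega)⟩
    · change k = 0 ∨ k = hi at h
      change 0 ≤ k ∧ k ≤ hi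
      omega
    · trivial
  · intro u hu
    rw [mem_block] at hu
    omega
  · rintro (⟨k, i, j⟩ | k | ⟨out, i⟩) h
    · obtain ⟨h1, h2, h3⟩ := h
      simp only [Arc.src, Arc.dst, mem_block]
      omega
    · change k = 0 ∨ k = hi at h
      simp only [Arc.src, Arc.dst, mem_block]
      omega
    · exact h.elim
  · rintro (⟨k, i, j⟩ | k | ⟨out, i⟩) h
    · exact ⟨h.2.2, rfl, rfl⟩
    · dsimp only
      split_ifs with h0
      · subst h0
        exact ⟨adj_lo false, rfl, (hΓ.mkV_rot 0 false (by omega)).symm⟩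
      · obtain rfl : k = hi := h.resolve_left h0
        exact ⟨WbarB_adj_succ.2 (Or.inr rfl), rfl, (hΓ.mkV_rot 1 false (by push_cast; omega)).symm⟩
    · exact h.elim
  · refine hΓ.edge_induction isStrip_WbarB (L := 0) (hi := hi) (by omega) (by omega) (by omega)
      (by push_cast; omega) ?_ ?_ ?_ ?_
    · intro k i j h1 h2 h3
      exact ⟨.step k i j, ⟨h1, h2, h3⟩, rfl⟩
    · intro i j h
      obtain rfl : i = j := by
        have h' : WbarB.Adj (-1, j) (-1 + 1, i) := h.symm
        exact ((WbarB_adj_succ.1 h').resolve_left (by omega)).symm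
      refine ⟨.level 0, Or.inl rfl, ?_⟩
      dsimp only
      rw [if_pos rfl]
      cases i
      · rfl
      -- The edge leaving in row `true` is the image under the rotation of the one in row `false`,
      -- with its ends reversed.
      · rw [mkE_comm (0, true)]
        exact (hΓ.mkE_rot 0 false false (by omega) (by omega)).symm
    · intro i j h
      obtain rfl : i = j := (WbarB_adj_succ.1 h).resolve_left (by omega)
      refine ⟨.level hi, Or.inr rfl, ?_⟩
      dsimp only
      rw [if_neg (by omega)]
      cases i
      · rfl
      · rw [mkE_comm (hi, true)]
        exact (hΓ.mkE_rot 1 false false (by push_cast; omega) (by push_cast; omega)).symm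
    · intro k _ _ h
      exact absurd h WbarB_adj_bar

/-- The angle (k + 2) / 3 advances at the complete hourglasses. Each end cuts an hourglass in half:
its two horizontal edges become one level arc, and its two diagonals become loops, drawn as petals
at the two end vertices. The vertical bars are the remaining level arcs. -/
theorem isPlanar_capHourglassA {n : ℕ} (hn : 1 ≤ n) : IsPlanar (capHourglassA n) := by
  have hΓ := isDihedral_capHourglassA n
  set Γ := Subgroup.closure {rotHourglass 0, rotHourglass n}
  set hi : ℤ := 3 * n with hhi
  have adj_lo : ∀ i j, WbarA.Adj (1, i) (0, j) := fun i j =>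
    (WbarA_adj_succ.2 (Or.inl rfl) : WbarA.Adj (0, j) (0 + 1, i)).symm
  have adj_hi : ∀ i j, WbarA.Adj (hi, i) (hi + 1, j) := fun i j =>
    WbarA_adj_succ.2 (Or.inl (by omega))
  refine isPlanar_of_arcs (fun k => (k + 2) / 3) (lo := 1) (hi := hi) (by omega) (by omega)
    {a | match a with
      | .step k i j => 1 ≤ k ∧ k < hi ∧ WbarA.Adj (k, i) (k + 1, j)
      | .level k => k = 1 ∨ k = hi ∨ (1 ≤ k ∧ k ≤ hi ∧ k % 3 = 2)
      | .petal _ _ => True} ?_ (hΓ.isFundamental_block (by omega)) ?_ ?_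
    (fun a => match a with
      | .step k i j => ((k, i), (k + 1, j))
      | .level k => if k = 1 then ((1, false), (0, false)) else
          if k = hi then ((hi, false), (hi + 1, false)) else ((k, false), (k, true))
      | .petal false i => ((1, i), (0, !i))
      | .petal true i => ((hi, i), (hi + 1, !i))) ?_ ?_
  · rintro (⟨k, i, j⟩ | k | ⟨out, i⟩) h
    · obtain ⟨h1, h2, h3⟩ := h
      refine ⟨h1, h2, ?_⟩
      dsimp only
      by_cases h0 : k % 3 = 0
      · right; omega
      · exact Or.inl ⟨by omega, (WbarA_adj_succ.1 h3).resolve_left h0⟩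
    · change k = 1 ∨ k = hi ∨ (1 ≤ k ∧ k ≤ hi ∧ k % 3 = 2) at h
      change 1 ≤ k ∧ k ≤ hi
      omega
    · trivial
  · intro u hu
    rw [mem_block] at hu
    omega
  · rintro (⟨k, i, j⟩ | k | ⟨out, i⟩) h
    · obtain ⟨h1, h2, h3⟩ := h
      simp only [Arc.src, Arc.dst, mem_block]
      omega
    · change k = 1 ∨ k = hi ∨ (1 ≤ k ∧ k ≤ hi ∧ k % 3 = 2) at h
      simp only [Arc.src, Arc.dst, mem_block]
      omega
    · cases out <;> simp only [Arc.src, Arc.dst, mem_block, cond_true, cond_false] <;> omega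
  · rintro (⟨k, i, j⟩ | k | ⟨_ | _, i⟩) h
    · exact ⟨h.2.2, rfl, rfl⟩
    · dsimp only
      split_ifs with h0 h1
      · subst h0
        exact ⟨adj_lo _ _, rfl, (hΓ.mkV_rot 0 false (by omega)).symm⟩
      · subst h1
        exact ⟨adj_hi _ _, rfl, (hΓ.mkV_rot 1 false (by push_cast; omega)).symm⟩
      · exact ⟨WbarA_adj_bar.2 ⟨((h.resolve_left h0).resolve_left h1).2.2, by simp⟩, rfl, rfl⟩
    · exact ⟨adj_lo _ _, rfl, hΓ.mkV_rot 0 i (by simp)⟩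
    · exact ⟨adj_hi _ _, rfl, hΓ.mkV_rot 1 i (by simp; omega)⟩
  · refine hΓ.edge_induction isStrip_WbarA (L := 1) (hi := hi) (by omega) (by omega) (by omega)
      (by push_cast; omega) ?_ ?_ ?_ ?_
    · intro k i j h1 h2 h3
      exact ⟨.step k i j, ⟨h1, h2, h3⟩, rfl⟩
    · intro i j _
      by_cases hij : i = j
      · subst hij
        refine ⟨.level 1, Or.inl rfl, ?_⟩
        dsimp only
        rw [if_pos rfl]
        cases i
        · rfl
        · rw [mkE_comm (1, true)]
          exact (hΓ.mkE_rot 0 false false (by omega) (by omega)).symm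
      · obtain rfl : j = !i := by cases i <;> cases j <;> simp at hij ⊢
        exact ⟨.petal false i, trivial, rfl⟩
    · intro i j _
      by_cases hij : i = j
      · subst hij
        refine ⟨.level hi, Or.inr (Or.inl rfl), ?_⟩
        dsimp only
        rw [if_neg (by omega), if_pos rfl]
        cases i
        · rfl
        · rw [mkE_comm (hi, true)]
          exact (hΓ.mkE_rot 1 false false (by push_cast; omega) (by push_cast; omega)).symm
      · obtain rfl : j = !i := by cases i <;> cases j <;> simp at hij ⊢
        exact ⟨.petal true i, trivial, rfl⟩
    · intro k h1 h2 h
      have h3 := (WbarA_adj_bar.1 h).1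
      refine ⟨.level k, Or.inr (Or.inr ⟨h1, h2, h3⟩), ?_⟩
      dsimp only
      rw [if_neg (by omega), if_neg (by omega)]

/-- In each end column the two vertices are identified and the bar becomes a loop. The remaining
vertex is joined to both vertices of the next column, so the angle needs an additional quarter turn
there, whence the exceptional values -1 and n + 1. For these end steps the edge in the strip is a
row edge, although its arc may change rows after the identification. -/
theorem isPlanar_capBarA {n : ℕ} (hn : 1 ≤ n) : IsPlanar (capBarA n) := by
  have hΓ := isDihedral_capBarA n
  set Γ := Subgroup.closure {rotBar 0, rotBar n}
  set hi : ℤ := 3 * n - 1 with hhi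
  have flip_lo : ∀ i, mkV Γ (-1, i) = mkV Γ (-1, false) := fun i => by
    cases i
    · rfl
    · exact hΓ.mkV_rot 0 false (by omega)
  have flip_hi : ∀ i, mkV Γ (hi, i) = mkV Γ (hi, false) := fun i => by
    cases i
    · rfl
    · exact hΓ.mkV_rot 1 false (by push_cast; omega)
  refine isPlanar_of_arcs
    (fun k => if k = -1 then -1 else if k = hi then n + 1 else (k + 2) / 3)
    (lo := -1) (hi := hi) (by omega) (by omega)
    {a | match a with
      | .step k i j => -1 ≤ k ∧ k < hi ∧ (k = -1 → i = false) ∧ (k + 1 = hi → j = false) ∧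
          (k = -1 ∨ k + 1 = hi ∨ WbarA.Adj (k, i) (k + 1, j))
      | .level k => -1 < k ∧ k < hi ∧ k % 3 = 2
      | .petal _ i => i = false} ?_ (hΓ.isFundamental_cappedBlock (by omega)) ?_ ?_
    (fun a => match a with
      | .step k i j => if k = -1 then ((k, j), (k + 1, j)) else
          if k + 1 = hi then ((k, i), (k + 1, i)) else ((k, i), (k + 1, j))
      | .level k => ((k, false), (k, true))
      | .petal false _ => ((-1, false), (-1, true))
      | .petal true _ => ((hi, false), (hi, true))) ?_ ?_
  · rintro (⟨k, i, j⟩ | k | ⟨out, i⟩) h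
    · obtain ⟨h1, h2, h3, h4, h5⟩ := h
      refine ⟨h1, h2, ?_⟩
      dsimp only
      rw [if_neg (by omega : k + 1 ≠ -1), if_neg (by omega : k ≠ hi)]
      by_cases hk : k = -1
      · right
        rw [if_pos hk, if_neg (by omega)]
        omega
      · rw [if_neg hk]
        by_cases hk' : k + 1 = hi
        · right
          rw [if_pos hk']
          omega
        · rw [if_neg hk']
          by_cases h0 : k % 3 = 0
          · right; omega
          · exact Or.inl ⟨by omega,
              (WbarA_adj_succ.1 ((h5.resolve_left hk).resolve_left hk')).resolve_left h0⟩
    · exact ⟨h.1.le, h.2.1.le⟩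
    · trivial
  · intro u hu
    rw [mem_cappedBlock] at hu
    rcases hu with rfl | rfl | h
    · dsimp only; omega
    · dsimp only; push_cast; omega
    · push_cast at h; omega
  · rintro (⟨k, i, j⟩ | k | ⟨out, i⟩) h
    · obtain ⟨h1, h2, h3, h4, -⟩ := h
      simp only [Arc.src, Arc.dst, mem_cappedBlock, Prod.mk.injEq]
      push_cast
      constructor
      · by_cases hk : k = -1
        · exact Or.inl ⟨hk, h3 hk⟩
        · right; right; omega
      · by_cases hk : k + 1 = hi
        · exact Or.inr (Or.inl ⟨by omega, h4 hk⟩)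
        · right; right; omega
    · obtain ⟨h1, h2, -⟩ := h
      simp only [Arc.src, Arc.dst, mem_cappedBlock]
      push_cast
      constructor <;> right <;> right <;> omega
    · obtain rfl : i = false := h
      cases out <;> simp only [Arc.src, Arc.dst, mem_cappedBlock, cond_true, cond_false,
        Prod.mk.injEq, and_true] <;> push_cast
      · exact ⟨Or.inl trivial, Or.inl trivial⟩
      · omega
  · rintro (⟨k, i, j⟩ | k | ⟨_ | _, i⟩) h
    · obtain ⟨h1, h2, h3, h4, h5⟩ := h
      dsimp only [Arc.src, Arc.dst]
      split_ifs with hk hk'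
      · refine ⟨WbarA_adj_succ.2 (Or.inr rfl), ?_, rfl⟩
        subst hk
        rw [h3 rfl, flip_lo]
      · refine ⟨WbarA_adj_succ.2 (Or.inr rfl), rfl, ?_⟩
        rw [h4 hk', hk', flip_hi]
      · exact ⟨(h5.resolve_left hk).resolve_left hk', rfl, rfl⟩
    · exact ⟨WbarA_adj_bar.2 ⟨h.2.2, by simp⟩, rfl, rfl⟩
    · obtain rfl : i = false := h
      exact ⟨WbarA_adj_bar.2 ⟨by omega, by simp⟩, rfl, flip_lo true⟩
    · obtain rfl : i = false := h
      exact ⟨WbarA_adj_bar.2 ⟨by omega, by simp⟩, rfl, flip_hi true⟩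
  · refine hΓ.edge_induction isStrip_WbarA (L := -1) (hi := hi) (by omega) (by omega) (by omega)
      (by push_cast; omega) ?_ ?_ ?_ ?_
    · intro k i j h1 h2 h3
      by_cases hk : k = -1
      · obtain rfl : i = j := (WbarA_adj_succ.1 h3).resolve_left (by omega)
        refine ⟨.step k false i, ⟨h1, h2, fun _ => rfl, fun _ => by omega, Or.inl hk⟩, ?_⟩
        dsimp only
        rw [if_pos hk]
      · by_cases hk' : k + 1 = hi
        · obtain rfl : i = j := (WbarA_adj_succ.1 h3).resolve_left (by omega)
          refine ⟨.step k i false, ⟨h1, h2, fun h => absurd h hk, fun _ => rfl,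
            Or.inr (Or.inl hk')⟩, ?_⟩
          dsimp only
          rw [if_neg hk, if_pos hk']
        · refine ⟨.step k i j, ⟨h1, h2, fun h => absurd h hk, fun h => absurd h hk',
            Or.inr (Or.inr h3)⟩, ?_⟩
          dsimp only
          rw [if_neg hk, if_neg hk']
    · intro i j h
      obtain rfl : i = j := by
        have h' := h.symm
        rw [show (-1 : ℤ) = -1 - 1 + 1 by norm_num, add_sub_cancel_right] at h'
        exact ((WbarA_adj_succ.1 h').resolve_left (by omega)).symm
      -- The rotation about column -1 sends the edge from (-1, i) to (-2, i) to the one from (-1,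
      -- !i) to (0, !i).
      refine ⟨.step (-1) false (!i), ⟨by omega, by omega, fun _ => rfl, fun _ => by omega,
        Or.inl rfl⟩, ?_⟩
      dsimp only
      rw [if_pos rfl]
      exact hΓ.mkE_rot 0 i i (by omega) (by omega)
    · intro i j h
      obtain rfl : i = j := (WbarA_adj_succ.1 h).resolve_left (by omega)
      refine ⟨.step (hi - 1) (!i) false, ⟨by omega, by omega, fun _ => by omega, fun _ => rfl,
        Or.inr (Or.inl (by omega))⟩, ?_⟩
      dsimp only
      rw [if_neg (by omega), if_pos (by omega), mkE_comm]
      exact hΓ.mkE_rot 1 i i (by push_cast; omega) (by push_cast; omega)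
    · intro k h1 h2 h
      have h3 := (WbarA_adj_bar.1 h).1
      rcases h1.lt_or_eq with h1 | rfl
      · rcases h2.lt_or_eq with h2 | rfl
        · exact ⟨.level k, ⟨h1, h2, h3⟩, rfl⟩
        · exact ⟨.petal true false, rfl, rfl⟩
      · exact ⟨.petal false false, rfl, rfl⟩

end PlanarExamples

/-! ### Gap sets from families of quotients -/

section GapSets

/-- A class of cubic multigraphs containing arbitrarily large members with spectrum in
`[-3, 3] \ I` has the gap set `I`. -/
lemma isGapSetFor_of_hasGap {P : ∀ ⦃α β : Type⦄, Graph α β → Prop} {I : Set ℝ} (hI : IsOpen I)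
    (hI3 : I ⊆ Set.Icc (-3) 3) {α β : ℕ → Type} (G : ∀ n, Graph (α n) (β n)) {c : ℕ} (hc : 1 ≤ c)
    (hG : ∀ n, 1 ≤ n → HasGap (G n) (c * n) I ∧ P (G n)) : IsGapSetFor P I := by
  refine ⟨Set.Icc (-3) 3 \ I, ⟨isClosed_Icc.sdiff hI, Set.sdiff_subset, fun N => ?_⟩, ?_⟩
  · obtain ⟨⟨hfin, hcub, hcard, hspec⟩, hP⟩ := hG (N + 1) (by omega)
    refine ⟨_, _, G (N + 1), hfin, hcub, hP, ?_, hspec⟩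
    rw [hcard]
    nlinarith
  · rw [Set.sdiff_sdiff_right_self, Set.inter_eq_right.2 hI3]

end GapSets

end CubicGaps

/-! ### Conclusion -/

open CubicGaps
theorem theorem3 :
    -- the two intervals are maximal among the gap intervals of cubic graphs
    Maximal IsGapInterval (Set.Ioo (-1) 1) ∧
    Maximal IsGapInterval (Set.Ioo (-2) 0) ∧
    -- the first is achieved by planar graphs, the second by planar multigraphs
    IsPlanarGapSet (Set.Ioo (-1) 1) ∧
    IsPlanarMultigraphGapSet (Set.Ioo (-2) 0) ∧
    -- the explicit planar examples
    (∀ n : ℕ, 1 ≤ n → IsGappedCubic (capB n) (4 * n) (Set.Ioo (-1) 1) ∧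
      (capB n).Simple ∧ IsPlanar (capB n)) ∧
    (∀ n : ℕ, 1 ≤ n → IsGappedCubic (capBarA n) (6 * n) (Set.Ioo (-2) 0) ∧
      IsPlanar (capBarA n)) ∧
    (∀ n : ℕ, 1 ≤ n → IsGappedCubic (capHourglassA n) (6 * n) (Set.Ioo (-2) 0) ∧
      IsPlanar (capHourglassA n)) ∧
    -- the hamburger graphs
    (∀ n : ℕ, 2 ≤ n → IsGappedCubic (hamburgerB n) (4 * n) (Set.Ioo (-1) 1) ∧
      (hamburgerB n).Simple ∧ (3 ≤ n → ¬ IsPlanar (hamburgerB n))) ∧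
    (∀ n : ℕ, 1 ≤ n → IsGappedCubic (hamburgerA n) (6 * n) (Set.Ioo (-2) 0) ∧
      (hamburgerA n).Simple ∧ (2 ≤ n → ¬ IsPlanar (hamburgerA n))) := by
  have hB3 : Set.Ioo (-1 : ℝ) 1 ⊆ Set.Icc (-3) 3 := fun x hx =>
    ⟨by linarith [hx.1], by linarith [hx.2]⟩
  have hA3 : Set.Ioo (-2 : ℝ) 0 ⊆ Set.Icc (-3) 3 := fun x hx =>
    ⟨by linarith [hx.1], by linarith [hx.2]⟩
  have hB : IsGapInterval (Set.Ioo (-1) 1) := ⟨Set.ordConnected_Ioo,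
    isGapSetFor_of_hasGap isOpen_Ioo hB3 capB (by norm_num)
      fun n hn => ⟨hasGap_capB hn, simple_capB hn⟩⟩
  -- The capped quotients of `WbarA` have loops, so the hamburger graphs serve as the simple
  -- examples here.
  have hA : IsGapInterval (Set.Ioo (-2) 0) := ⟨Set.ordConnected_Ioo,
    isGapSetFor_of_hasGap isOpen_Ioo hA3 hamburgerA (by norm_num)
      fun n hn => ⟨hasGap_hamburgerA hn, simple_hamburgerA hn⟩⟩
  refine ⟨?_, ?_, ?_, ?_, ?_, ?_, ?_, ?_, ?_⟩
  · have h := IsGapInterval.maximal (c₀ := 0) le_rfl (by norm_num)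
    norm_num at h
    exact h hB
  · have h := IsGapInterval.maximal (c₀ := -1) (by norm_num) (by norm_num)
    norm_num at h
    exact h hA
  · exact isGapSetFor_of_hasGap isOpen_Ioo hB3 capB (by norm_num)
      fun n hn => ⟨hasGap_capB hn, simple_capB hn, isPlanar_capB hn⟩
  · exact isGapSetFor_of_hasGap isOpen_Ioo hA3 capBarA (by norm_num)
      fun n hn => ⟨hasGap_capBarA hn, isPlanar_capBarA hn⟩
  · exact fun n hn => ⟨(hasGap_capB hn).isGappedCubic, simple_capB hn, isPlanar_capB hn⟩
  · exact fun n hn => ⟨(hasGap_capBarA hn).isGappedCubic, isPlanar_capBarA hn⟩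
  · exact fun n hn => ⟨(hasGap_capHourglassA hn).isGappedCubic, isPlanar_capHourglassA hn⟩
  · exact fun n hn => ⟨(hasGap_hamburgerB (by omega)).isGappedCubic, simple_hamburgerB hn,
      not_isPlanar_hamburgerB⟩
  · exact fun n hn => ⟨(hasGap_hamburgerA hn).isGappedCubic, simple_hamburgerA hn,
      not_isPlanar_hamburgerA⟩
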